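/- Let $A$ be a finite alphabet. A language over $A$ is piecewise testable if it is a finite Boolean combination of languages of the form $A^*a_1A^*a_2A^*\cdots A^*a_nA^*$ with $n\ge 0$ and $a_1,\dots,a_n\in A$. Two languages $L_1,L_2\subseteq A^*$ are separable by a piecewise testable language if there is a piecewise testable language $L$ with $L_1\subseteq L$ and $L_2\cap L=\varnothing$; equivalently, if there is a $\mathcal{B}\Sigma_1(<)$ sentence (a Boolean combination of purely existential prenex first-order sentences over the order $<$ on positions and the letter predicates) that is satisfied by all words of $L_1$ and by no word of $L_2$. Theorem. There are a (multi-stack) Turing machine $M$ and a polynomial $p$ such that the following holds. Let $\mathcal{A}_1,\mathcal{A}_2$ be two NFAs (any number of initial and final states, no $\varepsilon$-transitions) with $n_1$ and $n_2$ states over a common alphabet with $k$ letters, given to $M$ as a bit string consisting of $k,n_1,n_2$ in unary followed by the bit tables of initial states, final states and transitions of each NFA. Then $M$ halts after at most $p(n_1+n_2+k)$ steps, and its output bit tells whether $L(\mathcal{A}_1)$ and $L(\mathcal{A}_2)$ are separable by a piecewise testable language (equivalently, by a $\mathcal{B}\Sigma_1(<)$ sentence). -/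

import Mathlib

namespace PTSep

/-- For `u = a₁ a₂ ⋯ aₙ`, the language `A* a₁ A* a₂ A* ⋯ A* aₙ A*` over the alphabet `A = α`. -/
def pieceLanguage {α : Type*} : List α → Language α
  | [] => ⊤
  | a :: u => ⊤ * ({[a]} : Language α) * pieceLanguage u

/-- Piecewise testable languages: the finite Boolean combinations of the languages
`A* a₁ A* ⋯ A* aₙ A*`. -/
inductive IsPiecewiseTestable {α : Type*} : Language α → Prop
  | piece (u : List α) : IsPiecewiseTestable (pieceLanguage u)
  | compl {L : Language α} : IsPiecewiseTestable L → IsPiecewiseTestable Lᶜ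
  | inter {L K : Language α} :
      IsPiecewiseTestable L → IsPiecewiseTestable K → IsPiecewiseTestable (L ⊓ K)
  | union {L K : Language α} :
      IsPiecewiseTestable L → IsPiecewiseTestable K → IsPiecewiseTestable (L ⊔ K)

/-- `L₁` and `L₂` are separable by a piecewise testable language. -/
def PTSeparable {α : Type*} (L₁ L₂ : Language α) : Prop :=
  ∃ L : Language α, IsPiecewiseTestable L ∧ L₁ ≤ L ∧ L₂ ⊓ L = ⊥

/-- The relation symbols of first-order logic on words: the order of positions and, for each
letter `a`, the predicate "the position carries the letter `a`". -/
inductive WordRel (α : Type*) : ℕ → Type _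
  | letter (a : α) : WordRel α 1
  | lt : WordRel α 2

/-- The first-order signature of words over `α` (relational, without function symbols). -/
def wordSignature (α : Type*) : FirstOrder.Language where
  Functions := fun _ => Empty
  Relations := WordRel α

/-- A word viewed as a first-order structure; its elements are its positions. -/
@[reducible]
def wordStructure {α : Type*} (w : List α) : (wordSignature α).Structure (Fin w.length) where
  funMap := fun f => f.elim
  RelMap := fun r => match r with
    | WordRel.letter a => fun x => w.get (x 0) = a
    | WordRel.lt => fun x => x 0 < x 1

/-- The word `w` satisfies the sentence `φ`. -/
def WordSatisfies {α : Type*} (w : List α) (φ : (wordSignature α).Sentence) : Prop :=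
  @FirstOrder.Language.Sentence.Realize (wordSignature α) (Fin w.length) (wordStructure w) φ

/-- The sentences of `BΣ₁(<)`: the Boolean combinations of sentences `∃ x₁ ⋯ ∃ xₙ, ψ` with `ψ`
quantifier-free. -/
inductive IsBSigmaOne {α : Type*} : (wordSignature α).Sentence → Prop
  | existential {φ : (wordSignature α).Sentence} :
      FirstOrder.Language.BoundedFormula.IsExistential φ → IsBSigmaOne φ
  | not {φ : (wordSignature α).Sentence} : IsBSigmaOne φ → IsBSigmaOne φ.not
  | inf {φ ψ : (wordSignature α).Sentence} : IsBSigmaOne φ → IsBSigmaOne ψ → IsBSigmaOne (φ ⊓ ψ)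
  | sup {φ ψ : (wordSignature α).Sentence} : IsBSigmaOne φ → IsBSigmaOne ψ → IsBSigmaOne (φ ⊔ ψ)

/-- Some `BΣ₁(<)` sentence holds in all words of `L₁` and in no word of `L₂`. -/
def BSigmaOneSeparable {α : Type*} (L₁ L₂ : Language α) : Prop :=
  ∃ φ : (wordSignature α).Sentence, IsBSigmaOne φ ∧
    (∀ w ∈ L₁, WordSatisfies w φ) ∧ ∀ w ∈ L₂, ¬ WordSatisfies w φ

open Classical in
/-- The bit table of an NFA with alphabet `{0, …, k - 1}` and states `{0, …, n - 1}`: which states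
are initial, which are final, and, for all `(p, a, q)` in lexicographic order, whether there is a
transition from `p` to `q` labelled `a`. -/
noncomputable def encodeTable {k n : ℕ} (A : NFA (Fin k) (Fin n)) : List Bool :=
  (List.finRange n).map (fun q => decide (q ∈ A.start)) ++
  (List.finRange n).map (fun q => decide (q ∈ A.accept)) ++
  (List.finRange n).flatMap (fun p => (List.finRange k).flatMap (fun a =>
    (List.finRange n).map (fun q => decide (q ∈ A.step p a))))

/-- The number `m` in unary, followed by an end mark. -/
def encodeUnary (m : ℕ) : List Bool :=
  List.replicate m true ++ [false]

/-- A pair of NFAs over a common alphabet as a bit string: the sizes of the alphabet and of the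
two state sets in unary, then the two bit tables. -/
noncomputable def encodePair {k n₁ n₂ : ℕ} (A₁ : NFA (Fin k) (Fin n₁)) (A₂ : NFA (Fin k) (Fin n₂)) :
    List Bool :=
  encodeUnary k ++ encodeUnary n₁ ++ encodeUnary n₂ ++ encodeTable A₁ ++ encodeTable A₂

/-- Started on the bit string `x`, the multi-stack Turing machine `M` halts with the bit `b` as its
output after at most `t` steps. -/
def AnswersWithin (M : Turing.TM2ComputableAux Bool Bool) (x : List Bool) (b : Bool) (t : ℕ) :
    Prop :=
  Nonempty (Turing.TM2OutputsInTime M.tm (x.map M.inputAlphabet.symm)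
    (some ([b].map M.outputAlphabet.symm)) t)

end PTSep

/-! Two words are `m`-equivalent if they have the same subwords of length at most `m`
(`SubwordEquiv`). Over a finite alphabet there are finitely many classes, each a Boolean combination
of pieces; conversely every piecewise testable language and every BΣ₁(<) sentence is blind to
`m`-equivalence for some `m`. Hence both kinds of separability fail exactly if, for every `m`, the
two languages contain `m`-equivalent words (`Entangled`, `ptSeparable_iff`,
`bSigmaOneSeparable_iff`).

For NFAs this infinite family of conditions collapses to reachability in a graph of pairs of states
(`entangled_iff`). An edge reads a common letter in both automata, or it reads in each of them a
word over a common set `B`, passing through a state with a loop whose set of letters is exactly `B`.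
Pumping the loops turns a path into `m`-equivalent words. Conversely, along an ultrafilter every
sequence of words follows a finite pattern of letters and blocks, the blocks being universal to an
unbounded degree (`exists_adequate`). Without redundant items the pattern is determined by the words
that are subwords of almost all terms (`Reduced.eq_of_ideal_eq`), so two sequences whose `n`-th
terms are `n`-equivalent share a pattern. By the pigeonhole principle a sufficiently universal block
contains a loop using all its letters (`Universal.exists_blockRun`), and the pattern becomes a path.

Block edges quantify over exponentially many sets `B`, but for fixed loop states there is a largest
set to consider: starting from the whole alphabet, letters that lie on no loop over the remaining
letters, in one automaton or the other, are discarded until nothing changes. A block edge then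
amounts to reachability over the remaining letters (`exists_blockRun_iff`), and everything is a
saturation of sets of polynomial size.

The algorithm is written in a language of bounded loops over bit arrays (`Cmd`), translated to
structured stack programs (`SProg`) and these to machine code. Hoare triples with time bounds
accompany each level, so the polynomial can be read off the syntax of the program. -/

namespace PTSep

/-! ### Subword equivalence; patterns and their ideals. -/

section Subwords

variable {α : Type*}

/-- `w` and `w'` have the same subwords of length at most `m`. -/
def SubwordEquiv (m : ℕ) (w w' : List α) : Prop :=
  ∀ u : List α, u.length ≤ m → (u.Sublist w ↔ u.Sublist w')

theorem SubwordEquiv.symm {m : ℕ} {w w' : List α} (h : SubwordEquiv m w w') :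
    SubwordEquiv m w' w := fun u hu => (h u hu).symm

theorem SubwordEquiv.mono {m n : ℕ} (hmn : m ≤ n) {w w' : List α} (h : SubwordEquiv n w w') :
    SubwordEquiv m w w' := fun u hu => h u (hu.trans hmn)

theorem SubwordEquiv.refl (m : ℕ) (w : List α) : SubwordEquiv m w w := fun _ _ => Iff.rfl

/-- A short subword of a product splits into short subwords of the factors, so the equivalence is a
congruence. -/
theorem SubwordEquiv.append {m : ℕ} {w₁ w₁' w₂ w₂' : List α} (h₁ : SubwordEquiv m w₁ w₁')
    (h₂ : SubwordEquiv m w₂ w₂') : SubwordEquiv m (w₁ ++ w₂) (w₁' ++ w₂') := by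
  intro u hu
  simp only [List.sublist_append_iff]
  constructor
  · rintro ⟨a, b, rfl, ha, hb⟩
    simp only [List.length_append] at hu
    exact ⟨a, b, rfl, (h₁ a (by omega)).1 ha, (h₂ b (by omega)).1 hb⟩
  · rintro ⟨a, b, rfl, ha, hb⟩
    simp only [List.length_append] at hu
    exact ⟨a, b, rfl, (h₁ a (by omega)).2 ha, (h₂ b (by omega)).2 hb⟩

/-- `w` is a word over `B` that contains all words over `B` of length at most `m` as subwords. -/
def Universal (m : ℕ) (B : Finset α) (w : List α) : Prop :=
  (∀ a ∈ w, a ∈ B) ∧ ∀ u : List α, u.length ≤ m → (∀ a ∈ u, a ∈ B) → u.Sublist w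

/-- Up to length `m`, the subwords of either word are exactly the words over `B`. -/
theorem Universal.subwordEquiv {m : ℕ} {B : Finset α} {w w' : List α} (h : Universal m B w)
    (h' : Universal m B w') : SubwordEquiv m w w' := by
  intro u hu
  constructor
  · intro hs
    exact h'.2 u hu fun a ha => h.1 a (hs.subset ha)
  · intro hs
    exact h.2 u hu fun a ha => h'.1 a (hs.subset ha)

/-- The items of a pattern: a letter, or a set of letters. -/
inductive Item (α : Type*)
  | letter (a : α) : Item α
  | block (B : Finset α) : Item α

/-- The words that follow a pattern, all blocks being `m`-universal. -/
def Follows (m : ℕ) : List (Item α) → List α → Prop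
  | [], w => w = []
  | Item.letter a :: P, w => ∃ v, w = a :: v ∧ Follows m P v
  | Item.block B :: P, w => ∃ x v, w = x ++ v ∧ Universal m B x ∧ Follows m P v

/-- The subwords of the words that follow a pattern. -/
def Ideal : List (Item α) → List α → Prop
  | [], w => w = []
  | Item.letter a :: P, w => Ideal P w ∨ ∃ v, w = a :: v ∧ Ideal P v
  | Item.block B :: P, w => ∃ x v, w = x ++ v ∧ (∀ a ∈ x, a ∈ B) ∧ Ideal P v

theorem follows_append {m : ℕ} : ∀ {P Q : List (Item α)} {w : List α},
    Follows m (P ++ Q) w ↔ ∃ x y, w = x ++ y ∧ Follows m P x ∧ Follows m Q y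
  | [], Q, w => by
      constructor
      · intro h; exact ⟨[], w, rfl, rfl, h⟩
      · rintro ⟨x, y, rfl, hx, hy⟩
        cases hx; exact hy
  | Item.letter a :: P, Q, w => by
      simp only [List.cons_append, Follows]
      constructor
      · rintro ⟨v, rfl, hv⟩
        obtain ⟨x, y, rfl, hx, hy⟩ := follows_append.1 hv
        exact ⟨a :: x, y, rfl, ⟨x, rfl, hx⟩, hy⟩
      · rintro ⟨x, y, rfl, ⟨v, rfl, hv⟩, hy⟩
        exact ⟨v ++ y, rfl, follows_append.2 ⟨v, y, rfl, hv, hy⟩⟩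
  | Item.block B :: P, Q, w => by
      simp only [List.cons_append, Follows]
      constructor
      · rintro ⟨z, v, rfl, hz, hv⟩
        obtain ⟨x, y, rfl, hx, hy⟩ := follows_append.1 hv
        exact ⟨z ++ x, y, by simp, ⟨z, x, rfl, hz, hx⟩, hy⟩
      · rintro ⟨x, y, rfl, ⟨z, v, rfl, hz, hv⟩, hy⟩
        exact ⟨z, v ++ y, by simp, hz, follows_append.2 ⟨v, y, rfl, hv, hy⟩⟩

theorem Ideal.nil : ∀ P : List (Item α), Ideal P []
  | [] => rfl
  | Item.letter _ :: P => Or.inl (Ideal.nil P)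
  | Item.block _ :: P => ⟨[], [], rfl, by simp, Ideal.nil P⟩

theorem Ideal.sublist : ∀ {P : List (Item α)} {u w : List α}, u.Sublist w → Ideal P w → Ideal P u
  | [], u, w, h, hw => by
      cases hw
      exact List.sublist_nil.1 h
  | Item.letter a :: P, u, w, h, hw => by
      rcases hw with hw | ⟨v, rfl, hv⟩
      · exact Or.inl (Ideal.sublist h hw)
      · rcases List.sublist_cons_iff.1 h with h' | ⟨r, rfl, h'⟩
        · exact Or.inl (Ideal.sublist h' hv)
        · replace h := h'
          exact Or.inr ⟨r, rfl, Ideal.sublist h hv⟩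
  | Item.block B :: P, u, w, h, hw => by
      obtain ⟨x, v, rfl, hx, hv⟩ := hw
      obtain ⟨u₁, u₂, rfl, h₁, h₂⟩ := List.sublist_append_iff.1 h
      exact ⟨u₁, u₂, rfl, fun a ha => hx a (h₁.subset ha), Ideal.sublist h₂ hv⟩

theorem Follows.ideal {m : ℕ} : ∀ {P : List (Item α)} {w : List α}, Follows m P w → Ideal P w
  | [], _, h => h
  | Item.letter _ :: _, _, ⟨v, hw, hv⟩ => Or.inr ⟨v, hw, Follows.ideal hv⟩
  | Item.block _ :: _, _, ⟨x, v, hw, hx, hv⟩ => ⟨x, v, hw, hx.1, Follows.ideal hv⟩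

/-- A universal block swallows every short factor over its letters. Together with `Follows.ideal`
and `Ideal.sublist`, the ideal is seen to predict exactly the short subwords of each word that
follows the pattern. -/
theorem Ideal.sublist_of_follows {m : ℕ} : ∀ {P : List (Item α)} {u w : List α},
    Ideal P u → u.length ≤ m → Follows m P w → u.Sublist w
  | [], u, w, hu, _, hw => by cases hu; exact List.nil_sublist _
  | Item.letter a :: P, u, w, hu, hm, ⟨v, hw, hv⟩ => by
      subst hw
      rcases hu with hu | ⟨u', rfl, hu'⟩
      · exact (Ideal.sublist_of_follows hu hm hv).cons _
      · exact (Ideal.sublist_of_follows hu' (by simp at hm; omega) hv).cons_cons _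
  | Item.block B :: P, u, w, hu, hm, ⟨x, v, hw, hx, hv⟩ => by
      subst hw
      obtain ⟨u₁, u₂, rfl, h₁, h₂⟩ := hu
      simp only [List.length_append] at hm
      exact (hx.2 u₁ (by omega) h₁).append (Ideal.sublist_of_follows h₂ (by omega) hv)

/-- `x` is contained in `y`, as sets of words. -/
def Item.Le : Item α → Item α → Prop
  | .letter a, .letter b => a = b
  | .letter a, .block C => a ∈ C
  | .block _, .letter _ => False
  | .block B, .block C => B ⊆ C

/-- The block `y` absorbs the neighbouring item `x`. -/
def Item.Absorbs : Item α → Item α → Prop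
  | .letter _, _ => False
  | .block C, .letter a => a ∈ C
  | .block C, .block B => B ⊆ C

/-- An empty block stands for the empty word alone and could be inserted anywhere without changing
the ideal. -/
def Item.Nontrivial : Item α → Prop
  | .letter _ => True
  | .block B => B.Nonempty

/-- No item of the pattern is absorbed by a neighbour, and no block is empty. -/
def Reduced : List (Item α) → Prop
  | [] => True
  | x :: P => x.Nontrivial ∧ (∀ y ∈ P.head?, ¬ y.Absorbs x ∧ ¬ x.Absorbs y) ∧ Reduced P

theorem ideal_tail {x : Item α} {P : List (Item α)} {u : List α} (h : Ideal P u) :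
    Ideal (x :: P) u := by
  cases x with
  | letter a => exact Or.inl h
  | block B => exact ⟨[], u, rfl, by simp, h⟩

/-- Some letter of `x` cannot be matched by `y`. Prefixed to a word of the left ideal, it forces the
result to skip `y`, hence to lie in the ideal of `Q`, which is closed under subwords. -/
theorem ideal_le_tail {x y : Item α} {P Q : List (Item α)} (hx : x.Nontrivial) (hxy : ¬ x.Le y)
    (h : ∀ u, Ideal (x :: P) u → Ideal (y :: Q) u) : ∀ u, Ideal (x :: P) u → Ideal Q u := by
  classical
  cases x with
  | letter a =>
    have key : ∀ v, Ideal P v → Ideal Q (a :: v) := by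
      intro v hv
      have := h (a :: v) (Or.inr ⟨v, rfl, hv⟩)
      cases y with
      | letter b =>
        rcases this with h' | ⟨v', h', -⟩
        · exact h'
        · simp only [List.cons.injEq] at h'
          exact absurd h'.1 hxy
      | block C =>
        obtain ⟨z, v', h', hz, hv'⟩ := this
        cases z with
        | nil => rw [h']; exact hv'
        | cons c z =>
          simp only [List.cons_append, List.cons.injEq] at h'
          exact absurd (h'.1 ▸ hz c (by simp)) hxy
    rintro u (hu | ⟨v, rfl, hv⟩)
    · exact (key u hu).sublist (List.sublist_cons_self _ _)
    · exact key v hv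
  | block B =>
    have key : ∃ b ∈ B, ∀ v, Ideal (.block B :: P) v → Ideal Q (b :: v) := by
      cases y with
      | letter c =>
        obtain ⟨b, hb⟩ := hx
        refine ⟨b, hb, fun v hv => ?_⟩
        obtain ⟨z, v', rfl, hz, hv'⟩ := hv
        -- The letter `c` may equal `b`, but it matches only one of the two copies.
        have h1 := h (b :: b :: (z ++ v')) ⟨b :: b :: z, v', rfl, by simpa [hb] using hz, hv'⟩
        rcases h1 with h' | ⟨v'', h', h''⟩
        · exact h'.sublist (List.sublist_cons_self _ _)
        · simp only [List.cons.injEq] at h'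
          rw [h'.2]; exact h''
      | block C =>
        obtain ⟨b, hb, hbC⟩ := Finset.not_subset.1 hxy
        refine ⟨b, hb, fun v hv => ?_⟩
        obtain ⟨z, v', rfl, hz, hv'⟩ := hv
        obtain ⟨s, t, h', hs, ht⟩ := h (b :: (z ++ v')) ⟨b :: z, v', rfl, by simpa [hb] using hz, hv'⟩
        cases s with
        | nil => rw [h']; exact ht
        | cons c s =>
          simp only [List.cons_append, List.cons.injEq] at h'
          exact absurd (h'.1 ▸ hs c (by simp)) hbC
    obtain ⟨b, -, hb⟩ := key
    intro u hu
    exact (hb u hu).sublist (List.sublist_cons_self _ _)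

/-- If the head `x` were redundant, so would be its neighbour `z`: either `ideal_le_tail` skips `z`,
or `x` and `z` are the same letter, the only inclusion of `x` in `z` possible in a reduced pattern.
Descending, a nontrivial item would be redundant before the empty pattern. -/
theorem not_ideal_le_tail : ∀ {P : List (Item α)} {x : Item α}, Reduced (x :: P) →
    ¬ ∀ u, Ideal (x :: P) u → Ideal P u
  | [], x, hr, h => by
      cases x with
      | letter a => simpa [Ideal] using h [a] (Or.inr ⟨[], rfl, rfl⟩)
      | block B =>
        obtain ⟨b, hb⟩ := hr.1
        simpa [Ideal] using h [b] ⟨[b], [], rfl, by simpa using hb, rfl⟩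
  | z :: P, x, hr, h => by
      obtain ⟨hx, hadj, hrP⟩ := hr
      have hz := hadj z (by simp)
      have key : ∀ u, Ideal (z :: P) u → Ideal P u := by
        by_cases hxz : x.Le z
        · cases x with
          | letter a =>
            cases z with
            | letter b =>
              cases hxz
              intro u hu
              rcases h (a :: u) (Or.inr ⟨u, rfl, hu⟩) with h' | ⟨v, h', h''⟩
              · exact h'.sublist (List.sublist_cons_self _ _)
              · simp only [List.cons.injEq] at h'
                rw [h'.2]; exact h''
            | block C => exact absurd hxz hz.1
          | block B =>
            cases z with
            | letter b => exact hxz.elim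
            | block C => exact absurd hxz hz.1
        · intro u hu
          exact ideal_le_tail hx hxz h u (ideal_tail hu)
      exact not_ideal_le_tail hrP key

theorem Item.Le.antisymm {x y : Item α} (h : x.Le y) (h' : y.Le x) : x = y := by
  cases x <;> cases y <;> simp_all [Item.Le]
  exact Finset.Subset.antisymm h h'

/-- Cancellation of a common head. A letter is prefixed to the word; for a block, the next item of
the reduced pattern is not contained in it, so `ideal_le_tail` applies to this item. -/
theorem ideal_cons_le {x : Item α} {P Q : List (Item α)} (hP : Reduced (x :: P))
    (h : ∀ u, Ideal (x :: P) u → Ideal (x :: Q) u) : ∀ u, Ideal P u → Ideal Q u := by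
  cases x with
  | letter a =>
    intro u hu
    rcases h (a :: u) (Or.inr ⟨u, rfl, hu⟩) with h' | ⟨v, h', h''⟩
    · exact h'.sublist (List.sublist_cons_self _ _)
    · simp only [List.cons.injEq] at h'
      rw [h'.2]; exact h''
  | block B =>
    cases P with
    | nil => intro u hu; cases hu; exact Ideal.nil _
    | cons z P =>
      obtain ⟨-, hadj, hrP⟩ := hP
      refine ideal_le_tail hrP.1 (y := .block B) ?_ fun u hu => h u (ideal_tail hu)
      have := (hadj z (by simp)).2
      cases z <;> exact this

/-- A reduced pattern is determined by its ideal. -/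
theorem Reduced.eq_of_ideal_eq : ∀ {P Q : List (Item α)}, Reduced P → Reduced Q →
    (∀ u, Ideal P u ↔ Ideal Q u) → P = Q
  | [], [], _, _, _ => rfl
  | [], y :: Q, _, hQ, h => by
      refine absurd (fun u hu => ?_) (not_ideal_le_tail hQ)
      cases (h u).2 hu
      exact Ideal.nil _
  | x :: P, [], hP, _, h => by
      refine absurd (fun u hu => ?_) (not_ideal_le_tail hP)
      cases (h u).1 hu
      exact Ideal.nil _
  | x :: P, y :: Q, hP, hQ, h => by
      have h1 : x.Le y := by
        -- Otherwise the ideal of `y :: Q` is contained in that of `Q`, and `y` is redundant.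
        by_contra hxy
        have := ideal_le_tail hP.1 hxy fun u hu => (h u).1 hu
        exact not_ideal_le_tail hQ fun u hu => this u ((h u).2 hu)
      have h2 : y.Le x := by
        by_contra hxy
        have := ideal_le_tail hQ.1 hxy fun u hu => (h u).2 hu
        exact not_ideal_le_tail hP fun u hu => this u ((h u).1 hu)
      obtain rfl := h1.antisymm h2
      rw [Reduced.eq_of_ideal_eq hP.2.2 hQ.2.2 fun u =>
        ⟨ideal_cons_le hP (fun u hu => (h u).1 hu) u, ideal_cons_le hQ (fun u hu => (h u).2 hu) u⟩]

end Subwords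

/-! ### Limits of sequences of words along an ultrafilter. -/

section Sequences

open Filter

variable {α : Type*} {l : Filter ℕ}

/-- The words of the sequence follow the pattern, for blocks of unbounded universality. -/
def Adequate (l : Filter ℕ) (P : List (Item α)) (w : ℕ → List α) : Prop :=
  ∀ m, ∀ᶠ n in l, Follows m P (w n)

theorem Adequate.append {P Q : List (Item α)} {v w : ℕ → List α} (hv : Adequate l P v)
    (hw : Adequate l Q w) : Adequate l (P ++ Q) fun n => v n ++ w n := fun m => by
  filter_upwards [hv m, hw m] with n h1 h2
  exact follows_append.2 ⟨_, _, rfl, h1, h2⟩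

theorem Adequate.congr {P : List (Item α)} {v w : ℕ → List α} (hv : Adequate l P v)
    (h : ∀ᶠ n in l, v n = w n) : Adequate l P w := fun m => by
  filter_upwards [hv m, h] with n h1 h2
  rwa [← h2]

theorem adequate_letter (a : α) : Adequate l [.letter a] fun _ => [a] := fun _ =>
  Eventually.of_forall fun _ => ⟨[], rfl, rfl⟩

theorem finite_words [Finite α] (m : ℕ) : {u : List α | u.length ≤ m}.Finite :=
  List.finite_length_le α m

/-- Induction on `B`. Either the words become `m`-universal over `B` for every `m`, and a single
block suffices, or almost all of them miss a fixed word over `B`, along which they can be cut into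
letters and factors over smaller alphabets. -/
theorem exists_adequate_of_subset [Finite α] (U : Ultrafilter ℕ) (B : Finset α) :
    ∀ w : ℕ → List α, (∀ᶠ n in (U : Filter ℕ), ∀ a ∈ w n, a ∈ B) → ∃ P, Adequate U P w := by
  classical
  induction B using Finset.strongInduction with
  | H B ihB =>
  -- A word missing `b :: u` is cut at its first `b`: the part before lacks the letter `b`, the part
  -- after misses the shorter word `u`.
  have avoid : ∀ u : List α, (∀ a ∈ u, a ∈ B) → ∀ w : ℕ → List α,
      (∀ᶠ n in (U : Filter ℕ), ∀ a ∈ w n, a ∈ B) → (∀ᶠ n in (U : Filter ℕ), ¬ u.Sublist (w n)) →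
      ∃ P, Adequate U P w := by
    intro u
    induction u with
    | nil =>
      intro _ w _ h
      obtain ⟨n, hn⟩ := h.exists
      exact absurd (List.nil_sublist _) hn
    | cons b u ihu =>
      intro hu w hw h
      have hbB : b ∈ B := hu b (by simp)
      rcases Ultrafilter.eventually_or.1
        (Eventually.of_forall (f := (U : Filter ℕ)) fun n => em (b ∈ w n)) with hb | hb
      · have : ∀ n, ∃ y z, b ∈ w n → w n = y ++ b :: z ∧ b ∉ y := by
          intro n
          by_cases hn : b ∈ w n
          · obtain ⟨y, z, h⟩ := List.eq_append_cons_of_mem hn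
            exact ⟨y, z, fun _ => h⟩
          · exact ⟨[], [], fun h => absurd h hn⟩
        choose y z hyz using this
        obtain ⟨P, hP⟩ := ihB (B.erase b) (Finset.erase_ssubset hbB) y (by
          filter_upwards [hb, hw] with n h1 h2 a ha
          obtain ⟨h3, h4⟩ := hyz n h1
          refine Finset.mem_erase.2 ⟨?_, h2 a (by rw [h3]; simp [ha])⟩
          rintro rfl
          exact h4 ha)
        obtain ⟨Q, hQ⟩ := ihu (fun a ha => hu a (by simp [ha])) z (by
          filter_upwards [hb, hw] with n h1 h2 a ha
          exact h2 a (by rw [(hyz n h1).1]; simp [ha])) (by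
          filter_upwards [hb, h] with n h1 h2 h3
          apply h2
          rw [(hyz n h1).1]
          exact (h3.cons_cons b).trans (List.sublist_append_right _ _))
        refine ⟨P ++ ([.letter b] ++ Q), (hP.append ((adequate_letter b).append hQ)).congr ?_⟩
        filter_upwards [hb] with n h1
        rw [(hyz n h1).1]
        simp
      · refine ihB (B.erase b) (Finset.erase_ssubset hbB) w ?_
        filter_upwards [hb, hw] with n h1 h2 a ha
        refine Finset.mem_erase.2 ⟨?_, h2 a ha⟩
        rintro rfl
        exact h1 ha
  intro w hw
  by_cases huniv : ∀ m, ∀ᶠ n in (U : Filter ℕ), Universal m B (w n)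
  · refine ⟨[.block B], fun m => ?_⟩
    filter_upwards [huniv m] with n hn
    exact ⟨w n, [], by simp, hn, rfl⟩
  · push Not at huniv
    obtain ⟨m, hm⟩ := huniv
    have : ∀ᶠ n in (U : Filter ℕ), ∃ u ∈ {u : List α | u.length ≤ m},
        (∀ a ∈ u, a ∈ B) ∧ ¬ u.Sublist (w n) := by
      filter_upwards [hm, hw] with n h1 h2
      by_contra hcon
      push Not at hcon
      exact h1 ⟨h2, fun u hu hB => hcon u hu hB⟩
    -- Only finitely many words have length at most `m`, so the ultrafilter singles out one missed
    -- word for almost all indices.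
    obtain ⟨u, -, hu⟩ := (Ultrafilter.eventually_exists_mem_iff (finite_words m)).1 this
    obtain ⟨n, hn⟩ := hu.exists
    exact avoid u hn.1 w hw (hu.mono fun _ h => h.2)

theorem exists_adequate [Finite α] (U : Ultrafilter ℕ) (w : ℕ → List α) :
    ∃ P, Adequate U P w := by
  have := Fintype.ofFinite α
  exact exists_adequate_of_subset U Finset.univ w (by simp)

end Sequences

/-! ### Existence and uniqueness of reduced patterns. -/

section Minimal

open Filter

variable {α : Type*}

/-- An empty block is dropped; an absorbed item is merged into its neighbouring block, since adding
letters of the block to an `m`-universal word keeps it `m`-universal. The shorter pattern does not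
depend on `m`. -/
theorem exists_shorter : ∀ {P : List (Item α)}, ¬ Reduced P →
    ∃ Q : List (Item α), Q.length < P.length ∧ ∀ m w, Follows m P w → Follows m Q w
  | [], h => absurd trivial h
  | x :: P, h => by
      by_cases hx : x.Nontrivial
      · by_cases hP : Reduced P
        · cases P with
          | nil => exact absurd ⟨hx, by simp, trivial⟩ h
          | cons y P =>
            by_cases hyx : y.Absorbs x
            · refine ⟨y :: P, by simp, fun m w hw => ?_⟩
              cases y with
              | letter b => exact hyx.elim
              | block C =>
                cases x with
                | letter a =>
                  obtain ⟨v, rfl, z, v, rfl, hz, hv⟩ := hw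
                  refine ⟨a :: z, v, rfl, ⟨?_, fun u hu hC => ?_⟩, hv⟩
                  · simpa [show a ∈ C from hyx] using hz.1
                  · exact (hz.2 u hu hC).cons _
                | block B =>
                  obtain ⟨s, v, rfl, hs, z, v, rfl, hz, hv⟩ := hw
                  refine ⟨s ++ z, v, by simp, ⟨?_, fun u hu hC => ?_⟩, hv⟩
                  · intro a ha
                    rcases List.mem_append.1 ha with ha | ha
                    · exact hyx (hs.1 a ha)
                    · exact hz.1 a ha
                  · exact (hz.2 u hu hC).trans (List.sublist_append_right _ _)
            · by_cases hxy : x.Absorbs y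
              · refine ⟨x :: P, by simp, fun m w hw => ?_⟩
                cases x with
                | letter b => exact hxy.elim
                | block C =>
                  cases y with
                  | letter a =>
                    obtain ⟨z, v, rfl, hz, v, rfl, hv⟩ := hw
                    refine ⟨z ++ [a], v, by simp, ⟨?_, fun u hu hC => ?_⟩, hv⟩
                    · intro b hb
                      rcases List.mem_append.1 hb with hb | hb
                      · exact hz.1 b hb
                      · rw [List.mem_singleton.1 hb]; exact hxy
                    · exact (hz.2 u hu hC).trans (List.sublist_append_left _ _)
                  | block B =>
                    obtain ⟨z, v, rfl, hz, s, v, rfl, hs, hv⟩ := hw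
                    refine ⟨z ++ s, v, by simp, ⟨?_, fun u hu hC => ?_⟩, hv⟩
                    · intro a ha
                      rcases List.mem_append.1 ha with ha | ha
                      · exact hz.1 a ha
                      · exact hxy (hs.1 a ha)
                    · exact (hz.2 u hu hC).trans (List.sublist_append_left _ _)
              · exact absurd ⟨hx, by simp [hyx, hxy], hP⟩ h
        · obtain ⟨Q, hQ, h'⟩ := exists_shorter hP
          refine ⟨x :: Q, by simpa using hQ, fun m w hw => ?_⟩
          cases x with
          | letter a =>
            obtain ⟨v, rfl, hv⟩ := hw
            exact ⟨v, rfl, h' _ _ hv⟩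
          | block B =>
            obtain ⟨z, v, rfl, hz, hv⟩ := hw
            exact ⟨z, v, rfl, hz, h' _ _ hv⟩
      · refine ⟨P, by simp, fun m w hw => ?_⟩
        cases x with
        | letter a => exact absurd trivial hx
        | block B =>
          obtain ⟨z, v, rfl, hz, hv⟩ := hw
          obtain rfl : z = [] := by
            rw [List.eq_nil_iff_forall_not_mem]
            exact fun a ha => hx ⟨a, hz.1 a ha⟩
          exact hv

/-- An adequate pattern of least length is reduced, by `exists_shorter`. -/
theorem exists_reduced_adequate [Finite α] (U : Ultrafilter ℕ) (w : ℕ → List α) :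
    ∃ P, Reduced P ∧ Adequate U P w := by
  classical
  have h : ∃ n, ∃ P, P.length = n ∧ Adequate U P w :=
    let ⟨P, hP⟩ := exists_adequate U w
    ⟨_, P, rfl, hP⟩
  obtain ⟨P, hlen, hP⟩ := Nat.find_spec h
  refine ⟨P, ?_, hP⟩
  by_contra hred
  obtain ⟨Q, hQ, hPQ⟩ := exists_shorter hred
  exact Nat.find_min h (hlen ▸ hQ) ⟨Q, rfl, fun m => (hP m).mono fun n => hPQ m _⟩

/-- The right side does not mention `P`: the ideal is the limit of the sets of subwords and depends
on the sequence only. -/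
theorem Adequate.ideal_iff {U : Ultrafilter ℕ} {P : List (Item α)} {w : ℕ → List α}
    (h : Adequate U P w) (u : List α) :
    Ideal P u ↔ ∀ᶠ n in (U : Filter ℕ), u.Sublist (w n) := by
  constructor
  · intro hu
    exact (h u.length).mono fun n hn => hu.sublist_of_follows le_rfl hn
  · intro hu
    obtain ⟨n, h1, h2⟩ := (hu.and (h 0)).exists
    exact h2.ideal.sublist h1

/-- Two sequences of words whose `n`-th terms have the same subwords of length at most `n` share a
pattern. -/
theorem exists_common_pattern [Finite α] (w w' : ℕ → List α)
    (h : ∀ n, SubwordEquiv n (w n) (w' n)) :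
    ∃ P : List (Item α), ∀ m, ∃ n, Follows m P (w n) ∧ Follows m P (w' n) := by
  -- The ultrafilter must be nonprincipal: for each `u`, almost all indices have to be at least the
  -- length of `u`.
  let U := hyperfilter ℕ
  obtain ⟨P, hP, hPw⟩ := exists_reduced_adequate U w
  obtain ⟨Q, hQ, hQw⟩ := exists_reduced_adequate U w'
  obtain rfl : P = Q := hP.eq_of_ideal_eq hQ fun u => by
    rw [hPw.ideal_iff, hQw.ideal_iff]
    refine eventually_congr ?_
    have : ∀ᶠ n in (U : Filter ℕ), u.length ≤ n :=
      (Nat.hyperfilter_le_atTop (eventually_ge_atTop u.length))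
    exact this.mono fun n hn => h n u hn
  exact ⟨P, fun m => ((hPw m).and (hQw m)).exists⟩

end Minimal

/-! ### Entanglement as reachability in the graph of pairs. -/

section Automata

open Relation

variable {α σ σ₁ σ₂ : Type*}

theorem mem_evalFrom_append {A : NFA α σ} {p q : σ} {x y : List α} :
    q ∈ A.evalFrom {p} (x ++ y) ↔ ∃ r ∈ A.evalFrom {p} x, q ∈ A.evalFrom {r} y := by
  rw [NFA.evalFrom_append, NFA.mem_evalFrom_iff_exists]

theorem mem_evalFrom_cons {A : NFA α σ} {p q : σ} {a : α} {y : List α} :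
    q ∈ A.evalFrom {p} (a :: y) ↔ ∃ r ∈ A.step p a, q ∈ A.evalFrom {r} y := by
  rw [NFA.evalFrom_cons, NFA.stepSet_singleton, NFA.mem_evalFrom_iff_exists]

theorem mem_accepts_iff {A : NFA α σ} {w : List α} :
    w ∈ A.accepts ↔ ∃ p ∈ A.start, ∃ q ∈ A.accept, q ∈ A.evalFrom {p} w := by
  rw [NFA.mem_accepts]
  constructor
  · rintro ⟨q, hq, h⟩
    obtain ⟨p, hp, h⟩ := NFA.mem_evalFrom_iff_exists.1 h
    exact ⟨p, hp, q, hq, h⟩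
  · rintro ⟨p, hp, q, hq, h⟩
    exact ⟨q, hq, NFA.mem_evalFrom_iff_exists.2 ⟨p, hp, h⟩⟩

/-- A run from `p` to `q` over the letters of `B`, through a state `r` on a loop whose set of
letters is `B`. -/
def BlockRun (A : NFA α σ) (B : Finset α) (p r q : σ) : Prop :=
  ∃ x v z : List α, (∀ a ∈ x, a ∈ B) ∧ (∀ a, a ∈ v ↔ a ∈ B) ∧ (∀ a ∈ z, a ∈ B) ∧
    r ∈ A.evalFrom {p} x ∧ r ∈ A.evalFrom {r} v ∧ q ∈ A.evalFrom {r} z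

/-- The edges of the graph of pairs of states. -/
inductive PairStep (A₁ : NFA α σ₁) (A₂ : NFA α σ₂) : σ₁ × σ₂ → σ₁ × σ₂ → Prop
  | letter {p q : σ₁ × σ₂} (a : α) (h₁ : q.1 ∈ A₁.step p.1 a) (h₂ : q.2 ∈ A₂.step p.2 a) :
      PairStep A₁ A₂ p q
  | block {p q : σ₁ × σ₂} (B : Finset α) (r : σ₁ × σ₂) (h₁ : BlockRun A₁ B p.1 r.1 q.1)
      (h₂ : BlockRun A₂ B p.2 r.2 q.2) : PairStep A₁ A₂ p q

/-- Each copy of `v` contributes one letter of `u`. -/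
theorem universal_flatten_replicate {B : Finset α} {v : List α} (hv : ∀ a, a ∈ v ↔ a ∈ B) (m : ℕ) :
    ∀ u : List α, u.length ≤ m → (∀ a ∈ u, a ∈ B) → u.Sublist (List.replicate m v).flatten := by
  induction m with
  | zero =>
    intro u hu _
    rw [List.length_eq_zero_iff.1 (Nat.le_zero.1 hu)]
    exact List.nil_sublist _
  | succ m ih =>
    intro u hu hB
    cases u with
    | nil => exact List.nil_sublist _
    | cons a u =>
      rw [List.replicate_succ, List.flatten_cons]
      have ha : [a].Sublist v := List.singleton_sublist.2 ((hv a).2 (hB a (by simp)))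
      exact ha.append (ih u (by simpa using hu) fun b hb => hB b (by simp [hb]))

/-- Running through the loop `m` times makes the word `m`-universal. -/
theorem BlockRun.exists_universal {A : NFA α σ} {B : Finset α} {p r q : σ}
    (h : BlockRun A B p r q) (m : ℕ) : ∃ w, Universal m B w ∧ q ∈ A.evalFrom {p} w := by
  obtain ⟨x, v, z, hx, hv, hz, h1, h2, h3⟩ := h
  refine ⟨x ++ ((List.replicate m v).flatten ++ z), ⟨?_, fun u hu hB => ?_⟩, ?_⟩
  · intro a ha
    simp only [List.mem_append, List.mem_flatten, List.mem_replicate] at ha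
    rcases ha with ha | ⟨_, ⟨-, rfl⟩, ha⟩ | ha
    · exact hx a ha
    · exact (hv a).1 ha
    · exact hz a ha
  · exact ((universal_flatten_replicate hv m u hu hB).trans (List.sublist_append_left _ _)).trans
      (List.sublist_append_right _ _)
  · refine mem_evalFrom_append.2 ⟨r, h1, mem_evalFrom_append.2 ⟨r, ?_, h3⟩⟩
    induction m with
    | zero => simp
    | succ m ih =>
      rw [List.replicate_succ, List.flatten_cons]
      exact mem_evalFrom_append.2 ⟨r, h2, ih⟩

theorem PairStep.exists_words {A₁ : NFA α σ₁} {A₂ : NFA α σ₂} {p q : σ₁ × σ₂} (m : ℕ)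
    (h : PairStep A₁ A₂ p q) : ∃ w₁ w₂, q.1 ∈ A₁.evalFrom {p.1} w₁ ∧ q.2 ∈ A₂.evalFrom {p.2} w₂ ∧
      SubwordEquiv m w₁ w₂ := by
  cases h with
  | letter a h₁ h₂ =>
    exact ⟨[a], [a], by simpa using h₁, by simpa using h₂, SubwordEquiv.refl _ _⟩
  | block B r h₁ h₂ =>
    obtain ⟨w₁, hw₁, hr₁⟩ := h₁.exists_universal m
    obtain ⟨w₂, hw₂, hr₂⟩ := h₂.exists_universal m
    exact ⟨w₁, w₂, hr₁, hr₂, hw₁.subwordEquiv hw₂⟩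

theorem exists_words_of_reflTransGen {A₁ : NFA α σ₁} {A₂ : NFA α σ₂} {p q : σ₁ × σ₂} (m : ℕ)
    (h : ReflTransGen (PairStep A₁ A₂) p q) :
    ∃ w₁ w₂, q.1 ∈ A₁.evalFrom {p.1} w₁ ∧ q.2 ∈ A₂.evalFrom {p.2} w₂ ∧ SubwordEquiv m w₁ w₂ := by
  induction h with
  | refl => exact ⟨[], [], by simp, by simp, SubwordEquiv.refl _ _⟩
  | tail _ hs ih =>
    obtain ⟨w₁, w₂, h1, h2, h3⟩ := ih
    obtain ⟨v₁, v₂, h1', h2', h3'⟩ := hs.exists_words m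
    exact ⟨w₁ ++ v₁, w₂ ++ v₂, mem_evalFrom_append.2 ⟨_, h1, h1'⟩,
      mem_evalFrom_append.2 ⟨_, h2, h2'⟩, h3.append h3'⟩

/-- The run is cut behind the successive copies of `v`, and `s i` is the state after `i` cuts. The
values of `s` beyond `k` are irrelevant. -/
theorem exists_states_of_flatten_sublist {A : NFA α σ} {B : Finset α} {v : List α} {q : σ} :
    ∀ (k : ℕ) {p : σ} {w : List α}, (∀ a ∈ w, a ∈ B) → q ∈ A.evalFrom {p} w →
      (List.replicate k v).flatten.Sublist w → ∃ s : ℕ → σ, s 0 = p ∧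
        (∀ i < k, ∃ x : List α, v.Sublist x ∧ (∀ a ∈ x, a ∈ B) ∧ s (i + 1) ∈ A.evalFrom {s i} x) ∧
        ∃ z : List α, (∀ a ∈ z, a ∈ B) ∧ q ∈ A.evalFrom {s k} z
  | 0, p, w, hw, hq, _ => ⟨fun _ => p, rfl, by simp, w, hw, hq⟩
  | k + 1, p, w, hw, hq, h => by
      rw [List.replicate_succ, List.flatten_cons, List.append_sublist_iff] at h
      obtain ⟨x, y, rfl, hx, hy⟩ := h
      obtain ⟨r, hr, hq⟩ := mem_evalFrom_append.1 hq
      obtain ⟨s, hs0, hs, hz⟩ :=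
        exists_states_of_flatten_sublist k (fun a ha => hw a (by simp [ha])) hq hy
      refine ⟨fun i => Nat.casesOn i p s, rfl, ?_, hz⟩
      rintro (_ | i) hi
      · exact ⟨x, hx, fun a ha => hw a (by simp [ha]), by simpa [hs0] using hr⟩
      · exact hs i (by omega)

theorem exists_run_of_states {A : NFA α σ} {B : Finset α} {v : List α} {k : ℕ} {s : ℕ → σ}
    (hs : ∀ i < k, ∃ x : List α, v.Sublist x ∧ (∀ a ∈ x, a ∈ B) ∧ s (i + 1) ∈ A.evalFrom {s i} x)
    (i d : ℕ) (hd : i + d ≤ k) : ∃ x : List α, (0 < d → v.Sublist x) ∧ (∀ a ∈ x, a ∈ B) ∧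
      s (i + d) ∈ A.evalFrom {s i} x := by
  induction d with
  | zero => exact ⟨[], by simp, by simp, by simp⟩
  | succ d ih =>
    obtain ⟨x, -, hx, hr⟩ := ih (by omega)
    obtain ⟨y, hv, hy, hr'⟩ := hs (i + d) (by omega)
    refine ⟨x ++ y, fun _ => hv.trans (List.sublist_append_right _ _), ?_,
      mem_evalFrom_append.2 ⟨_, hr, hr'⟩⟩
    intro a ha
    rcases List.mem_append.1 ha with ha | ha
    · exact hx a ha
    · exact hy a ha

/-- Listing `B` once for every state gives a word of length `card σ * card B`, hence a subword of
`w`. Cutting the run at its copies yields one state more than there are, so a state repeats, and the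
factor between two repetitions is a loop that contains a full copy of `B`. -/
theorem Universal.exists_blockRun [Fintype σ] {A : NFA α σ} {B : Finset α} {p q : σ} {w : List α}
    {m : ℕ} (hm : Fintype.card σ * B.card ≤ m) (h : Universal m B w) (hq : q ∈ A.evalFrom {p} w) :
    ∃ r, BlockRun A B p r q := by
  have hsub : (List.replicate (Fintype.card σ) B.toList).flatten.Sublist w := by
    refine h.2 _ (by simpa using hm) fun a ha => ?_
    simp only [List.mem_flatten, List.mem_replicate] at ha
    obtain ⟨_, ⟨-, rfl⟩, ha⟩ := ha
    exact Finset.mem_toList.1 ha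
  obtain ⟨s, hs0, hs, z, hz, hqz⟩ := exists_states_of_flatten_sublist _ h.1 hq hsub
  obtain ⟨i, j, hij, heq⟩ := Fintype.exists_ne_map_eq_of_card_lt
    (fun i : Fin (Fintype.card σ + 1) => s i) (by simp)
  wlog hlt : i < j generalizing i j
  · exact this j i hij.symm heq.symm (lt_of_le_of_ne (not_lt.1 hlt) hij.symm)
  have hlt' : (i : ℕ) < j := hlt
  have hj : (j : ℕ) ≤ Fintype.card σ := Nat.lt_succ_iff.1 j.2
  obtain ⟨x, -, hx, hrx⟩ := exists_run_of_states hs 0 i (by omega)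
  obtain ⟨v, hv, hv', hrv⟩ := exists_run_of_states hs i (j - i) (by omega)
  obtain ⟨y, -, hy, hry⟩ := exists_run_of_states hs j (Fintype.card σ - j) (by omega)
  rw [show (i : ℕ) + (j - i) = j by omega] at hrv
  rw [show (j : ℕ) + (Fintype.card σ - j) = Fintype.card σ by omega] at hry
  rw [zero_add, hs0] at hrx
  rw [← heq] at hrv hry
  refine ⟨s i, x, v, y ++ z, hx, fun a => ⟨hv' a, fun ha => ?_⟩, ?_, hrx, hrv,
    mem_evalFrom_append.2 ⟨_, hry, hqz⟩⟩
  · exact (hv (by omega)).subset (Finset.mem_toList.2 ha)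
  · intro a ha
    rcases List.mem_append.1 ha with ha | ha
    · exact hy a ha
    · exact hz a ha

/-- Both words follow the same pattern, so the two runs are cut item by item in parallel. The bounds
on `m` suffice for the pigeonhole argument in either automaton and for every block. -/
theorem Follows.reflTransGen [Fintype α] [Fintype σ₁] [Fintype σ₂] {A₁ : NFA α σ₁} {A₂ : NFA α σ₂}
    {m : ℕ} (hm₁ : Fintype.card σ₁ * Fintype.card α ≤ m)
    (hm₂ : Fintype.card σ₂ * Fintype.card α ≤ m) :
    ∀ {P : List (Item α)} {p q : σ₁ × σ₂} {w₁ w₂ : List α}, Follows m P w₁ → Follows m P w₂ →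
      q.1 ∈ A₁.evalFrom {p.1} w₁ → q.2 ∈ A₂.evalFrom {p.2} w₂ →
      ReflTransGen (PairStep A₁ A₂) p q
  | [], p, q, _, _, h₁, h₂, r₁, r₂ => by
      cases h₁
      cases h₂
      rw [Prod.ext r₁ r₂]
  | .letter a :: P, p, q, _, _, ⟨v₁, e₁, h₁⟩, ⟨v₂, e₂, h₂⟩, r₁, r₂ => by
      subst e₁ e₂
      obtain ⟨s₁, hs₁, r₁⟩ := mem_evalFrom_cons.1 r₁
      obtain ⟨s₂, hs₂, r₂⟩ := mem_evalFrom_cons.1 r₂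
      exact .head (.letter (q := (s₁, s₂)) a hs₁ hs₂) (Follows.reflTransGen hm₁ hm₂ h₁ h₂ r₁ r₂)
  | .block B :: P, p, q, _, _, ⟨x₁, v₁, e₁, hx₁, h₁⟩, ⟨x₂, v₂, e₂, hx₂, h₂⟩, r₁, r₂ => by
      subst e₁ e₂
      obtain ⟨s₁, hs₁, r₁⟩ := mem_evalFrom_append.1 r₁
      obtain ⟨s₂, hs₂, r₂⟩ := mem_evalFrom_append.1 r₂
      have hB : B.card ≤ Fintype.card α := Finset.card_le_univ B
      obtain ⟨t₁, ht₁⟩ := hx₁.exists_blockRun ((Nat.mul_le_mul_left _ hB).trans hm₁) hs₁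
      obtain ⟨t₂, ht₂⟩ := hx₂.exists_blockRun ((Nat.mul_le_mul_left _ hB).trans hm₂) hs₂
      exact .head (.block (q := (s₁, s₂)) B (t₁, t₂) ht₁ ht₂)
        (Follows.reflTransGen hm₁ hm₂ h₁ h₂ r₁ r₂)

/-- For all `m`, some words of `L₁` and `L₂` have the same subwords of length at most `m`. -/
def Entangled (L₁ L₂ : Language α) : Prop :=
  ∀ m, ∃ w₁ ∈ L₁, ∃ w₂ ∈ L₂, SubwordEquiv m w₁ w₂

theorem entangled_iff [Finite α] [Finite σ₁] [Finite σ₂] {A₁ : NFA α σ₁} {A₂ : NFA α σ₂} :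
    Entangled A₁.accepts A₂.accepts ↔ ∃ p q : σ₁ × σ₂, (p.1 ∈ A₁.start ∧ p.2 ∈ A₂.start) ∧
      (q.1 ∈ A₁.accept ∧ q.2 ∈ A₂.accept) ∧ ReflTransGen (PairStep A₁ A₂) p q := by
  have := Fintype.ofFinite α
  have := Fintype.ofFinite σ₁
  have := Fintype.ofFinite σ₂
  constructor
  · intro h
    choose w₁ h₁ w₂ h₂ h using h
    obtain ⟨P, hP⟩ := exists_common_pattern w₁ w₂ h
    obtain ⟨n, hn₁, hn₂⟩ := hP
      (max (Fintype.card σ₁ * Fintype.card α) (Fintype.card σ₂ * Fintype.card α))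
    obtain ⟨p₁, hp₁, q₁, hq₁, r₁⟩ := mem_accepts_iff.1 (h₁ n)
    obtain ⟨p₂, hp₂, q₂, hq₂, r₂⟩ := mem_accepts_iff.1 (h₂ n)
    exact ⟨(p₁, p₂), (q₁, q₂), ⟨hp₁, hp₂⟩, ⟨hq₁, hq₂⟩,
      hn₁.reflTransGen (le_max_left _ _) (le_max_right _ _) hn₂ r₁ r₂⟩
  · rintro ⟨p, q, ⟨hp₁, hp₂⟩, ⟨hq₁, hq₂⟩, h⟩ m
    obtain ⟨w₁, w₂, r₁, r₂, h⟩ := exists_words_of_reflTransGen m h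
    exact ⟨w₁, mem_accepts_iff.2 ⟨_, hp₁, _, hq₁, r₁⟩, w₂, mem_accepts_iff.2 ⟨_, hp₂, _, hq₂, r₂⟩, h⟩

end Automata

/-! ### Piecewise testable separability and entanglement. -/

section Separability

variable {α : Type*}

theorem mem_pieceLanguage : ∀ {u w : List α}, w ∈ pieceLanguage u ↔ u.Sublist w
  | [], w => ⟨fun _ => List.nil_sublist _, fun _ => trivial⟩
  | a :: u, w => by
      rw [pieceLanguage, Language.mem_mul]
      constructor
      · rintro ⟨x, hx, y, hy, rfl⟩
        obtain ⟨z, -, t, ht, rfl⟩ := Language.mem_mul.1 hx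
        cases ht
        rw [List.append_assoc]
        exact ((mem_pieceLanguage.1 hy).cons_cons a).trans (List.sublist_append_right _ _)
      · intro h
        obtain ⟨x, y, rfl, hx, hy⟩ := List.cons_sublist_iff.1 h
        obtain ⟨s, t, rfl⟩ := List.append_of_mem hx
        refine ⟨s ++ [a], Language.mem_mul.2 ⟨s, trivial, [a], rfl, rfl⟩, t ++ y, ?_, by simp⟩
        exact mem_pieceLanguage.2 (hy.trans (List.sublist_append_right _ _))

theorem mem_compl {L : Language α} {w : List α} : w ∈ Lᶜ ↔ w ∉ L := Iff.rfl
theorem mem_inf {L K : Language α} {w : List α} : w ∈ L ⊓ K ↔ w ∈ L ∧ w ∈ K := Iff.rfl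
theorem mem_sup {L K : Language α} {w : List α} : w ∈ L ⊔ K ↔ w ∈ L ∨ w ∈ K := Iff.rfl

/-- The maximal length of the pieces in the Boolean combination serves as `m`. -/
theorem IsPiecewiseTestable.exists_saturated {L : Language α} (h : IsPiecewiseTestable L) :
    ∃ m, ∀ w w', SubwordEquiv m w w' → (w ∈ L ↔ w' ∈ L) := by
  induction h with
  | piece u => exact ⟨u.length, fun w w' h => by simpa [mem_pieceLanguage] using h u le_rfl⟩
  | compl _ ih =>
    obtain ⟨m, hm⟩ := ih
    exact ⟨m, fun w w' h => not_congr (hm w w' h)⟩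
  | inter _ _ ih₁ ih₂ =>
    obtain ⟨m, hm⟩ := ih₁
    obtain ⟨n, hn⟩ := ih₂
    exact ⟨max m n, fun w w' h => and_congr (hm w w' (h.mono (le_max_left _ _)))
      (hn w w' (h.mono (le_max_right _ _)))⟩
  | union _ _ ih₁ ih₂ =>
    obtain ⟨m, hm⟩ := ih₁
    obtain ⟨n, hn⟩ := ih₂
    exact ⟨max m n, fun w w' h => or_congr (hm w w' (h.mono (le_max_left _ _)))
      (hn w w' (h.mono (le_max_right _ _)))⟩

theorem isPiecewiseTestable_top : IsPiecewiseTestable (⊤ : Language α) := .piece []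

theorem isPiecewiseTestable_bot : IsPiecewiseTestable (⊥ : Language α) := by
  simpa using isPiecewiseTestable_top.compl

theorem mem_finset_inf {ι : Type*} {s : Finset ι} {f : ι → Language α} {w : List α} :
    w ∈ s.inf f ↔ ∀ i ∈ s, w ∈ f i := by
  classical
  induction s using Finset.induction_on with
  | empty => exact ⟨fun _ => by simp, fun _ => trivial⟩
  | insert a s _ ih => rw [Finset.inf_insert, mem_inf, ih]; simp

theorem mem_finset_sup {ι : Type*} {s : Finset ι} {f : ι → Language α} {w : List α} :
    w ∈ s.sup f ↔ ∃ i ∈ s, w ∈ f i := by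
  classical
  induction s using Finset.induction_on with
  | empty => exact ⟨fun h => h.elim, fun h => by simp at h⟩
  | insert a s _ ih => rw [Finset.sup_insert, mem_sup, ih]; simp

/-- `L` is a union of classes, and a class is cut out by stating for each of the finitely many words
of length at most `m` whether it is a subword. -/
theorem isPiecewiseTestable_of_saturated [Finite α] {L : Language α} {m : ℕ}
    (h : ∀ w w', SubwordEquiv m w w' → w ∈ L → w' ∈ L) : IsPiecewiseTestable L := by
  classical
  let W : Finset (List α) := (finite_words m).toFinset
  have hW : ∀ u, u ∈ W ↔ u.length ≤ m := fun u => by simp [W]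
  let type : List α → Finset (List α) := fun w => W.filter fun u => u.Sublist w
  let K : Finset (List α) → Language α := fun S =>
    W.inf fun u => if u ∈ S then pieceLanguage u else (pieceLanguage u)ᶜ
  have hK : ∀ S, IsPiecewiseTestable (K S) := fun S =>
    Finset.inf_induction isPiecewiseTestable_top (fun _ h _ h' => h.inter h') fun u _ => by
      split_ifs
      · exact .piece u
      · exact (IsPiecewiseTestable.piece u).compl
  have key : L = (W.powerset.filter fun S => ∃ w ∈ L, type w = S).sup K := by
    ext w
    rw [mem_finset_sup]
    constructor
    · intro hw
      refine ⟨type w, ?_, ?_⟩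
      · simp only [Finset.mem_filter, Finset.mem_powerset]
        exact ⟨Finset.filter_subset _ _, w, hw, rfl⟩
      · rw [mem_finset_inf]
        intro u hu
        by_cases huw : u.Sublist w
        · rw [if_pos (Finset.mem_filter.2 ⟨hu, huw⟩)]
          exact mem_pieceLanguage.2 huw
        · rw [if_neg (fun h : u ∈ type _ => huw (Finset.mem_filter.1 h).2)]
          exact mem_compl.2 fun h => huw (mem_pieceLanguage.1 h)
    · rintro ⟨S, hS, hw⟩
      obtain ⟨-, w', hw', rfl⟩ := Finset.mem_filter.1 hS
      refine h w' w (fun u hu => ?_) hw'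
      have := mem_finset_inf.1 hw u ((hW u).2 hu)
      by_cases huw : u.Sublist w'
      · rw [if_pos (Finset.mem_filter.2 ⟨(hW u).2 hu, huw⟩)] at this
        exact iff_of_true huw (mem_pieceLanguage.1 this)
      · rw [if_neg (fun h : u ∈ type _ => huw (Finset.mem_filter.1 h).2)] at this
        exact iff_of_false huw fun h => mem_compl.1 this (mem_pieceLanguage.2 h)
  rw [key]
  exact Finset.sup_induction isPiecewiseTestable_bot (fun _ h _ h' => h.union h') fun S _ => hK S

theorem ptSeparable_iff [Finite α] {L₁ L₂ : Language α} :
    PTSeparable L₁ L₂ ↔ ¬ Entangled L₁ L₂ := by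
  constructor
  · rintro ⟨L, hL, h₁, h₂⟩ h
    obtain ⟨m, hm⟩ := hL.exists_saturated
    obtain ⟨w₁, hw₁, w₂, hw₂, h⟩ := h m
    have : w₂ ∈ L₂ ⊓ L := ⟨hw₂, (hm _ _ h).1 (h₁ hw₁)⟩
    rw [h₂] at this
    exact this
  · intro h
    simp only [Entangled, not_forall, not_exists, not_and] at h
    obtain ⟨m, hm⟩ := h
    -- The closure of `L₁` under `m`-equivalence is the least saturated language that could
    -- separate.
    let L : Language α := {w | ∃ w₁ ∈ L₁, SubwordEquiv m w₁ w}
    refine ⟨L, isPiecewiseTestable_of_saturated (m := m) ?_,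
      fun w hw => ⟨w, hw, SubwordEquiv.refl _ _⟩, ?_⟩
    · rintro w w' h ⟨w₁, hw₁, h'⟩
      exact ⟨w₁, hw₁, fun u hu => (h' u hu).trans (h u hu)⟩
    · ext w
      refine ⟨?_, fun h => h.elim⟩
      rintro ⟨hw, w₁, hw₁, h⟩
      exact absurd h (hm w₁ hw₁ w hw)

end Separability

/-! ### Separability by BΣ₁(<) sentences. -/

section Logic

open FirstOrder FirstOrder.Language

variable {α : Type*}

theorem isQF_foldr_inf {n : ℕ} (l : List ((wordSignature α).BoundedFormula Empty n))
    (h : ∀ φ ∈ l, φ.IsQF) : (l.foldr (· ⊓ ·) ⊤).IsQF := by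
  induction l with
  | nil => exact BoundedFormula.IsQF.top
  | cons φ l ih =>
    exact (h φ (by simp)).inf (ih fun ψ hψ => h ψ (by simp [hψ]))

theorem isExistential_exs : ∀ {n : ℕ} {φ : (wordSignature α).BoundedFormula Empty n},
    φ.IsExistential → BoundedFormula.IsExistential φ.exs
  | 0, _, h => h
  | n + 1, φ, h => isExistential_exs (n := n) (φ := φ.ex) h.ex

/-- The positions `x₀, …, x_{n-1}` are increasing and carry the letters of the word `u`. -/
noncomputable def embeddingFormula (u : List α) :
    (wordSignature α).BoundedFormula Empty u.length :=
  BoundedFormula.iInf (fun i : Fin u.length =>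
    BoundedFormula.rel (L := wordSignature α) (WordRel.letter (u.get i) : WordRel α 1)
      ![Term.var (Sum.inr i)]) ⊓
  BoundedFormula.iInf (fun p : {p : Fin u.length × Fin u.length // p.1 < p.2} =>
    BoundedFormula.rel (L := wordSignature α) (WordRel.lt : WordRel α 2)
      ![Term.var (Sum.inr p.1.1), Term.var (Sum.inr p.1.2)])

theorem isQF_embeddingFormula (u : List α) : (embeddingFormula u).IsQF := by
  refine BoundedFormula.IsQF.inf ?_ ?_
  · refine isQF_foldr_inf _ fun φ hφ => ?_
    simp only [List.mem_map] at hφ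
    obtain ⟨i, -, rfl⟩ := hφ
    exact (BoundedFormula.IsAtomic.rel _ _).isQF
  · refine isQF_foldr_inf _ fun φ hφ => ?_
    simp only [List.mem_map] at hφ
    obtain ⟨i, -, rfl⟩ := hφ
    exact (BoundedFormula.IsAtomic.rel _ _).isQF

theorem wordSatisfies_exs_embeddingFormula {u w : List α} :
    WordSatisfies w (embeddingFormula u).exs ↔ u.Sublist w := by
  let := wordStructure w
  have h1 : WordSatisfies w (embeddingFormula u).exs ↔ ∃ xs : Fin u.length → Fin w.length,
      (∀ i, w.get (xs i) = u.get i) ∧ ∀ i j, i < j → xs i < xs j := by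
    unfold WordSatisfies Sentence.Realize
    rw [BoundedFormula.realize_exs]
    refine exists_congr fun xs => ?_
    rw [embeddingFormula, BoundedFormula.realize_inf, BoundedFormula.realize_iInf,
      BoundedFormula.realize_iInf]
    refine and_congr (forall_congr' fun i => Iff.rfl) ?_
    exact ⟨fun h i j hij => h ⟨(i, j), hij⟩, fun h p => h _ _ p.2⟩
  rw [h1, List.sublist_iff_exists_fin_orderEmbedding_get_eq]
  constructor
  · rintro ⟨xs, h1, h2⟩
    exact ⟨OrderEmbedding.ofStrictMono xs fun i j h => h2 i j h, fun i => (h1 i).symm⟩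
  · rintro ⟨f, hf⟩
    exact ⟨f, fun i => (hf i).symm, fun i j h => f.strictMono h⟩

theorem wordSatisfies_inf {w : List α} {φ ψ : (wordSignature α).Sentence} :
    WordSatisfies w (φ ⊓ ψ) ↔ WordSatisfies w φ ∧ WordSatisfies w ψ :=
  letI := wordStructure w
  BoundedFormula.realize_inf

theorem wordSatisfies_sup {w : List α} {φ ψ : (wordSignature α).Sentence} :
    WordSatisfies w (φ ⊔ ψ) ↔ WordSatisfies w φ ∨ WordSatisfies w ψ :=
  letI := wordStructure w
  BoundedFormula.realize_sup

theorem IsPiecewiseTestable.exists_sentence {L : Language α} (h : IsPiecewiseTestable L) :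
    ∃ φ : (wordSignature α).Sentence, IsBSigmaOne φ ∧ ∀ w, WordSatisfies w φ ↔ w ∈ L := by
  induction h with
  | piece u =>
    refine ⟨(embeddingFormula u).exs,
      .existential (isExistential_exs (isQF_embeddingFormula u).isExistential), fun w => ?_⟩
    rw [wordSatisfies_exs_embeddingFormula, mem_pieceLanguage]
  | compl _ ih =>
    obtain ⟨φ, hφ, h⟩ := ih
    exact ⟨φ.not, hφ.not, fun w => not_congr (h w)⟩
  | inter _ _ ih₁ ih₂ =>
    obtain ⟨φ, hφ, h⟩ := ih₁
    obtain ⟨ψ, hψ, h'⟩ := ih₂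
    exact ⟨φ ⊓ ψ, hφ.inf hψ, fun w => wordSatisfies_inf.trans (and_congr (h w) (h' w))⟩
  | union _ _ ih₁ ih₂ =>
    obtain ⟨φ, hφ, h⟩ := ih₁
    obtain ⟨ψ, hψ, h'⟩ := ih₂
    exact ⟨φ ⊔ ψ, hφ.sup hψ, fun w => wordSatisfies_sup.trans (or_congr (h w) (h' w))⟩

/-- `φ` holds in the word `w` for the positions `xs`. -/
def RealizedIn {n : ℕ} (w : List α) (φ : (wordSignature α).BoundedFormula Empty n)
    (xs : Fin n → Fin w.length) : Prop :=
  letI := wordStructure w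
  φ.Realize (default : Empty → Fin w.length) xs

theorem term_eq_var {n : ℕ} (t : (wordSignature α).Term (Empty ⊕ Fin n)) :
    ∃ i, t = Term.var (Sum.inr i) := by
  cases t with
  | var x =>
    cases x with
    | inl x => exact x.elim
    | inr i => exact ⟨i, rfl⟩
  | func f _ => exact f.elim

/-- Without function symbols, a quantifier-free formula sees only the relative order of the given
positions and their letters; equality is determined by the order. -/
theorem realizedIn_iff_of_isQF {n : ℕ} {φ : (wordSignature α).BoundedFormula Empty n}
    (hφ : φ.IsQF) {w w' : List α} {xs : Fin n → Fin w.length} {ys : Fin n → Fin w'.length}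
    (hlt : ∀ i j, xs i < xs j ↔ ys i < ys j) (hget : ∀ i, w.get (xs i) = w'.get (ys i)) :
    RealizedIn w φ xs ↔ RealizedIn w' φ ys := by
  induction hφ with
  | falsum => exact Iff.rfl
  | imp _ _ ih₁ ih₂ => exact imp_congr ih₁ ih₂
  | of_isAtomic h =>
    cases h with
    | equal t₁ t₂ =>
      obtain ⟨i, rfl⟩ := term_eq_var t₁
      obtain ⟨j, rfl⟩ := term_eq_var t₂
      change xs i = xs j ↔ ys i = ys j
      rw [le_antisymm_iff, le_antisymm_iff, ← not_lt, ← not_lt, ← not_lt, ← not_lt, hlt, hlt]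
    | rel R ts =>
      cases R with
      | letter a =>
        obtain ⟨i, hi⟩ := term_eq_var (ts 0)
        have e₁ : RealizedIn w (BoundedFormula.rel (L := wordSignature α)
            (WordRel.letter a : WordRel α 1) ts) xs ↔ w.get (xs i) = a := by
          let := wordStructure w
          change w.get ((ts 0).realize _) = a ↔ _
          rw [hi]; rfl
        have e₂ : RealizedIn w' (BoundedFormula.rel (L := wordSignature α)
            (WordRel.letter a : WordRel α 1) ts) ys ↔ w'.get (ys i) = a := by
          let := wordStructure w'
          change w'.get ((ts 0).realize _) = a ↔ _
          rw [hi]; rfl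
        have e₃ : w.get (xs i) = a ↔ w'.get (ys i) = a := by rw [hget]
        exact e₁.trans (e₃.trans e₂.symm)
      | lt =>
        obtain ⟨i, hi⟩ := term_eq_var (ts 0)
        obtain ⟨j, hj⟩ := term_eq_var (ts 1)
        have e₁ : RealizedIn w (BoundedFormula.rel (L := wordSignature α)
            (WordRel.lt : WordRel α 2) ts) xs ↔ xs i < xs j := by
          let := wordStructure w
          change (ts 0).realize _ < (ts 1).realize _ ↔ _
          rw [hi, hj]; rfl
        have e₂ : RealizedIn w' (BoundedFormula.rel (L := wordSignature α)
            (WordRel.lt : WordRel α 2) ts) ys ↔ ys i < ys j := by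
          let := wordStructure w'
          change (ts 0).realize _ < (ts 1).realize _ ↔ _
          rw [hi, hj]; rfl
        exact e₁.trans ((hlt i j).trans e₂.symm)

theorem realizedIn_ex {n : ℕ} {φ : (wordSignature α).BoundedFormula Empty (n + 1)} {w : List α}
    {xs : Fin n → Fin w.length} :
    RealizedIn w φ.ex xs ↔ ∃ a, RealizedIn w φ (Fin.snoc xs a) :=
  letI := wordStructure w
  BoundedFormula.realize_ex

/-- The truth of an existential formula depends on boundedly many positions only. -/
theorem exists_witnesses {n : ℕ} {φ : (wordSignature α).BoundedFormula Empty n}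
    (hφ : φ.IsExistential) : ∃ m, ∀ (w : List α) (xs : Fin n → Fin w.length), RealizedIn w φ xs →
      ∃ S : Finset (Fin w.length), S.card ≤ m ∧ ∀ (w' : List α) (f : ℕ → ℕ)
        (ys : Fin n → Fin w'.length), (∀ i, (ys i : ℕ) = f (xs i)) →
        (∀ i, (i ∈ S ∨ i ∈ Set.range xs) → w'[f i]? = some (w.get i)) →
        (∀ i j, (i ∈ S ∨ i ∈ Set.range xs) → (j ∈ S ∨ j ∈ Set.range xs) → i < j → f i < f j) →
        RealizedIn w' φ ys := by
  -- `S` collects the witnesses of the quantifiers, so `m` counts the quantifiers. The map `f`,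
  -- which carries positions of `w` to positions of `w'`, is total but constrained only on the
  -- relevant positions; therefore the same `f` serves throughout the induction.
  induction hφ with
  | of_isQF h =>
    refine ⟨0, fun w xs hw => ⟨∅, by simp, fun w' f ys hys hget hmono => ?_⟩⟩
    have hlt : ∀ i j, xs i < xs j → ys i < ys j := fun i j hij => by
      rw [Fin.lt_def, hys, hys]
      exact hmono _ _ (Or.inr ⟨i, rfl⟩) (Or.inr ⟨j, rfl⟩) hij
    refine (realizedIn_iff_of_isQF h (fun i j => ⟨hlt i j, fun hij => ?_⟩) fun i => ?_).1 hw
    · by_contra hcon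
      rcases lt_or_eq_of_le (not_lt.1 hcon) with h' | h'
      · exact absurd hij (hlt _ _ h').asymm
      · have : ys i = ys j := Fin.ext (by rw [hys, hys, h'])
        exact absurd hij (by rw [this]; exact lt_irrefl _)
    · have := hget (xs i) (Or.inr ⟨i, rfl⟩)
      rw [← hys i, List.getElem?_eq_getElem (ys i).2] at this
      exact (Option.some.inj this).symm
  | @ex n φ _ ih =>
    obtain ⟨m, hm⟩ := ih
    refine ⟨m + 1, fun w xs hw => ?_⟩
    obtain ⟨a, ha⟩ := realizedIn_ex.1 hw
    obtain ⟨S, hS, h⟩ := hm w _ ha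
    classical
    refine ⟨insert a S, (Finset.card_insert_le _ _).trans (by omega), ?_⟩
    intro w' f ys hys hget hmono
    have hmem : ∀ i, (i ∈ S ∨ i ∈ Set.range (Fin.snoc xs a : Fin (n + 1) → Fin w.length)) →
        (i ∈ insert a S ∨ i ∈ Set.range xs) := by
      rintro i (hi | ⟨j, rfl⟩)
      · exact Or.inl (Finset.mem_insert_of_mem hi)
      · refine Fin.lastCases ?_ (fun j => ?_) j
        · left; simp
        · right; simp
    have hfa : f a < w'.length := by
      have := hget a (Or.inl (by simp))
      by_contra hcon
      rw [List.getElem?_eq_none (not_lt.1 hcon)] at this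
      cases this
    refine realizedIn_ex.2 ⟨⟨f a, hfa⟩, h w' f _ (fun i => ?_) (fun i hi => hget i (hmem i hi))
      fun i j hi hj => hmono i j (hmem i hi) (hmem j hj)⟩
    refine Fin.lastCases ?_ (fun j => ?_) i
    · simp
    · simpa using hys j

/-- `u` spells the letters at the positions in `S`, so an embedding of `u` into `w'` is a map on
these positions. Elsewhere `f` takes the default value `0`. -/
theorem exists_sublist_of_finset {w : List α} (S : Finset (Fin w.length)) :
    ∃ u : List α, u.length = S.card ∧ u.Sublist w ∧ ∀ w' : List α, u.Sublist w' →
      ∃ f : ℕ → ℕ, (∀ i ∈ S, w'[f i]? = some (w.get i)) ∧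
        ∀ i ∈ S, ∀ j ∈ S, i < j → f i < f j := by
  classical
  let e := S.orderIsoOfFin rfl
  let u : List α := List.ofFn fun i : Fin S.card => w.get (e i)
  have hu : u.length = S.card := by simp [u]
  refine ⟨u, hu, ?_, fun w' hw' => ?_⟩
  · rw [List.sublist_iff_exists_fin_orderEmbedding_get_eq]
    refine ⟨OrderEmbedding.ofStrictMono (fun i => (e (Fin.cast hu i) : Fin w.length)) ?_, fun i => ?_⟩
    · intro i j hij
      exact e.strictMono (show Fin.cast hu i < Fin.cast hu j from hij)
    · simp [u]
      rfl
  · obtain ⟨g, hg⟩ := List.sublist_iff_exists_fin_orderEmbedding_get_eq.1 hw'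
    refine ⟨fun n => if h : ∃ hn : n < w.length, (⟨n, hn⟩ : Fin w.length) ∈ S then
      g (Fin.cast hu.symm (e.symm ⟨⟨n, h.1⟩, h.2⟩)) else 0, ?_, ?_⟩
    · intro i hi
      have h : ∃ hn : (i : ℕ) < w.length, (⟨i, hn⟩ : Fin w.length) ∈ S := ⟨i.2, hi⟩
      beta_reduce
      rw [dif_pos h, List.getElem?_eq_getElem (Fin.is_lt _)]
      have := hg (Fin.cast hu.symm (e.symm ⟨i, hi⟩))
      simp only [List.get_eq_getElem] at this
      rw [← this]
      simp [u]
    · intro i hi j hj hij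
      have h : ∃ hn : (i : ℕ) < w.length, (⟨i, hn⟩ : Fin w.length) ∈ S := ⟨i.2, hi⟩
      have h' : ∃ hn : (j : ℕ) < w.length, (⟨j, hn⟩ : Fin w.length) ∈ S := ⟨j.2, hj⟩
      beta_reduce
      rw [dif_pos h, dif_pos h']
      refine g.strictMono ?_
      have := e.symm.strictMono (show (⟨i, hi⟩ : S) < ⟨j, hj⟩ from hij)
      exact this

/-- The witnesses of an existential sentence occupy at most `m` positions. The subword at these
positions recurs in every `m`-equivalent word and carries the witnesses over. -/
theorem IsBSigmaOne.exists_saturated {φ : (wordSignature α).Sentence} (h : IsBSigmaOne φ) :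
    ∃ m, ∀ w w', SubwordEquiv m w w' → (WordSatisfies w φ ↔ WordSatisfies w' φ) := by
  induction h with
  | @existential φ h =>
    obtain ⟨m, hm⟩ := exists_witnesses h
    have key : ∀ w w', SubwordEquiv m w w' → WordSatisfies w φ → WordSatisfies w' φ := by
      intro w w' hww' hw
      obtain ⟨S, hS, h⟩ := hm w default hw
      obtain ⟨u, hu, huw, h'⟩ := exists_sublist_of_finset S
      obtain ⟨f, hf, hf'⟩ := h' w' ((hww' u (hu.trans_le hS)).1 huw)
      refine h w' f default (fun i => i.elim0) ?_ ?_
      · rintro i (hi | ⟨j, -⟩)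
        · exact hf i hi
        · exact j.elim0
      · rintro i j (hi | ⟨k, -⟩) (hj | ⟨l, -⟩)
        · exact hf' i hi j hj
        · exact l.elim0
        · exact k.elim0
        · exact k.elim0
    exact ⟨m, fun w w' h => ⟨key w w' h, key w' w h.symm⟩⟩
  | not _ ih =>
    obtain ⟨m, hm⟩ := ih
    exact ⟨m, fun w w' h => not_congr (hm w w' h)⟩
  | inf _ _ ih₁ ih₂ =>
    obtain ⟨m, hm⟩ := ih₁
    obtain ⟨n, hn⟩ := ih₂
    refine ⟨max m n, fun w w' h => ?_⟩
    rw [wordSatisfies_inf, wordSatisfies_inf, hm w w' (h.mono (le_max_left _ _)),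
      hn w w' (h.mono (le_max_right _ _))]
  | sup _ _ ih₁ ih₂ =>
    obtain ⟨m, hm⟩ := ih₁
    obtain ⟨n, hn⟩ := ih₂
    refine ⟨max m n, fun w w' h => ?_⟩
    rw [wordSatisfies_sup, wordSatisfies_sup, hm w w' (h.mono (le_max_left _ _)),
      hn w w' (h.mono (le_max_right _ _))]

/-- Only the translation of languages into sentences is needed: a separating sentence is blind to
`m`-equivalence for some `m` and so rules out entanglement directly. -/
theorem bSigmaOneSeparable_iff [Finite α] {L₁ L₂ : Language α} :
    BSigmaOneSeparable L₁ L₂ ↔ ¬ Entangled L₁ L₂ := by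
  constructor
  · rintro ⟨φ, hφ, h₁, h₂⟩ h
    obtain ⟨m, hm⟩ := hφ.exists_saturated
    obtain ⟨w₁, hw₁, w₂, hw₂, h⟩ := h m
    exact h₂ w₂ hw₂ ((hm _ _ h).1 (h₁ w₁ hw₁))
  · intro h
    obtain ⟨L, hL, h₁, h₂⟩ := ptSeparable_iff.2 h
    obtain ⟨φ, hφ, h'⟩ := hL.exists_sentence
    refine ⟨φ, hφ, fun w hw => (h' w).2 (h₁ hw), fun w hw hwφ => ?_⟩
    have : w ∈ L₂ ⊓ L := ⟨hw, (h' w).1 hwφ⟩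
    rw [h₂] at this
    exact this

end Logic

/-! ### Structured stack programs, their machine code and timed Hoare triples. -/

section StackPrograms

open Turing Function

/-- The control state of stack programs: a flag and the symbol that was popped last. -/
abbrev Ctrl : Type := Bool × Option Bool

/-- Structured programs that work on stacks of bits indexed by `K`. -/
inductive SProg (K : Type) : Type
  | push (k : K) (f : Ctrl → Bool) : SProg K
  | pop (k : K) : SProg K
  | load (f : Ctrl → Ctrl) : SProg K
  | seq (p q : SProg K) : SProg K
  | ite (c : Ctrl → Bool) (p q : SProg K) : SProg K
  | loop (c : Ctrl → Bool) (p : SProg K) : SProg K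

namespace SProg

variable {K : Type}

/-- The labels of the machine code of a program. -/
def Lab : SProg K → Type
  | push _ _ => Unit
  | pop _ => Unit
  | load _ => Unit
  | seq p q => Lab p ⊕ Lab q
  | ite _ p q => Option (Lab p ⊕ Lab q)
  | loop _ p => Option (Lab p)

@[reducible]
def labFintype : ∀ p : SProg K, Fintype (Lab p)
  | push _ _ => inferInstanceAs (Fintype Unit)
  | pop _ => inferInstanceAs (Fintype Unit)
  | load _ => inferInstanceAs (Fintype Unit)
  | seq p q =>
    letI := labFintype p
    letI := labFintype q
    inferInstanceAs (Fintype (Lab p ⊕ Lab q))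
  | ite _ p q =>
    letI := labFintype p
    letI := labFintype q
    inferInstanceAs (Fintype (Option (Lab p ⊕ Lab q)))
  | loop _ p =>
    letI := labFintype p
    inferInstanceAs (Fintype (Option (Lab p)))

/-- The label at which a program starts. -/
def entry : ∀ p : SProg K, Lab p
  | push _ _ => ()
  | pop _ => ()
  | load _ => ()
  | seq p _ => Sum.inl (entry p)
  | ite _ _ _ => none
  | loop _ _ => none

/-- The machine code of a program; at its end, the statement `exit` is executed. -/
def code {Λ : Type} : ∀ p : SProg K, (Lab p → Λ) → TM2.Stmt (fun _ : K => Bool) Λ Ctrl →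
    Lab p → TM2.Stmt (fun _ : K => Bool) Λ Ctrl
  | push k f, _, exit, _ => .push k f exit
  | pop k, _, exit, _ => .pop k (fun v o => (v.1, o)) exit
  | load f, _, exit, _ => .load f exit
  | seq p q, emb, exit, l =>
    match l with
    | Sum.inl l => code p (emb ∘ Sum.inl) (.goto fun _ => emb (Sum.inr (entry q))) l
    | Sum.inr l => code q (emb ∘ Sum.inr) exit l
  | ite c p q, emb, exit, l =>
    match l with
    | none => .branch c (.goto fun _ => emb (some (Sum.inl (entry p))))
        (.goto fun _ => emb (some (Sum.inr (entry q))))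
    | some (Sum.inl l) => code p (emb ∘ some ∘ Sum.inl) exit l
    | some (Sum.inr l) => code q (emb ∘ some ∘ Sum.inr) exit l
  | loop c p, emb, exit, l =>
    match l with
    | none => .branch c (.goto fun _ => emb (some (entry p))) exit
    | some l => code p (emb ∘ some) (.goto fun _ => emb none) l

variable [DecidableEq K]

/-- The contents of the stacks. -/
abbrev Stacks (K : Type) : Type := K → List Bool

/-- `t` steps of the machine with code `M`. -/
def steps {Λ : Type} (M : Λ → TM2.Stmt (fun _ : K => Bool) Λ Ctrl) (t : ℕ)
    (c : Option (TM2.Cfg (fun _ : K => Bool) Λ Ctrl)) : Option (TM2.Cfg (fun _ : K => Bool) Λ Ctrl) :=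
  (flip bind (TM2.step M))^[t] c

theorem steps_add {Λ : Type} (M : Λ → TM2.Stmt (fun _ : K => Bool) Λ Ctrl) (s t : ℕ)
    (c : Option (TM2.Cfg (fun _ : K => Bool) Λ Ctrl)) :
    steps M (s + t) c = steps M t (steps M s c) := by
  rw [steps, add_comm, iterate_add_apply]; rfl

theorem steps_one {Λ : Type} (M : Λ → TM2.Stmt (fun _ : K => Bool) Λ Ctrl) (l : Λ) (v : Ctrl)
    (S : Stacks K) : steps M 1 (some ⟨some l, v, S⟩) = some (TM2.stepAux (M l) v S) := rfl

/-- Run from `(v, S)`, the program `p` ends in `(v', S')` after at most `T` steps; no stack grows by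
more than `T` symbols. -/
structure Runs (p : SProg K) (v : Ctrl) (S : Stacks K) (v' : Ctrl) (S' : Stacks K) (T : ℕ) :
    Prop where
  steps_eq : ∀ (Λ : Type) (M : Λ → TM2.Stmt (fun _ : K => Bool) Λ Ctrl) (emb : Lab p → Λ)
    (exit : TM2.Stmt (fun _ : K => Bool) Λ Ctrl), (∀ l, M (emb l) = code p emb exit l) →
    ∃ t ≤ T, steps M t (some ⟨some (emb (entry p)), v, S⟩) = some (TM2.stepAux exit v' S')
  length_le : ∀ k, (S' k).length ≤ (S k).length + T

variable {p q : SProg K} {v v₁ v' : Ctrl} {S S₁ S' : Stacks K} {T T₁ T₂ : ℕ}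

theorem Runs.mono (h : Runs p v S v' S' T) {T' : ℕ} (hT : T ≤ T') : Runs p v S v' S' T' where
  steps_eq Λ M emb exit hM := by
    obtain ⟨t, ht, h⟩ := h.steps_eq Λ M emb exit hM
    exact ⟨t, ht.trans hT, h⟩
  length_le k := (h.length_le k).trans (Nat.add_le_add_left hT _)

theorem runs_push (k : K) (f : Ctrl → Bool) (v : Ctrl) (S : Stacks K) :
    Runs (push k f) v S v (update S k (f v :: S k)) 1 where
  steps_eq Λ M emb exit hM := ⟨1, le_rfl, by rw [steps_one, hM]; rfl⟩
  length_le j := by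
    by_cases h : j = k
    · subst h; simp
    · simp [h]

theorem runs_pop (k : K) (v : Ctrl) (S : Stacks K) :
    Runs (pop k) v S (v.1, (S k).head?) (update S k (S k).tail) 1 where
  steps_eq Λ M emb exit hM := ⟨1, le_rfl, by rw [steps_one, hM]; rfl⟩
  length_le j := by
    by_cases h : j = k
    · subst h; simp; omega
    · simp [h]

theorem runs_load (f : Ctrl → Ctrl) (v : Ctrl) (S : Stacks K) :
    Runs (load f) v S (f v) S 1 where
  steps_eq Λ M emb exit hM := ⟨1, le_rfl, by rw [steps_one, hM]; rfl⟩
  length_le j := by simp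

/-- `Runs` refers to all machines that contain the code, with any exit statement. So the first part
runs inside the compound machine, its exit being the jump to the second part. -/
theorem Runs.seq (hp : Runs p v S v₁ S₁ T₁) (hq : Runs q v₁ S₁ v' S' T₂) :
    Runs (p.seq q) v S v' S' (T₁ + T₂) where
  steps_eq Λ M emb exit hM := by
    obtain ⟨s, hs, h₁⟩ := hp.steps_eq Λ M (emb ∘ Sum.inl) (.goto fun _ => emb (Sum.inr (entry q)))
      fun l => hM (Sum.inl l)
    obtain ⟨t, ht, h₂⟩ := hq.steps_eq Λ M (emb ∘ Sum.inr) exit fun l => hM (Sum.inr l)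
    refine ⟨s + t, Nat.add_le_add hs ht, ?_⟩
    rw [steps_add]
    exact (congrArg _ h₁).trans h₂
  length_le k := by
    have h₁ := hp.length_le k
    have h₂ := hq.length_le k
    omega

theorem Runs.ite_true {c : Ctrl → Bool} (hc : c v = true) (hp : Runs p v S v' S' T) :
    Runs (ite c p q) v S v' S' (T + 1) where
  steps_eq Λ M emb exit hM := by
    obtain ⟨t, ht, h⟩ := hp.steps_eq Λ M (emb ∘ some ∘ Sum.inl) exit fun l => hM (some (Sum.inl l))
    refine ⟨1 + t, by omega, ?_⟩
    rw [steps_add, steps_one, hM]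
    simp only [entry, code, TM2.stepAux, hc, cond_true]
    exact h
  length_le k := (hp.length_le k).trans (by omega)

theorem Runs.ite_false {c : Ctrl → Bool} (hc : c v = false) (hq : Runs q v S v' S' T) :
    Runs (ite c p q) v S v' S' (T + 1) where
  steps_eq Λ M emb exit hM := by
    obtain ⟨t, ht, h⟩ := hq.steps_eq Λ M (emb ∘ some ∘ Sum.inr) exit fun l => hM (some (Sum.inr l))
    refine ⟨1 + t, by omega, ?_⟩
    rw [steps_add, steps_one, hM]
    simp only [entry, code, TM2.stepAux, hc, cond_false]
    exact h
  length_le k := (hq.length_le k).trans (by omega)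

theorem runs_loop_false {c : Ctrl → Bool} (hc : c v = false) : Runs (loop c p) v S v S 1 where
  steps_eq Λ M emb exit hM := ⟨1, le_rfl, by
    rw [steps_one, hM]
    simp only [entry, code, TM2.stepAux, hc, cond_false]⟩
  length_le k := by omega

theorem Runs.loop_true {c : Ctrl → Bool} (hc : c v = true) (hp : Runs p v S v₁ S₁ T₁)
    (h : Runs (loop c p) v₁ S₁ v' S' T₂) : Runs (loop c p) v S v' S' (T₁ + 1 + T₂) where
  steps_eq Λ M emb exit hM := by
    obtain ⟨s, hs, h₁⟩ := hp.steps_eq Λ M (emb ∘ some) (.goto fun _ => emb none)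
      fun l => hM (some l)
    obtain ⟨t, ht, h₂⟩ := h.steps_eq Λ M emb exit hM
    refine ⟨1 + s + t, by omega, ?_⟩
    rw [steps_add, steps_add, steps_one, hM]
    simp only [entry, code, TM2.stepAux, hc, cond_true]
    exact (congrArg _ h₁).trans h₂
  length_le k := by
    have h₁ := hp.length_le k
    have h₂ := h.length_le k
    omega

/-- Hoare triples with a time bound. -/
def Triple (P : Ctrl → Stacks K → Prop) (p : SProg K) (Q : Ctrl → Stacks K → Prop) (T : ℕ) : Prop :=
  ∀ v S, P v S → ∃ v' S', Runs p v S v' S' T ∧ Q v' S'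

variable {P Q R : Ctrl → Stacks K → Prop}

theorem Triple.mono (h : Triple P p Q T) (hT : T ≤ T₁) : Triple P p Q T₁ := fun v S hP =>
  let ⟨v', S', h, hQ⟩ := h v S hP
  ⟨v', S', h.mono hT, hQ⟩

theorem Triple.pre (h : Triple P p Q T) (hP : ∀ v S, R v S → P v S) : Triple R p Q T :=
  fun v S hR => h v S (hP v S hR)

theorem Triple.post (h : Triple P p Q T) (hQ : ∀ v S, Q v S → R v S) : Triple P p R T :=
  fun v S hP =>
    let ⟨v', S', h, h'⟩ := h v S hP
    ⟨v', S', h, hQ _ _ h'⟩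

theorem Triple.seq (h₁ : Triple P p Q T₁) (h₂ : Triple Q q R T₂) :
    Triple P (p.seq q) R (T₁ + T₂) := fun v S hP =>
  let ⟨v₁, S₁, h₁, hQ⟩ := h₁ v S hP
  let ⟨v₂, S₂, h₂, hR⟩ := h₂ v₁ S₁ hQ
  ⟨v₂, S₂, h₁.seq h₂, hR⟩

/-- The sum of the two bounds, instead of their maximum, keeps bounds polynomial expressions. -/
theorem Triple.ite {c : Ctrl → Bool} (h₁ : Triple (fun v S => P v S ∧ c v = true) p Q T₁)
    (h₂ : Triple (fun v S => P v S ∧ c v = false) q Q T₂) :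
    Triple P (ite c p q) Q (T₁ + T₂ + 1) := fun v S hP => by
  by_cases hc : c v = true
  · obtain ⟨v', S', h, hQ⟩ := h₁ v S ⟨hP, hc⟩
    exact ⟨v', S', (Runs.ite_true hc h).mono (by omega), hQ⟩
  · rw [Bool.not_eq_true] at hc
    obtain ⟨v', S', h, hQ⟩ := h₂ v S ⟨hP, hc⟩
    exact ⟨v', S', (Runs.ite_false hc h).mono (by omega), hQ⟩

theorem triple_load {f : Ctrl → Ctrl} (h : ∀ v S, P v S → Q (f v) S) : Triple P (load f) Q 1 :=
  fun v S hP => ⟨_, _, runs_load f v S, h v S hP⟩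

theorem triple_push {k : K} {f : Ctrl → Bool}
    (h : ∀ v S, P v S → Q v (update S k (f v :: S k))) : Triple P (push k f) Q 1 :=
  fun v S hP => ⟨_, _, runs_push k f v S, h v S hP⟩

theorem Runs.cast (h : Runs p v S v₁ S₁ T₁) (hv : v₁ = v') (hS : S₁ = S') (hT : T₁ ≤ T) :
    Runs p v S v' S' T := by
  subst hv hS
  exact h.mono hT

/-- Push a symbol onto several stacks. -/
def pushAll (f : Ctrl → Bool) : List K → SProg K
  | [] => load id
  | k :: ks => (push k f).seq (pushAll f ks)

theorem runs_pushAll (f : Ctrl → Bool) : ∀ (ks : List K), ks.Nodup → ∀ (v : Ctrl) (S : Stacks K),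
    Runs (pushAll f ks) v S v (fun j => if j ∈ ks then f v :: S j else S j) (ks.length + 1)
  | [], _, v, S => (runs_load id v S).cast rfl (by simp) (by simp)
  | k :: ks, hks, v, S => by
      obtain ⟨hk, hks⟩ := List.nodup_cons.1 hks
      refine ((runs_push k f v S).seq (runs_pushAll f ks hks v _)).cast rfl ?_ ?_
      · ext1 j
        by_cases hj : j = k
        · subst hj; simp [hk]
        · simp [hj]
      · simp only [List.length_cons]; omega

/-- Pop symbols from the stack `k` as long as `c` holds, running `p` after each of them. -/
def popLoop (k : K) (c : Ctrl → Bool) (p : SProg K) : SProg K :=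
  (pop k).seq (loop c (p.seq (pop k)))

/-- What remains of `popLoop` after the first symbol has been popped. -/
def LoopRuns (k : K) (c : Ctrl → Bool) (p : SProg K) (v : Ctrl) (S : Stacks K) (v' : Ctrl)
    (S' : Stacks K) (T : ℕ) : Prop :=
  Runs (loop c (p.seq (pop k))) (v.1, (S k).head?) (update S k (S k).tail) v' S' T

variable {k : K} {c : Ctrl → Bool}

theorem LoopRuns.runs (h : LoopRuns k c p v S v' S' T) : Runs (popLoop k c p) v S v' S' (T + 1) :=
  ((runs_pop k v S).seq h).cast rfl rfl (by omega)

theorem loopRuns_stop (h : c (v.1, (S k).head?) = false) :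
    LoopRuns k c p v S (v.1, (S k).head?) (update S k (S k).tail) 1 :=
  runs_loop_false h

theorem loopRuns_nil (hS : S k = []) (h : c (v.1, none) = false) :
    LoopRuns k c p v S (v.1, none) S 1 := by
  have := loopRuns_stop (k := k) (c := c) (p := p) (v := v) (S := S) (by simpa [hS] using h)
  simp only [hS, List.head?_nil, List.tail_nil] at this
  rwa [← hS, update_eq_self] at this

/-- The `2` pays for the branch and for popping the next symbol. -/
theorem LoopRuns.cons {a : Bool} {l : List Bool} (hS : S k = a :: l) (hc : c (v.1, some a) = true)
    (hp : Runs p (v.1, some a) (update S k l) v₁ S₁ T₁) (h : LoopRuns k c p v₁ S₁ v' S' T₂) :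
    LoopRuns k c p v S v' S' (T₁ + 2 + T₂) := by
  unfold LoopRuns
  rw [hS, List.head?_cons, List.tail_cons]
  exact (Runs.loop_true hc (hp.seq (runs_pop k v₁ S₁)) h).cast rfl rfl (by omega)

/-- Empty the stack `k`, copying its symbols onto the stacks `ks` and as many ticks onto the stacks
`ts`. -/
def drain (k : K) (ks ts : List K) : SProg K :=
  popLoop k (fun v => v.2.isSome)
    ((pushAll (fun v => v.2.getD false) ks).seq (pushAll (fun _ => true) ts))

/-- The effect of `drain`. -/
def drained (k : K) (ks ts : List K) (S : Stacks K) : Stacks K := fun j =>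
  if j = k then []
  else if j ∈ ks then (S k).reverse ++ S j
  else if j ∈ ts then List.replicate (S k).length true ++ S j
  else S j

/-- Symbols arrive on `ks` in reverse order, so draining a stack into an empty one and back restores
it; the ticks on `ts` record its height meanwhile. -/
theorem loopRuns_drain {k : K} {ks ts : List K} (hks : ks.Nodup) (hts : ts.Nodup) (hk : k ∉ ks)
    (hk' : k ∉ ts) (hd : ∀ j ∈ ks, j ∉ ts) : ∀ (l : List Bool) (v : Ctrl) (S : Stacks K), S k = l →
    LoopRuns k (fun v => v.2.isSome)
      ((pushAll (fun v => v.2.getD false) ks).seq (pushAll (fun _ => true) ts))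
      v S (v.1, none) (drained k ks ts S) ((ks.length + ts.length + 4) * l.length + 1)
  | [], v, S, hS => by
      refine Runs.cast (loopRuns_nil hS rfl) rfl ?_ (by simp)
      ext1 j
      by_cases hj : j = k
      · subst hj; simp [drained, hS]
      · simp [drained, hj, hS]
  | a :: l, v, S, hS => by
      have h₁ := (runs_pushAll (fun v => v.2.getD false) ks hks (v.1, some a)
        (update S k l)).seq (runs_pushAll (fun _ => true) ts hts _ _)
      refine Runs.cast (LoopRuns.cons hS rfl h₁ (loopRuns_drain hks hts hk hk' hd l _ _ ?_))
        rfl ?_ ?_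
      · simp [hk, hk']
      · ext1 j
        by_cases hj : j = k
        · subst hj; simp [drained]
        · by_cases h : j ∈ ks
          · simp [drained, hj, h, hd j h, hk, hk', hS]
          · by_cases h' : j ∈ ts
            · simp [drained, hj, h, h', hk, hk', hS, List.replicate_succ']
            · simp [drained, hj, h, h']
      · simp only [List.length_cons, Nat.mul_add]; omega

theorem runs_drain {k : K} {ks ts : List K} (hks : ks.Nodup) (hts : ts.Nodup) (hk : k ∉ ks)
    (hk' : k ∉ ts) (hd : ∀ j ∈ ks, j ∉ ts) (v : Ctrl) (S : Stacks K) :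
    Runs (drain k ks ts) v S (v.1, none) (drained k ks ts S)
      ((ks.length + ts.length + 4) * (S k).length + 2) :=
  (loopRuns_drain hks hts hk hk' hd _ v S rfl).runs

/-- Empty a stack. -/
def clear (k : K) : SProg K := drain k [] []

theorem runs_clear (k : K) (v : Ctrl) (S : Stacks K) :
    Runs (clear k) v S (v.1, none) (update S k []) (4 * (S k).length + 2) := by
  refine (runs_drain (k := k) (by simp) (by simp) (by simp) (by simp) (by simp) v S).cast rfl ?_
    (by simp)
  ext1 j
  by_cases hj : j = k
  · subst hj; simp [drained]
  · simp [drained, hj]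

/-- Empty several stacks. -/
def clearAll : List K → SProg K
  | [] => load id
  | k :: ks => (clear k).seq (clearAll ks)

/-- The flag `v.1` survives; it holds the answer while the machine cleans up. -/
theorem runs_clearAll {m : ℕ} : ∀ (ks : List K) (v : Ctrl) (S : Stacks K),
    (∀ k, (S k).length ≤ m) → ∃ o, Runs (clearAll ks) v S (v.1, o)
      (fun j => if j ∈ ks then [] else S j) ((4 * m + 2) * ks.length + 1)
  | [], v, S, _ => ⟨v.2, (runs_load id v S).cast rfl (by simp) (by simp)⟩
  | k :: ks, v, S, hS => by
      obtain ⟨o, h⟩ := runs_clearAll ks (v.1, none) (update S k []) (fun j => by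
        by_cases hj : j = k
        · subst hj; simp
        · simpa [hj] using hS j)
      refine ⟨o, ((runs_clear k v S).seq h).cast rfl ?_ ?_⟩
      · ext1 j
        by_cases hj : j = k
        · subst hj; simp
        · simp [hj]
      · have := hS k
        simp only [List.length_cons, Nat.mul_add]; omega

end SProg
end StackPrograms

/-! ### Programs with unary registers and bit arrays. -/

section TablePrograms

open Function Polynomial

/-- The stacks of a machine with unary registers `V` and bit arrays `A`. -/
inductive Stk (V A : Type) : Type
  | var (x : V) : Stk V A
  | arr (a : A) : Stk V A
  | ptr : Stk V A
  | tmp : Stk V A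
  | ctl : Stk V A
  | out : Stk V A
  deriving DecidableEq, Fintype

variable {V A : Type} [DecidableEq V] [DecidableEq A]

/-- The contents of the bit arrays. -/
abbrev Mem (A : Type) : Type := A → ℕ → Bool

open SProg

/-- The stacks represent the registers `env`, the arrays `m`, the pointer `n`, the control stack `C`
and the flag `b`. -/
structure Rep (env : V → ℕ) (m : Mem A) (n : ℕ) (C : List Bool) (b : Bool) (v : Ctrl)
    (S : Stacks (Stk V A)) : Prop where
  var : ∀ x, S (.var x) = List.replicate (env x) true
  arr : ∀ a i, (S (.arr a)).getD i false = m a i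
  ptr : S .ptr = List.replicate n true
  tmp : S .tmp = []
  ctl : S .ctl = C
  out : S .out = []
  flag : v.1 = b

/-- The first `n` bits, with trailing zeros if there are fewer. -/
def padTake : ℕ → List Bool → List Bool
  | 0, _ => []
  | n + 1, l => l.head?.getD false :: padTake n l.tail

theorem length_padTake : ∀ (n : ℕ) (l : List Bool), (padTake n l).length = n
  | 0, _ => rfl
  | n + 1, l => by simp [padTake, length_padTake n]

/-- Arrays are finite lists read with default `false`. Padding makes a write beyond the end of the
list land at position `n`. -/
theorem getD_padTake_append (b : Bool) : ∀ (n : ℕ) (l : List Bool) (i : ℕ),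
    (padTake n l ++ b :: l.drop (n + 1)).getD i false = if i = n then b else l.getD i false
  | 0, l, i => by cases i <;> cases l <;> simp [padTake]
  | n + 1, l, i => by
      have ih := fun j => getD_padTake_append b n l.tail j
      cases i with
      | zero => cases l <;> simp [padTake]
      | succ i =>
        have := ih i
        cases l with
        | nil => simpa [padTake] using this
        | cons a l => simpa [padTake] using this

/-- Move the first symbols of an array to `tmp`, as many as `ptr` says. -/
def walk (a : A) : SProg (Stk V A) :=
  popLoop .ptr (fun v => v.2.isSome) ((pop (.arr a)).seq (push .tmp fun v => v.2.getD false))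

theorem loopRuns_walk (a : A) : ∀ (n : ℕ) (v : Ctrl) (S : Stacks (Stk V A)), (S .ptr).length = n →
    LoopRuns .ptr (fun v => v.2.isSome) ((pop (.arr a)).seq (push .tmp fun v => v.2.getD false))
      v S (v.1, none) (update (update (update S .ptr []) .tmp
        ((padTake n (S (.arr a))).reverse ++ S .tmp)) (.arr a) ((S (.arr a)).drop n)) (4 * n + 1)
  | 0, v, S, h => by
      have h := List.length_eq_zero_iff.1 h
      refine Runs.cast (loopRuns_nil h rfl) rfl ?_ (by simp)
      ext1 j
      cases j <;> simp [padTake, h, update_apply]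
      intro h; rw [h]
  | n + 1, v, S, h => by
      obtain ⟨c, l, hl⟩ := List.exists_cons_of_length_eq_add_one h
      have hlen : l.length = n := by simpa [hl] using h
      have h₁ := (runs_pop (.arr a) (v.1, some c) (update S .ptr l)).seq
        (runs_push .tmp (fun v => v.2.getD false) _ _)
      refine Runs.cast (LoopRuns.cons hl rfl h₁ (loopRuns_walk a n _ _ (by simpa using hlen)))
        rfl ?_ (by omega)
      ext1 j
      cases j <;> simp [padTake, update_apply]
      split_ifs <;> rfl

/-- Read the bit of an array at the position `ptr` into the flag, or write the flag there. -/
def access (a : A) (write : Bool) : SProg (Stk V A) :=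
  (walk a).seq ((pop (.arr a)).seq ((load fun v => (if write then v.1 else v.2.getD false, v.2)).seq
    ((push (.arr a) fun v => v.1).seq (drain .tmp [.arr a] []))))

/-- The first `n` bits are moved to `tmp`, the next one is popped, it or the flag is pushed, and the
`n` bits are poured back. The pointer is used up on the way. -/
theorem runs_access (a : A) (w : Bool) (v : Ctrl) (S : Stacks (Stk V A)) (n : ℕ)
    (hn : (S .ptr).length = n) (htmp : S .tmp = []) :
    Runs (access a w) v S (if w then v.1 else (S (.arr a)).getD n false, none)
      (update (update S .ptr []) (.arr a) (padTake n (S (.arr a)) ++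
        (if w then v.1 else (S (.arr a)).getD n false) :: (S (.arr a)).drop (n + 1)))
      (9 * n + 8) := by
  have h := ((loopRuns_walk a n v S hn).runs.seq ((runs_pop (.arr a) _ _).seq ((runs_load
    (fun v => (if w then v.1 else v.2.getD false, v.2)) _ _).seq
    ((runs_push (.arr a) (fun v => v.1) _ _).seq
      (runs_drain (k := .tmp) (ks := [.arr a]) (ts := []) (by simp) (by simp) (by simp) (by simp)
        (by simp) _ _)))))
  refine h.cast ?_ ?_ ?_
  · simp [List.getD_eq_getElem?_getD]
  · ext1 j
    cases j <;> simp [update_apply, drained, htmp]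
    split_ifs <;> simp
  · simp [htmp, length_padTake]
    omega

theorem triple_read (env : V → ℕ) (m : Mem A) (n : ℕ) (C : List Bool) (b : Bool) (a : A) :
    Triple (Rep env m n C b) (access a false) (Rep env m 0 C (m a n)) (9 * n + 8) := by
  intro v S h
  refine ⟨_, _, runs_access a false v S n (by simp [h.ptr]) h.tmp, ?_⟩
  refine ⟨fun x => ?_, fun a' i => ?_, ?_, ?_, ?_, ?_, ?_⟩
  · simpa using h.var x
  · by_cases ha : a' = a
    · subst ha
      rw [update_self, getD_padTake_append, ← h.arr a' i]
      by_cases hi : i = n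
      · rw [if_pos hi, hi]; rfl
      · rw [if_neg hi]
    · simpa [ha, update_apply] using h.arr a' i
  · simp
  · simpa using h.tmp
  · simpa using h.ctl
  · simpa using h.out
  · simpa using h.arr a n

theorem triple_write (env : V → ℕ) (m : Mem A) (n : ℕ) (C : List Bool) (b : Bool) (a : A) :
    Triple (Rep env m n C b) (access a true)
      (Rep env (update m a (update (m a) n b)) 0 C b) (9 * n + 8) := by
  intro v S h
  refine ⟨_, _, runs_access a true v S n (by simp [h.ptr]) h.tmp, ?_⟩
  refine ⟨fun x => ?_, fun a' i => ?_, ?_, ?_, ?_, ?_, ?_⟩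
  · simpa using h.var x
  · by_cases ha : a' = a
    · subst ha
      rw [update_self, getD_padTake_append, h.arr, if_pos rfl, h.flag, update_self, update_apply, h.arr]
    · simpa [ha, update_apply] using h.arr a' i
  · simp
  · simpa using h.tmp
  · simpa using h.ctl
  · simpa using h.out
  · simpa using h.flag

/-- Run `p` as many times as the register `y` says. The control stack holds the count. -/
def repeatProg (y : V) (p : SProg (Stk V A)) : SProg (Stk V A) :=
  ((push .ctl fun _ => false).seq ((drain (.var y) [.tmp] []).seq
    (drain .tmp [.var y] [.ctl]))).seq (popLoop .ctl (fun v => v.2 == some true) p)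

/-- The remaining rounds lie as ticks on the control stack above a mark `false`, so nested loops
pile up there. The invariant `J` therefore takes the control stack as a parameter, and `hfr` says
that this stack and the last popped symbol may be exchanged. -/
theorem triple_repeatProg {y : V} {p : SProg (Stk V A)} {n T : ℕ}
    (J : ℕ → List Bool → Ctrl → Stacks (Stk V A) → Prop)
    (hfr : ∀ i C C' v v' S, J i C v S → v'.1 = v.1 → J i C' v' (update S .ctl C'))
    (hctl : ∀ i C v S, J i C v S → S .ctl = C)
    (h0 : ∀ C v S, J 0 C v S → S (.var y) = List.replicate n true ∧ S .tmp = [])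
    (hp : ∀ i < n, ∀ C, Triple (J i C) p (J (i + 1) C) T) (C : List Bool) :
    Triple (J 0 C) (repeatProg y p) (J n C) (n * (T + 13) + 7) := by
  -- `d` rounds remain after `i` of them; popping the mark ends the loop.
  have hloop : ∀ d i, i + d = n → ∀ v S, J i (List.replicate d true ++ false :: C) v S →
      ∃ v' S', LoopRuns .ctl (fun v => v.2 == some true) p v S v' S' (d * (T + 2) + 1) ∧
        J n C v' S' := by
    intro d
    induction d with
    | zero =>
      intro i hi v S hJ
      have hS := hctl _ _ _ _ hJ
      simp only [List.replicate_zero, List.nil_append] at hS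
      refine ⟨_, _, (loopRuns_stop (by simp [hS])).cast rfl rfl (by omega), ?_⟩
      rw [add_zero] at hi
      subst hi
      rw [hS]
      exact hfr _ _ _ _ _ _ hJ rfl
    | succ d ih =>
      intro i hi v S hJ
      have hS := hctl _ _ _ _ hJ
      rw [List.replicate_succ, List.cons_append] at hS
      obtain ⟨v₁, S₁, h₁, hJ₁⟩ := hp i (by omega) (List.replicate d true ++ false :: C)
        (v.1, some true) _ (hfr _ _ _ _ _ _ hJ rfl)
      obtain ⟨v', S', h₂, hJ₂⟩ := ih (i + 1) (by omega) v₁ S₁ hJ₁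
      refine ⟨v', S', (LoopRuns.cons hS rfl h₁ h₂).cast rfl rfl ?_, hJ₂⟩
      rw [Nat.succ_mul]; omega
  intro v S hJ
  obtain ⟨hy, htmp⟩ := h0 _ _ _ hJ
  have hS := hctl _ _ _ _ hJ
  have h := (runs_push .ctl (fun _ => false) v S).seq
    ((runs_drain (k := .var y) (ks := [.tmp]) (ts := []) (by simp) (by simp) (by simp) (by simp)
      (by simp) _ _).seq (runs_drain (k := .tmp) (ks := [.var y]) (ts := [.ctl]) (by simp) (by simp)
      (by simp) (by simp) (by simp) _ _))
  -- One step for the mark, `5 * n + 2` for pouring `y` into `tmp`, and `6 * n + 2` for pouring it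
  -- back with a tick on the control stack for each unit.
  replace h := h.cast (S' := update S .ctl (List.replicate n true ++ false :: C))
    (T := 11 * n + 5) rfl (by
      ext1 j
      cases j with
      | var x => by_cases hx : x = y <;> simp [drained, hy, htmp, hx]
      | _ => simp [drained, hy, htmp, hS]) (by simp [drained, hy, htmp]; omega)
  obtain ⟨v', S', h', hJ'⟩ := hloop n 0 (by omega) (v.1, none) _ (hfr _ _ _ (v' := (v.1, none)) _ _ hJ rfl)
  refine ⟨v', S', (h.seq h'.runs).cast rfl rfl ?_, hJ'⟩
  rw [Nat.mul_add, Nat.mul_add]; omega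

/-- Run `p` for the values of the register `x` from `0` to `y - 1`. -/
def forProg (x y : V) (p : SProg (Stk V A)) : SProg (Stk V A) :=
  (repeatProg y (p.seq (push (.var x) fun _ => true))).seq (clear (.var x))

/-- The register `x` counts the rounds in unary, so it must be `0` at the start and is cleared at
the end. `G` is a relation because the specification of a body need not determine the flag. -/
theorem triple_forProg {x y : V} {p : SProg (Stk V A)} {env : V → ℕ} {T : ℕ} (hx : env x = 0)
    (G : ℕ → Mem A → Bool → Prop)
    (hp : ∀ i < env y, ∀ C m b, G i m b → Triple (Rep (update env x i) m 0 C b) p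
      (fun v S => ∃ m' b', G (i + 1) m' b' ∧ Rep (update env x i) m' 0 C b' v S) T)
    {m : Mem A} {b : Bool} (h0 : G 0 m b) (C : List Bool) :
    Triple (Rep env m 0 C b) (forProg x y p)
      (fun v S => ∃ m' b', G (env y) m' b' ∧ Rep env m' 0 C b' v S)
      (env y * (T + 18) + 9) := by
  let J : ℕ → List Bool → Ctrl → Stacks (Stk V A) → Prop := fun i C v S =>
    ∃ m b, G i m b ∧ Rep (update env x i) m 0 C b v S
  have h := triple_repeatProg (y := y) (p := p.seq (push (.var x) fun _ => true)) (n := env y)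
    (T := T + 1) J ?_ ?_ ?_ ?_ C
  · intro v S hv
    obtain ⟨v', S', h₁, m', b', hG, hR⟩ := h v S ⟨m, b, h0, by
      have := update_eq_self x env
      rw [hx] at this
      rwa [this]⟩
    refine ⟨_, _, Runs.cast (p := forProg x y p) (h₁.seq (runs_clear (.var x) v' S')) rfl rfl ?_, m',
      b', hG, ?_⟩
    · have : (S' (.var x)).length = env y := by rw [hR.var]; simp
      rw [this]
      simp only [Nat.mul_add]
      omega
    · refine ⟨fun z => ?_, fun a i => ?_, ?_, ?_, ?_, ?_, ?_⟩
      · by_cases hz : z = x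
        · subst hz; simp [hx]
        · simpa [hz] using hR.var z
      · simpa using hR.arr a i
      · simpa using hR.ptr
      · simpa using hR.tmp
      · simpa using hR.ctl
      · simpa using hR.out
      · exact hR.flag
  · rintro i C C' v v' S ⟨m, b, hG, hR⟩ hv
    refine ⟨m, b, hG, fun z => ?_, fun a i => ?_, ?_, ?_, ?_, ?_, ?_⟩
    · simpa using hR.var z
    · simpa using hR.arr a i
    · simpa using hR.ptr
    · simpa using hR.tmp
    · simp
    · simpa using hR.out
    · exact hv.trans hR.flag
  · rintro i C v S ⟨m, b, hG, hR⟩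
    exact hR.ctl
  · rintro C v S ⟨m, b, hG, hR⟩
    have := update_eq_self x env
    rw [hx] at this
    rw [this] at hR
    exact ⟨hR.var y, hR.tmp⟩
  · rintro i hi C v S ⟨m, b, hG, hR⟩
    obtain ⟨v', S', h₁, m', b', hG', hR'⟩ := hp i hi C m b hG v S hR
    refine ⟨_, _, h₁.seq (runs_push _ _ _ _), m', b', hG', fun z => ?_, fun a i => ?_, ?_, ?_, ?_,
      ?_, ?_⟩
    · by_cases hz : z = x
      · subst hz
        simp only [update_self, hR'.var]
        rfl
      · simpa [hz] using hR'.var z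
    · simpa using hR'.arr a i
    · simpa using hR'.ptr
    · simpa using hR'.tmp
    · simpa using hR'.ctl
    · simpa using hR'.out
    · exact hR'.flag

/-- Addresses in arrays: sums of products of registers. -/
abbrev Addr (V : Type) : Type := List (List V)

/-- The value of an address. -/
def Addr.val (env : V → ℕ) (e : Addr V) : ℕ := (e.map fun xs => (xs.map env).prod).sum

/-- Add a product of registers to the pointer. -/
def addMono : List V → SProg (Stk V A)
  | [] => push .ptr fun _ => true
  | x :: xs => repeatProg x (addMono xs)

/-- This cost and those below are polynomials in a common bound for all registers and follow the
syntax of the program. -/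
noncomputable def monoCost : List V → Polynomial ℕ
  | [] => 1
  | _ :: xs => X * (monoCost xs + 13) + 7

/-- Nested repetitions multiply: the innermost push is executed once for each tuple of loop indices.
-/
theorem triple_addMono {N : ℕ} {env : V → ℕ} (hN : ∀ x, env x ≤ N) (m : Mem A) (b : Bool) :
    ∀ (xs : List V) (n : ℕ) (C : List Bool), Triple (Rep env m n C b) (addMono xs)
      (Rep env m (n + (xs.map env).prod) C b) ((monoCost xs).eval N)
  | [], n, C => by
      simp only [monoCost, eval_one]
      refine triple_push fun v S hR => ⟨fun z => ?_, fun a i => ?_, ?_, ?_, ?_, ?_, ?_⟩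
      · simpa using hR.var z
      · simpa using hR.arr a i
      · simp [hR.ptr, List.replicate_succ]
      · simpa using hR.tmp
      · simpa using hR.ctl
      · simpa using hR.out
      · exact hR.flag
  | x :: xs, n, C => by
      have h := triple_repeatProg (y := x) (p := addMono xs) (n := env x)
        (T := (monoCost xs).eval N)
        (fun i C => Rep env m (n + i * (xs.map env).prod) C b) ?_ ?_ ?_ ?_ C
      · simp only [zero_mul, add_zero] at h
        simp only [List.map_cons, List.prod_cons, monoCost, eval_add, eval_mul, eval_X, eval_ofNat]
        exact h.mono (Nat.add_le_add_right (Nat.mul_le_mul_right _ (hN x)) _)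
      · rintro i C C' v v' S hR hv
        refine ⟨fun z => ?_, fun a i => ?_, ?_, ?_, ?_, ?_, ?_⟩
        · simpa using hR.var z
        · simpa using hR.arr a i
        · simpa using hR.ptr
        · simpa using hR.tmp
        · simp
        · simpa using hR.out
        · exact hv.trans hR.flag
      · intro i C v S hR
        exact hR.ctl
      · intro C v S hR
        exact ⟨hR.var x, hR.tmp⟩
      · intro i _ C
        have := triple_addMono hN m b xs (n + i * (xs.map env).prod) C
        rwa [add_assoc, ← Nat.succ_mul] at this

/-- Add an address to the pointer. -/
def addAddr : Addr V → SProg (Stk V A)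
  | [] => load id
  | xs :: e => (addMono xs).seq (addAddr e)

noncomputable def addrCost : Addr V → Polynomial ℕ
  | [] => 1
  | xs :: e => monoCost xs + addrCost e

theorem triple_addAddr {N : ℕ} {env : V → ℕ} (hN : ∀ x, env x ≤ N) (m : Mem A) (b : Bool)
    (C : List Bool) : ∀ (e : Addr V) (n : ℕ), Triple (Rep env m n C b) (addAddr e)
      (Rep env m (n + Addr.val env e) C b) ((addrCost e).eval N)
  | [], n => by
      simp only [addrCost, eval_one]
      exact triple_load fun v S h => h
  | xs :: e, n => by
      have h := (triple_addMono hN m b xs n C).seq (triple_addAddr hN m b C e _)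
      rw [addrCost, eval_add]
      simp only [Addr.val, List.map_cons, List.sum_cons, ← add_assoc] at h ⊢
      exact h

noncomputable def addrBound : Addr V → Polynomial ℕ
  | [] => 0
  | xs :: e => X ^ xs.length + addrBound e

omit [DecidableEq V] in
theorem Addr.val_le {N : ℕ} {env : V → ℕ} (hN : ∀ x, env x ≤ N) :
    ∀ e : Addr V, Addr.val env e ≤ (addrBound e).eval N
  | [] => by simp [Addr.val]
  | xs :: e => by
      have h := Addr.val_le hN e
      have h' : (xs.map env).prod ≤ N ^ xs.length := by
        simpa using List.prod_le_pow_card (xs.map env) N (by simpa using fun x _ => hN x)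
      simp only [Addr.val, List.map_cons, List.sum_cons, addrBound, eval_add, eval_pow, eval_X]
        at h ⊢
      omega

/-- Formulas with bounded quantifiers about bit arrays. -/
inductive Fm (V A : Type) : Type
  | bit (a : A) (e : Addr V) : Fm V A
  | not (φ : Fm V A) : Fm V A
  | and (φ ψ : Fm V A) : Fm V A
  | ex (x y : V) (φ : Fm V A) : Fm V A

namespace Fm

def Holds : Fm V A → (V → ℕ) → Mem A → Prop
  | bit a e, env, m => m a (Addr.val env e) = true
  | not φ, env, m => ¬ φ.Holds env m
  | and φ ψ, env, m => φ.Holds env m ∧ ψ.Holds env m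
  | ex x y φ, env, m => ∃ i < env y, φ.Holds (update env x i) m

/-- The truth value of a formula. -/
noncomputable def eval (φ : Fm V A) (env : V → ℕ) (m : Mem A) : Bool :=
  @decide (φ.Holds env m) (Classical.propDecidable _)

omit [DecidableEq A] in
theorem eval_eq_true {φ : Fm V A} {env : V → ℕ} {m : Mem A} :
    φ.eval env m = true ↔ φ.Holds env m :=
  @decide_eq_true_iff (φ.Holds env m) (Classical.propDecidable _)

omit [DecidableEq A] in
theorem eval_eq_false {φ : Fm V A} {env : V → ℕ} {m : Mem A} :
    φ.eval env m = false ↔ ¬ φ.Holds env m := by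
  rw [← eval_eq_true, Bool.not_eq_true]

/-- The program that evaluates a formula into the flag. -/
def prog : Fm V A → SProg (Stk V A)
  | bit a e => (addAddr e).seq (access a false)
  | not φ => φ.prog.seq (load fun v => (!v.1, v.2))
  | and φ ψ => φ.prog.seq (ite (fun v => v.1) ψ.prog (load id))
  | ex x y φ => (load fun v => (false, v.2)).seq
      (forProg x y (ite (fun v => v.1) (load id) φ.prog))

noncomputable def cost : Fm V A → Polynomial ℕ
  | bit _ e => addrCost e + (9 * addrBound e + 8)
  | not φ => φ.cost + 1
  | and φ ψ => φ.cost + (ψ.cost + 1 + 1)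
  | ex _ _ φ => 1 + (X * (1 + φ.cost + 1 + 18) + 9)

/-- The variables in `sc` are not bound again. -/
def wf : Fm V A → List V → Bool
  | bit _ _, _ => true
  | not φ, sc => φ.wf sc
  | and φ ψ, sc => φ.wf sc && ψ.wf sc
  | ex x _ φ, sc => decide (x ∉ sc) && φ.wf (x :: sc)

/-- Registers outside `sc` are `0`, as `forProg` requires of the register of a quantifier. The loop
of a quantifier keeps the disjunction over the values tried so far in the flag and skips the
evaluation once it is true. -/
theorem triple_prog {N : ℕ} (m : Mem A) : ∀ (φ : Fm V A) {sc : List V} {env : V → ℕ},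
    φ.wf sc = true → (∀ x, env x ≤ N) → (∀ x ∉ sc, env x = 0) → ∀ (C : List Bool) (b : Bool),
    Triple (Rep env m 0 C b) φ.prog (Rep env m 0 C (φ.eval env m)) (φ.cost.eval N)
  | bit a e, sc, env, _, hN, _, C, b => by
      have h := (triple_addAddr hN m b C e 0).seq (triple_read env m _ C b a)
      refine (h.mono ?_).post ?_
      · have := Addr.val_le hN e
        simp only [cost, eval_add, eval_mul, eval_ofNat]
        omega
      · intro v S h
        rw [zero_add] at h
        rwa [show (bit a e).eval env m = m a (Addr.val env e) from
          Bool.eq_iff_iff.2 eval_eq_true]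
  | not φ, sc, env, hwf, hN, hsc, C, b => by
      have h := (triple_prog m φ hwf hN hsc C b).seq (triple_load (f := fun v => (!v.1, v.2))
        (Q := Rep env m 0 C ((not φ).eval env m)) ?_)
      · refine h.mono ?_
        simp only [cost, eval_add, eval_one, le_refl]
      · intro v S h
        exact ⟨h.var, h.arr, h.ptr, h.tmp, h.ctl, h.out, by
          rw [h.flag, Bool.eq_iff_iff, eval_eq_true, Bool.not_eq_true', eval_eq_false]; rfl⟩
  | and φ ψ, sc, env, hwf, hN, hsc, C, b => by
      simp only [wf, Bool.and_eq_true] at hwf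
      refine ((triple_prog m φ hwf.1 hN hsc C b).seq (Triple.ite (T₁ := ψ.cost.eval N) (T₂ := 1)
        (Q := Rep env m 0 C ((and φ ψ).eval env m)) ?_ ?_)).mono ?_
      · by_cases hφ : φ.Holds env m
        · refine ((triple_prog m ψ hwf.2 hN hsc C _).pre fun v S h => h.1).post fun v S h => ?_
          rwa [show (and φ ψ).eval env m = ψ.eval env m from Bool.eq_iff_iff.2 (by
            rw [eval_eq_true, eval_eq_true, Holds, and_iff_right hφ])]
        · rintro v S ⟨h, h'⟩
          rw [h.flag] at h'
          exact absurd (eval_eq_true.1 h') hφ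
      · refine triple_load fun v S h => ?_
        obtain ⟨h, h'⟩ := h
        rw [h.flag] at h'
        rw [h'] at h
        rwa [show (and φ ψ).eval env m = false from
          eval_eq_false.2 fun hφ => eval_eq_false.1 h' hφ.1]
      · simp only [cost, eval_add, eval_one]; omega
  | ex x y φ, sc, env, hwf, hN, hsc, C, b => by
      simp only [wf, Bool.and_eq_true, decide_eq_true_eq] at hwf
      have hx := hsc x hwf.1
      let G : ℕ → Mem A → Bool → Prop := fun i m' b' =>
        m' = m ∧ (b' = true ↔ ∃ j < i, φ.Holds (update env x j) m)
      have hbody : ∀ i < env y, ∀ C m' b, G i m' b → Triple (Rep (update env x i) m' 0 C b)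
          (ite (fun v => v.1) (load id) φ.prog)
          (fun v S => ∃ m' b', G (i + 1) m' b' ∧ Rep (update env x i) m' 0 C b' v S)
          (1 + φ.cost.eval N + 1) := by
        rintro i hi C m' b ⟨rfl, hb⟩
        refine Triple.ite ?_ ?_
        · refine triple_load fun v S h => ?_
          obtain ⟨h, h'⟩ := h
          rw [h.flag] at h'
          obtain ⟨j, hj, hj'⟩ := hb.1 h'
          exact ⟨m', b, ⟨rfl, iff_of_true h' ⟨j, by omega, hj'⟩⟩, h⟩
        · intro v S h
          obtain ⟨h, h'⟩ := h
          rw [h.flag] at h'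
          have hN' : ∀ z, update env x i z ≤ N := fun z => by
            by_cases hz : z = x
            · subst hz
              simpa using hi.le.trans (hN y)
            · simpa [hz] using hN z
          have hsc' : ∀ z ∉ x :: sc, update env x i z = 0 := fun z hz => by
            rw [List.mem_cons, not_or] at hz
            simpa [hz.1] using hsc z hz.2
          obtain ⟨v', S', h₁, h₂⟩ := triple_prog m' φ hwf.2 hN' hsc' C _ v S h
          refine ⟨v', S', h₁, m', _, ⟨rfl, ?_⟩, h₂⟩
          rw [eval_eq_true]
          refine ⟨fun h => ⟨i, by omega, h⟩, ?_⟩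
          rintro ⟨j, hj, hj'⟩
          obtain rfl : j = i := by
            by_contra hne
            rw [hb.2 ⟨j, by omega, hj'⟩] at h'
            cases h'
          exact hj'
      have h := triple_forProg hx G hbody (m := m) (b := false) (by simp [G]) C
      refine ((Triple.seq (T₁ := 1) (Q := Rep env m 0 C false) (triple_load fun v S h => ?_)
        h).mono ?_).post ?_
      · exact ⟨h.var, h.arr, h.ptr, h.tmp, h.ctl, h.out, rfl⟩
      · simp only [cost, eval_add, eval_one, eval_mul, eval_X, eval_ofNat]
        exact Nat.add_le_add_left (Nat.add_le_add_right (Nat.mul_le_mul_right _ (hN y)) _) _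
      · rintro v S ⟨_, b', ⟨rfl, hb⟩, h₃⟩
        have hb' := Bool.eq_iff_iff.2 (hb.trans (eval_eq_true (φ := ex x y φ)).symm)
        rwa [hb'] at h₃

end Fm

/-- Programs that fill in bit arrays. -/
inductive Cmd (V A : Type) : Type
  | assign (a : A) (e : Addr V) (φ : Fm V A) : Cmd V A
  | seq (c d : Cmd V A) : Cmd V A
  | loop (x y : V) (c : Cmd V A) : Cmd V A
  | cond (φ : Fm V A) (c : Cmd V A) : Cmd V A

namespace Cmd

noncomputable def run : Cmd V A → (V → ℕ) → Mem A → Mem A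
  | assign a e φ, env, m => update m a (update (m a) (Addr.val env e) (φ.eval env m))
  | seq c d, env, m => d.run env (c.run env m)
  | loop x y c, env, m => Nat.rec m (fun i m => c.run (update env x i) m) (env y)
  | cond φ c, env, m => bif φ.eval env m then c.run env m else m

def prog : Cmd V A → SProg (Stk V A)
  | assign a e φ => φ.prog.seq ((addAddr e).seq (access a true))
  | seq c d => c.prog.seq d.prog
  | loop x y c => forProg x y c.prog
  | cond φ c => φ.prog.seq (ite (fun v => v.1) c.prog (load id))

noncomputable def cost : Cmd V A → Polynomial ℕ
  | assign _ e φ => φ.cost + (addrCost e + (9 * addrBound e + 8))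
  | seq c d => c.cost + d.cost
  | loop _ _ c => X * (c.cost + 18) + 9
  | cond φ c => φ.cost + (c.cost + 1 + 1)

/-- The variables in `sc` are not bound again. -/
def wf : Cmd V A → List V → Bool
  | assign _ _ φ, sc => φ.wf sc
  | seq c d, sc => c.wf sc && d.wf sc
  | loop x _ c, sc => decide (x ∉ sc) && c.wf (x :: sc)
  | cond φ c, sc => φ.wf sc && c.wf sc

/-- Loop indices stay below another register, so the bound `N` persists inside loops, and each loop
costs a factor `X`. -/
theorem triple_prog {N : ℕ} : ∀ (c : Cmd V A) {sc : List V} {env : V → ℕ},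
    c.wf sc = true → (∀ x, env x ≤ N) → (∀ x ∉ sc, env x = 0) → ∀ (m : Mem A) (C : List Bool)
    (b : Bool), Triple (Rep env m 0 C b) c.prog
      (fun v S => ∃ b', Rep env (c.run env m) 0 C b' v S) (c.cost.eval N)
  | assign a e φ, sc, env, hwf, hN, hsc, m, C, b => by
      have h := (φ.triple_prog m hwf hN hsc C b).seq ((triple_addAddr hN m _ C e 0).seq
        (triple_write env m _ C _ a))
      refine (h.mono ?_).post fun v S h => ⟨φ.eval env m, ?_⟩
      · have := Addr.val_le hN e
        simp only [cost, eval_add, eval_mul, eval_ofNat]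
        omega
      · rw [zero_add] at h
        exact h
  | seq c d, sc, env, hwf, hN, hsc, m, C, b => by
      simp only [wf, Bool.and_eq_true] at hwf
      rw [cost, eval_add]
      refine (triple_prog c hwf.1 hN hsc m C b).seq fun v S ⟨b', h⟩ => ?_
      exact triple_prog d hwf.2 hN hsc _ C b' v S h
  | loop x y c, sc, env, hwf, hN, hsc, m, C, b => by
      simp only [wf, Bool.and_eq_true, decide_eq_true_eq] at hwf
      let G : ℕ → Mem A → Bool → Prop := fun i m' _ =>
        m' = Nat.rec m (fun i m => c.run (update env x i) m) i
      have h := triple_forProg (y := y) (p := c.prog) (T := c.cost.eval N) (hsc x hwf.1) G ?_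
        (m := m) (b := b) rfl C
      · refine (h.mono ?_).post ?_
        · simp only [cost, eval_add, eval_mul, eval_X, eval_ofNat]
          exact Nat.add_le_add_right (Nat.mul_le_mul_right _ (hN y)) _
        · rintro v S ⟨m', b', hG, h⟩
          refine ⟨b', ?_⟩
          rw [hG] at h
          exact h
      · intro i hi C m' b hG
        refine (triple_prog (N := N) c (sc := x :: sc) (env := update env x i) hwf.2 (fun z => ?_)
          (fun z hz => ?_) m' C b).post ?_
        · by_cases hz : z = x
          · subst hz
            simpa using hi.le.trans (hN y)
          · simpa [hz] using hN z
        · rw [List.mem_cons, not_or] at hz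
          simpa [hz.1] using hsc z hz.2
        · rintro v S ⟨b', h⟩
          refine ⟨_, b', ?_, h⟩
          rw [hG]
  | cond φ c, sc, env, hwf, hN, hsc, m, C, b => by
      simp only [wf, Bool.and_eq_true] at hwf
      refine ((φ.triple_prog m hwf.1 hN hsc C b).seq (Triple.ite (T₁ := c.cost.eval N) (T₂ := 1)
        (Q := fun v S => ∃ b', Rep env ((cond φ c).run env m) 0 C b' v S) ?_ ?_)).mono ?_
      · rintro v S ⟨h, h'⟩
        rw [h.flag] at h'
        rw [run, h', cond_true]
        exact triple_prog c hwf.2 hN hsc m C _ v S h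
      · refine triple_load fun v S h => ?_
        obtain ⟨h, h'⟩ := h
        rw [h.flag] at h'
        rw [run, h', cond_false]
        exact ⟨_, h⟩
      · simp only [cost, eval_add, eval_one]; omega

end Cmd

end TablePrograms

/-! ### From programs to Turing machines. -/

section Machines

open Function Polynomial Turing SProg

variable {V A : Type} [DecidableEq V] [DecidableEq A]

/-- Compute the length of an array into a register. -/
def measure (a : A) (x : V) : SProg (Stk V A) :=
  (drain (.arr a) [.tmp] []).seq (drain .tmp [.arr a] [.var x])

/-- The memory that holds the bit string `w` in the array `a`. -/
def inputMem (a : A) (w : List Bool) : Mem A := fun a' i => if a' = a then w.getD i false else false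

/-- The registers all of which are `0` except for `x`, which is `n`. -/
def sizeEnv (x : V) (n : ℕ) : V → ℕ := update (fun _ => 0) x n

/-- The second drain leaves one tick per bit in `x`, the only nonzero register. From here on the
length of the input bounds all registers. -/
theorem triple_measure (a : A) (x : V) (w : List Bool) (v : Ctrl) (S : Stacks (Stk V A))
    (hS : S = fun j => if j = .arr a then w else []) : ∃ v' S',
    Runs (measure a x) v S v' S' (11 * w.length + 4) ∧
      Rep (sizeEnv x w.length) (inputMem a w) 0 [] v.1 v' S' := by
  have h := (runs_drain (k := .arr a) (ks := [.tmp]) (ts := []) (by simp) (by simp) (by simp)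
    (by simp) (by simp) v S).seq (runs_drain (k := .tmp) (ks := [.arr a]) (ts := [.var x]) (by simp)
    (by simp) (by simp) (by simp) (by simp) _ _)
  refine ⟨_, _, Runs.cast h rfl rfl ?_, ?_⟩
  · simp [drained, hS]; omega
  · refine ⟨fun z => ?_, fun a' i => ?_, ?_, ?_, ?_, ?_, rfl⟩
    · by_cases hz : z = x
      · subst hz; simp [drained, hS, sizeEnv]
      · simp [drained, hS, sizeEnv, hz]
    · by_cases ha : a' = a
      · subst ha; simp [drained, hS, inputMem]
      · simp [drained, hS, inputMem, ha]
    all_goals simp [drained, hS]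

/-- The program that measures the input, runs `c`, reads off the answer and cleans up. -/
noncomputable def mainProg [Fintype V] [Fintype A] (x : V) (a b : A) (c : Cmd V A) :
    SProg (Stk V A) :=
  ((measure a x).seq (c.prog.seq (access b false))).seq
    ((clearAll (Finset.univ : Finset (Stk V A)).toList).seq
      ((push .out fun v => v.1).seq (load fun _ => (false, none))))

/-- The first summand is the time until the answer is in the flag. Added to the length of the input
it bounds the height of every stack, and thereby the time for emptying the stacks. -/
noncomputable def mainCost [Fintype V] [Fintype A] (c : Cmd V A) : Polynomial ℕ :=
  (11 * X + 4 + (c.cost + 8)) +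
    ((4 * (X + (11 * X + 4 + (c.cost + 8))) + 2) * (Fintype.card (Stk V A) : Polynomial ℕ) + 3)

/-- A halting configuration with output demands that all other stacks are empty and that the control
state is the initial one, whence the cleaning up. -/
theorem runs_mainProg [Fintype V] [Fintype A] (x : V) (a b : A) (c : Cmd V A)
    (hwf : c.wf [x] = true) (w : List Bool) (v : Ctrl) (S : Stacks (Stk V A))
    (hS : S = fun j => if j = .arr a then w else []) :
    Runs (mainProg x a b c) v S (false, none) (fun j => if j = .out then
      [c.run (sizeEnv x w.length) (inputMem a w) b 0] else []) ((mainCost c).eval w.length) := by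
  obtain ⟨v₁, S₁, h₁, hR₁⟩ := triple_measure a x w v S hS
  obtain ⟨v₂, S₂, h₂, b', hR₂⟩ := c.triple_prog (N := w.length) hwf (fun z => by
    by_cases hz : z = x
    · subst hz; simp [sizeEnv]
    · simp [sizeEnv, hz]) (fun z hz => by
    have hz : z ≠ x := by simpa using hz
    simp [sizeEnv, hz]) _ _ _ v₁ S₁ hR₁
  obtain ⟨v₃, S₃, h₃, hR₃⟩ := triple_read _ _ _ _ _ b v₂ S₂ hR₂
  have h := h₁.seq (h₂.seq h₃)
  have hlen := h.length_le
  obtain ⟨o, h₄⟩ := runs_clearAll (Finset.univ : Finset (Stk V A)).toList v₃ S₃ (m := w.length +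
    (11 * w.length + 4 + (c.cost.eval w.length + (9 * 0 + 8)))) (fun k => (hlen k).trans (by
      refine Nat.add_le_add_right ?_ _
      rw [hS]
      dsimp only
      split_ifs <;> simp))
  refine (h.seq (h₄.seq ((runs_push .out (fun v => v.1) _ _).seq (runs_load _ _ _)))).cast rfl ?_ ?_
  · ext1 j
    by_cases hj : j = .out
    · subst hj
      simp [hR₃.flag]
    · simp [hj]
  · simp only [mainCost, eval_add, eval_mul, eval_X, eval_ofNat, eval_natCast, Finset.length_toList,
      Finset.card_univ, mul_zero, zero_add, Nat.cast_id]
    omega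

/-- The Turing machine that executes a program. -/
noncomputable def machine [Fintype V] [Fintype A] (x : V) (a b : A) (c : Cmd V A) :
    TM2ComputableAux Bool Bool where
  tm :=
    letI := labFintype (mainProg x a b c)
    { K := Stk V A
      k₀ := .arr a
      k₁ := .out
      Γ := fun _ => Bool
      Λ := Lab (mainProg x a b c)
      main := entry (mainProg x a b c)
      σ := Ctrl
      initialState := (false, none)
      Γk₀Fin := inferInstanceAs (Fintype Bool)
      m := code (mainProg x a b c) id .halt }
  inputAlphabet := Equiv.refl Bool
  outputAlphabet := Equiv.refl Bool

theorem machine_answersWithin [Fintype V] [Fintype A] (x : V) (a b : A) (c : Cmd V A)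
    (hwf : c.wf [x] = true) (w : List Bool) :
    AnswersWithin (machine x a b c) w (c.run (sizeEnv x w.length) (inputMem a w) b 0)
      ((mainCost c).eval w.length) := by
  have h := runs_mainProg x a b c hwf w (false, none) (fun j => if j = .arr a then w else []) rfl
  obtain ⟨t, ht, hst⟩ := h.steps_eq _ (code (mainProg x a b c) id .halt) id .halt fun _ => rfl
  refine ⟨⟨⟨t, ?_⟩, ht⟩⟩
  have e₁ : initList (machine x a b c).tm (w.map (machine x a b c).inputAlphabet.symm) =
      (⟨some (entry (mainProg x a b c)), (false, none),
        fun j : Stk V A => if j = .arr a then w else []⟩ :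
        TM2.Cfg (fun _ : Stk V A => Bool) (Lab (mainProg x a b c)) Ctrl) := by
    unfold initList
    refine congrArg (TM2.Cfg.mk (Γ := fun _ : Stk V A => Bool) (Λ := Lab (mainProg x a b c))
      (some (entry (mainProg x a b c))) ((false, none) : Ctrl)) ?_
    funext k
    by_cases hk : k = Stk.arr a
    · subst hk
      refine (dif_pos rfl).trans ?_
      rw [if_pos rfl]
      exact List.map_id w
    · exact (dif_neg hk).trans (if_neg hk).symm
  have e₂ : ∀ l : List Bool, haltList (machine x a b c).tm
      (l.map (machine x a b c).outputAlphabet.symm) =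
      (⟨none, (false, none), fun j : Stk V A => if j = .out then l else []⟩ :
        TM2.Cfg (fun _ : Stk V A => Bool) (Lab (mainProg x a b c)) Ctrl) := by
    intro l
    unfold haltList
    refine congrArg (TM2.Cfg.mk (Γ := fun _ : Stk V A => Bool) (Λ := Lab (mainProg x a b c))
      none ((false, none) : Ctrl)) ?_
    funext k
    by_cases hk : k = Stk.out
    · subst hk
      refine (dif_pos rfl).trans ?_
      rw [if_pos rfl]
      exact List.map_id l
    · exact (dif_neg hk).trans (if_neg hk).symm
  rw [e₁]
  refine hst.trans ?_
  exact congrArg some (e₂ _).symm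

end Machines

/-! ### Fixed points of saturation and the largest block. -/

section Saturation

open Relation Function

variable {ι α σ σ₁ σ₂ : Type*}

/-- A round without change is final; otherwise `card ι + 1` rounds would each add an element. -/
theorem iterate_card_fixed [Fintype ι] (f : Set ι → Set ι) (hf : ∀ S, S ⊆ f S) (S : Set ι) :
    f (f^[Fintype.card ι] S) = f^[Fintype.card ι] S := by
  classical
  by_contra hne
  have key : ∀ s ≤ Fintype.card ι, f (f^[s] S) ≠ f^[s] S := by
    intro s hs heq
    apply hne
    have : ∀ d, f^[s + d] S = f^[s] S := by
      intro d
      induction d with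
      | zero => rfl
      | succ d ih => rw [← add_assoc, iterate_succ_apply', ih, heq]
    obtain ⟨d, hd⟩ := Nat.exists_eq_add_of_le hs
    rw [hd, this, heq]
  have hcard : ∀ s ≤ Fintype.card ι + 1, s ≤ (f^[s] S).ncard := by
    intro s
    induction s with
    | zero => simp
    | succ s ih =>
      intro hs
      have h₁ := ih (by omega)
      have h₂ : (f^[s] S).ncard < (f^[s + 1] S).ncard := by
        rw [iterate_succ_apply']
        exact Set.ncard_lt_ncard ((hf _).ssubset_of_ne (key s (by omega)).symm) (Set.toFinite _)
      omega
  have h₁ := hcard _ le_rfl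
  have h₂ : (f^[Fintype.card ι + 1] S).ncard ≤ Fintype.card ι := by
    rw [← Nat.card_eq_fintype_card, ← Set.ncard_univ]
    exact Set.ncard_le_ncard (Set.subset_univ _) (Set.toFinite _)
  omega

/-- Add the `e`-successors to a set. -/
def expand (e : ι → ι → Prop) (S : Set ι) : Set ι := S ∪ {j | ∃ i ∈ S, e i j}

theorem expand_mono {e : ι → ι → Prop} {S T : Set ι} (h : S ⊆ T) : expand e S ⊆ expand e T := by
  rintro j (hj | ⟨i, hi, hij⟩)
  · exact Or.inl (h hj)
  · exact Or.inr ⟨i, h hi, hij⟩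

/-- Iterates contain only reachable elements, and by `iterate_card_fixed` the last one is closed
under successors. -/
theorem iterate_expand_card [Fintype ι] (e : ι → ι → Prop) (S : Set ι) :
    (expand e)^[Fintype.card ι] S = {j | ∃ i ∈ S, ReflTransGen e i j} := by
  have hsub : ∀ s, S ⊆ (expand e)^[s] S := by
    intro s
    induction s with
    | zero => exact subset_rfl
    | succ s ih =>
      rw [iterate_succ_apply']
      exact ih.trans Set.subset_union_left
  apply Set.Subset.antisymm
  · have : ∀ s, (expand e)^[s] S ⊆ {j | ∃ i ∈ S, ReflTransGen e i j} := by
      intro s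
      induction s with
      | zero => exact fun j hj => ⟨j, hj, .refl⟩
      | succ s ih =>
        rw [iterate_succ_apply']
        rintro j (hj | ⟨i, hi, hij⟩)
        · exact ih hj
        · obtain ⟨i₀, h₀, h⟩ := ih hi
          exact ⟨i₀, h₀, h.tail hij⟩
    exact this _
  · rintro j ⟨i, hi, hij⟩
    induction hij with
    | refl => exact hsub _ hi
    | tail _ hs ih =>
      rw [← iterate_card_fixed (expand e) (fun _ => Set.subset_union_left)]
      exact Or.inr ⟨_, ih, hs⟩

/-- The transitions with a letter in `C`. -/
def StepIn (A : NFA α σ) (C : Set α) (i j : σ) : Prop := ∃ a ∈ C, j ∈ A.step i a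

theorem reflTransGen_stepIn_iff {A : NFA α σ} {C : Set α} {i j : σ} :
    ReflTransGen (StepIn A C) i j ↔ ∃ w : List α, (∀ a ∈ w, a ∈ C) ∧ j ∈ A.evalFrom {i} w := by
  constructor
  · intro h
    induction h with
    | refl => exact ⟨[], by simp, by simp⟩
    | tail _ hs ih =>
      obtain ⟨w, hw, h⟩ := ih
      obtain ⟨a, ha, hs⟩ := hs
      refine ⟨w ++ [a], ?_, mem_evalFrom_append.2 ⟨_, h, by simpa using hs⟩⟩
      intro b hb
      rcases List.mem_append.1 hb with hb | hb
      · exact hw b hb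
      · rwa [List.mem_singleton.1 hb]
  · rintro ⟨w, hw, h⟩
    induction w generalizing i with
    | nil =>
      simp only [NFA.evalFrom_nil, Set.mem_singleton_iff] at h
      rw [h]
    | cons a w ih =>
      obtain ⟨r, hr, h⟩ := mem_evalFrom_cons.1 h
      exact .head ⟨a, hw a (by simp), hr⟩ (ih (fun b hb => hw b (by simp [hb])) h)

/-- The state `r` lies on a loop over `C` that uses the letter `a`. -/
def OnLoop (A : NFA α σ) (C : Set α) (r : σ) (a : α) : Prop :=
  ∃ i j, ReflTransGen (StepIn A C) r i ∧ j ∈ A.step i a ∧ ReflTransGen (StepIn A C) j r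

/-- Remove the letters that lie on no loop at `r₁` or on no loop at `r₂`; `D` is the set of the
letters that have been removed before. -/
def prune (A₁ : NFA α σ₁) (A₂ : NFA α σ₂) (r₁ : σ₁) (r₂ : σ₂) (D : Set α) : Set α :=
  D ∪ {a | ¬ (OnLoop A₁ Dᶜ r₁ a ∧ OnLoop A₂ Dᶜ r₂ a)}

/-- For each letter of `C`, a loop at `r` that uses it is appended. -/
theorem exists_full_loop {A : NFA α σ} {C : Finset α} {r : σ} (h : ∀ a ∈ C, OnLoop A C r a) :
    ∃ v : List α, (∀ a, a ∈ v ↔ a ∈ C) ∧ r ∈ A.evalFrom {r} v := by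
  classical
  have key : ∀ B ⊆ C, ∃ v : List α, (∀ a ∈ v, a ∈ C) ∧ (∀ a ∈ B, a ∈ v) ∧
      r ∈ A.evalFrom {r} v := by
    intro B
    induction B using Finset.induction_on with
    | empty => exact fun _ => ⟨[], by simp, by simp, by simp⟩
    | insert a B _ ih =>
      intro hB
      obtain ⟨v, h₁, h₂, h₃⟩ := ih fun b hb => hB (Finset.mem_insert_of_mem hb)
      have haC := hB (Finset.mem_insert_self a B)
      obtain ⟨i, j, hi, hij, hj⟩ := h a haC
      obtain ⟨x, hx, hrx⟩ := reflTransGen_stepIn_iff.1 hi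
      obtain ⟨y, hy, hry⟩ := reflTransGen_stepIn_iff.1 hj
      refine ⟨v ++ (x ++ a :: y), ?_, ?_, mem_evalFrom_append.2 ⟨r, h₃, mem_evalFrom_append.2
        ⟨i, hrx, mem_evalFrom_cons.2 ⟨j, hij, hry⟩⟩⟩⟩
      · intro b hb
        simp only [List.mem_append, List.mem_cons] at hb
        rcases hb with hb | hb | rfl | hb
        · exact h₁ b hb
        · exact hx b hb
        · exact haC
        · exact hy b hb
      · intro b hb
        rcases Finset.mem_insert.1 hb with rfl | hb
        · simp
        · simp [h₂ b hb]
  obtain ⟨v, h₁, h₂, h₃⟩ := key C subset_rfl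
  exact ⟨v, fun a => ⟨h₁ a, h₂ a⟩, h₃⟩

theorem BlockRun.reflTransGen {A : NFA α σ} {B : Finset α} {C : Set α} {p r q : σ}
    (h : BlockRun A B p r q) (hB : ∀ a ∈ B, a ∈ C) :
    ReflTransGen (StepIn A C) p r ∧ ReflTransGen (StepIn A C) r q := by
  obtain ⟨x, v, z, hx, -, hz, h₁, -, h₃⟩ := h
  exact ⟨reflTransGen_stepIn_iff.2 ⟨x, fun a ha => hB a (hx a ha), h₁⟩,
    reflTransGen_stepIn_iff.2 ⟨z, fun a ha => hB a (hz a ha), h₃⟩⟩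

/-- The full loop at `r` is split at an occurrence of `a`. -/
theorem BlockRun.onLoop {A : NFA α σ} {B : Finset α} {C : Set α} {p r q : σ}
    (h : BlockRun A B p r q) (hB : ∀ a ∈ B, a ∈ C) {a : α} (ha : a ∈ B) : OnLoop A C r a := by
  obtain ⟨-, v, -, -, hv, -, -, h, -⟩ := h
  obtain ⟨s, t, rfl⟩ := List.append_of_mem ((hv a).2 ha)
  obtain ⟨i, hi, h⟩ := mem_evalFrom_append.1 h
  obtain ⟨j, hij, hj⟩ := mem_evalFrom_cons.1 h
  exact ⟨i, j, reflTransGen_stepIn_iff.2 ⟨s, fun b hb => hB b ((hv b).1 (by simp [hb])), hi⟩, hij,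
    reflTransGen_stepIn_iff.2 ⟨t, fun b hb => hB b ((hv b).1 (by simp [hb])), hj⟩⟩

theorem blockRun_toFinset {A : NFA α σ} {C : Set α} [Fintype C] {p r q : σ}
    (h : ReflTransGen (StepIn A C) p r) (h' : ReflTransGen (StepIn A C) r q)
    (hl : ∀ a ∈ C, OnLoop A C r a) : BlockRun A C.toFinset p r q := by
  obtain ⟨x, hx, h₁⟩ := reflTransGen_stepIn_iff.1 h
  obtain ⟨z, hz, h₂⟩ := reflTransGen_stepIn_iff.1 h'
  obtain ⟨v, hv, h₃⟩ := exists_full_loop (A := A) (C := C.toFinset) (r := r) fun a ha => by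
    rw [Set.coe_toFinset]
    exact hl a (Set.mem_toFinset.1 ha)
  exact ⟨x, v, z, fun a ha => Set.mem_toFinset.2 (hx a ha), hv,
    fun a ha => Set.mem_toFinset.2 (hz a ha), h₁, h₃, h₂⟩

/-- The letters that remain after pruning form the largest block for the states `r₁`, `r₂`. -/
theorem exists_blockRun_iff [Fintype α] {A₁ : NFA α σ₁} {A₂ : NFA α σ₂} {p q r : σ₁ × σ₂} {C : Set α}
    (hC : C = ((prune A₁ A₂ r.1 r.2)^[Fintype.card α] ∅)ᶜ) :
    (∃ B, BlockRun A₁ B p.1 r.1 q.1 ∧ BlockRun A₂ B p.2 r.2 q.2) ↔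
      (ReflTransGen (StepIn A₁ C) p.1 r.1 ∧ ReflTransGen (StepIn A₁ C) r.1 q.1) ∧
        ReflTransGen (StepIn A₂ C) p.2 r.2 ∧ ReflTransGen (StepIn A₂ C) r.2 q.2 := by
  classical
  -- After as many rounds as there are letters pruning is stable, so each remaining letter lies on
  -- loops over the remaining letters.
  have hfix := iterate_card_fixed (prune A₁ A₂ r.1 r.2) (fun _ => Set.subset_union_left) ∅
  rw [← compl_compl ((prune A₁ A₂ r.1 r.2)^[Fintype.card α] ∅), ← hC] at hfix
  constructor
  · rintro ⟨B, h₁, h₂⟩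
    -- A block through `r` never loses a letter: its own loops survive as long as all its letters
    -- do.
    have hB : ∀ s, ∀ a ∈ B, a ∈ ((prune A₁ A₂ r.1 r.2)^[s] ∅)ᶜ := by
      intro s
      induction s with
      | zero => simp
      | succ s ih =>
        intro a ha
        rw [iterate_succ_apply']
        rintro (h | h)
        · exact ih a ha h
        · exact h ⟨h₁.onLoop ih ha, h₂.onLoop ih ha⟩
    have hB' := hB (Fintype.card α)
    rw [← hC] at hB'
    exact ⟨h₁.reflTransGen hB', h₂.reflTransGen hB'⟩
  · rintro ⟨⟨h₁, h₁'⟩, h₂, h₂'⟩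
    have hloop : ∀ a ∈ C, OnLoop A₁ C r.1 a ∧ OnLoop A₂ C r.2 a := by
      intro a ha
      by_contra hcon
      have : a ∈ prune A₁ A₂ r.1 r.2 Cᶜ := Or.inr (by rwa [compl_compl])
      rw [hfix] at this
      exact this ha
    exact ⟨C.toFinset, blockRun_toFinset h₁ h₁' fun a ha => (hloop a ha).1,
      blockRun_toFinset h₂ h₂' fun a ha => (hloop a ha).2⟩

end Saturation

/-! ### Filling arrays and reachability as array programs. -/

section Fill

open Function Relation

variable {V A : Type} [DecidableEq V] [DecidableEq A]

namespace Fm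

/-- A formula that never holds. -/
def fls (a : A) : Fm V A := and (bit a []) (not (bit a []))

def or (φ ψ : Fm V A) : Fm V A := not (and (not φ) (not ψ))

omit [DecidableEq A] in
theorem holds_fls {a : A} {env : V → ℕ} {m : Mem A} : (fls a).Holds env m ↔ False := by
  simp [fls, Holds]

omit [DecidableEq A] in
theorem holds_or {φ ψ : Fm V A} {env : V → ℕ} {m : Mem A} :
    (φ.or ψ).Holds env m ↔ φ.Holds env m ∨ ψ.Holds env m := by
  simp only [or, Holds]
  tauto

end Fm

namespace Cmd

/-- An invariant of a loop holds at its end. -/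
theorem run_loop_induction {x y : V} {c : Cmd V A} {env : V → ℕ} {m : Mem A}
    (P : ℕ → Mem A → Prop) (h0 : P 0 m)
    (hs : ∀ i < env y, ∀ m, P i m → P (i + 1) (c.run (update env x i) m)) :
    P (env y) ((loop x y c).run env m) := by
  have : ∀ n ≤ env y, P n (Nat.rec m (fun i m => c.run (update env x i) m) n) := by
    intro n
    induction n with
    | zero => exact fun _ => h0
    | succ n ih => exact fun hn => hs n (by omega) _ (ih (by omega))
  exact this _ le_rfl

/-- Setting the entries of an array one after the other. -/
theorem run_fill {x n : V} {a : A} {e : Addr V} {φ : Fm V A} {env : V → ℕ} {m : Mem A} {c : ℕ}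
    {P : ℕ → Prop} (he : ∀ j < env n, Addr.val (update env x j) e = c + j)
    (hφ : ∀ j < env n, ∀ m', (∀ b ≠ a, m' b = m b) → (φ.Holds (update env x j) m' ↔ P j)) :
    (∀ b ≠ a, (loop x n (assign a e φ)).run env m b = m b) ∧
      (∀ j < env n, (loop x n (assign a e φ)).run env m a (c + j) = true ↔ P j) ∧
      ∀ i, (i < c ∨ c + env n ≤ i) → (loop x n (assign a e φ)).run env m a i = m a i := by
  refine run_loop_induction (fun s m' => (∀ b ≠ a, m' b = m b) ∧
    (∀ j < s, m' a (c + j) = true ↔ P j) ∧ ∀ i, (i < c ∨ c + s ≤ i) → m' a i = m a i)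
    ⟨by simp, by simp, by simp⟩ ?_
  rintro s hs m' ⟨h₁, h₂, h₃⟩
  refine ⟨fun b hb => ?_, fun j hj => ?_, fun i hi => ?_⟩
  · rw [run, update_of_ne hb, h₁ b hb]
  · rw [run, update_self, he s hs]
    by_cases hjs : j = s
    · subst hjs
      rw [update_self, Fm.eval_eq_true]
      exact hφ j hs m' h₁
    · rw [update_of_ne (by omega)]
      exact h₂ j (by omega)
  · rw [run, update_self, he s hs, update_of_ne (by omega)]
    exact h₃ i (by omega)

/-- Entries are stored row by row, so filling row `s` touches no address below `s * env n'` and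
spares the finished rows. -/
theorem run_fill₂ {x y n n' : V} {a : A} {φ : Fm V A} {env : V → ℕ} {m : Mem A}
    {P : ℕ → ℕ → Prop} (hxy : x ≠ y) (hx : n' ≠ x) (hy : n' ≠ y)
    (hφ : ∀ i < env n, ∀ j < env n', ∀ m', (∀ b ≠ a, m' b = m b) →
      (φ.Holds (update (update env x i) y j) m' ↔ P i j)) :
    (∀ b ≠ a, (loop x n (loop y n' (assign a [[x, n'], [y]] φ))).run env m b = m b) ∧
      ∀ i < env n, ∀ j < env n',
        (loop x n (loop y n' (assign a [[x, n'], [y]] φ))).run env m a (i * env n' + j) = true ↔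
          P i j := by
  refine run_loop_induction (fun s m' => (∀ b ≠ a, m' b = m b) ∧
    ∀ i < s, ∀ j < env n', m' a (i * env n' + j) = true ↔ P i j) ⟨by simp, by simp⟩ ?_
  rintro s hs m' ⟨h₁, h₂⟩
  obtain ⟨h₃, h₄, h₅⟩ := run_fill (x := y) (n := n') (a := a) (e := [[x, n'], [y]]) (φ := φ)
    (env := update env x s) (m := m') (c := s * env n') (P := fun j => P s j)
    (by
      intro j _
      simp [Addr.val, hxy, hx, hy])
    (by
      intro j hj m'' hm''
      rw [update_of_ne hx] at hj
      exact hφ s hs j hj m'' fun b hb => (hm'' b hb).trans (h₁ b hb))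
  rw [update_of_ne hx] at h₄ h₅
  refine ⟨fun b hb => (h₃ b hb).trans (h₁ b hb), fun i hi j hj => ?_⟩
  by_cases his : i = s
  · subst his
    exact h₄ j hj
  · rw [h₅ _ (Or.inl ?_)]
    · exact h₂ i (by omega) j hj
    · calc i * env n' + j < i * env n' + env n' := by omega
        _ = (i + 1) * env n' := by rw [Nat.succ_mul]
        _ ≤ s * env n' := Nat.mul_le_mul_right _ (by omega)

/-- Replace the array `F` by the values of `φ`, by way of the array `T`. -/
def replace (x n : V) (F T : A) (φ : Fm V A) : Cmd V A :=
  seq (loop x n (assign T [[x]] φ)) (loop x n (assign F [[x]] (.bit T [[x]])))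

def replace₂ (x y n n' : V) (F T : A) (φ : Fm V A) : Cmd V A :=
  seq (loop x n (loop y n' (assign T [[x, n'], [y]] φ)))
    (loop x n (loop y n' (assign F [[x, n'], [y]] (.bit T [[x, n'], [y]]))))

/-- `φ` may read `F`, so its values are first collected in `T` while `F` is unchanged. Accordingly
`φ` has to tolerate changes of `T` only. -/
theorem run_replace {x n : V} {F T : A} {φ : Fm V A} {env : V → ℕ} {m : Mem A} {P : ℕ → Prop}
    (hFT : F ≠ T)
    (hφ : ∀ j < env n, ∀ m', (∀ b ≠ T, m' b = m b) → (φ.Holds (update env x j) m' ↔ P j)) :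
    (∀ b, b ≠ F → b ≠ T → (replace x n F T φ).run env m b = m b) ∧
      ∀ j < env n, (replace x n F T φ).run env m F j = true ↔ P j := by
  obtain ⟨h₁, h₂, -⟩ := run_fill (x := x) (n := n) (a := T) (e := [[x]]) (φ := φ) (env := env)
    (m := m) (c := 0) (by intro j _; simp [Addr.val]) hφ
  obtain ⟨h₃, h₄, -⟩ := run_fill (x := x) (n := n) (a := F) (e := [[x]]) (φ := .bit T [[x]])
    (env := env) (m := (loop x n (assign T [[x]] φ)).run env m) (c := 0) (P := P)
    (by intro j _; simp [Addr.val]) (by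
      intro j hj m' hm'
      rw [Fm.Holds, hm' T hFT.symm, ← h₂ j hj]
      simp [Addr.val])
  simp only [zero_add] at h₄
  exact ⟨fun b hb hb' => (h₃ b hb).trans (h₁ b hb'), h₄⟩

theorem run_replace₂ {x y n n' : V} {F T : A} {φ : Fm V A} {env : V → ℕ} {m : Mem A}
    {P : ℕ → ℕ → Prop} (hFT : F ≠ T) (hxy : x ≠ y) (hx : n' ≠ x) (hy : n' ≠ y)
    (hφ : ∀ i < env n, ∀ j < env n', ∀ m', (∀ b ≠ T, m' b = m b) →
      (φ.Holds (update (update env x i) y j) m' ↔ P i j)) :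
    (∀ b, b ≠ F → b ≠ T → (replace₂ x y n n' F T φ).run env m b = m b) ∧
      ∀ i < env n, ∀ j < env n', (replace₂ x y n n' F T φ).run env m F (i * env n' + j) = true ↔
        P i j := by
  obtain ⟨h₁, h₂⟩ := run_fill₂ hxy hx hy hφ
  obtain ⟨h₃, h₄⟩ := run_fill₂ (n := n) (a := F) (φ := .bit T [[x, n'], [y]]) (env := env)
    (m := (loop x n (loop y n' (assign T [[x, n'], [y]] φ))).run env m) (P := P) hxy hx hy (by
      intro i hi j hj m' hm'
      rw [Fm.Holds, hm' T hFT.symm, ← h₂ i hi j hj]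
      simp [Addr.val, hxy, hx, hy])
  exact ⟨fun b hb hb' => (h₃ b hb).trans (h₁ b hb'), h₄⟩

/-- Compute into `F` the states that are reachable from `r` by the edges `E` from `y` to `x`. -/
def reach (n t x y r : V) (E : Fm V A) (F T : A) : Cmd V A :=
  seq (loop x n (assign F [[x]] (.fls F))) (seq (assign F [[r]] (.not (.fls F)))
    (loop t n (replace x n F T (.or (.bit F [[x]]) (.ex y n (.and (.bit F [[y]]) E))))))

/-- After `s` rounds, `F` holds the `s`-fold expansion of the start state, and `N` rounds exhaust
the reachable states. Edges are tested in the midst of the search, so `hE` allows for changed `t`,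
`x`, `y`, `F` and `T`. -/
theorem run_reach {n t x y r : V} {E : Fm V A} {F T : A} {env : V → ℕ} {m : Mem A} {N : ℕ}
    {e : Fin N → Fin N → Prop} {i₀ : Fin N} (hN : env n = N) (hr : env r = i₀) (hFT : F ≠ T)
    (hd : [n, t, x, y].Nodup) (hE : ∀ (env' : V → ℕ) (m' : Mem A),
      (∀ z, z ≠ t → z ≠ x → z ≠ y → env' z = env z) → (∀ b, b ≠ F → b ≠ T → m' b = m b) →
      ∀ i j : Fin N, env' y = i → env' x = j → (E.Holds env' m' ↔ e i j)) :
    (∀ b, b ≠ F → b ≠ T → (reach n t x y r E F T).run env m b = m b) ∧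
      ∀ j : Fin N, (reach n t x y r E F T).run env m F j = true ↔ ReflTransGen e i₀ j := by
  simp only [List.nodup_cons, List.mem_cons, not_or, List.not_mem_nil, not_false_eq_true,
    and_true] at hd
  obtain ⟨⟨hnt, hnx, hny⟩, ⟨htx, hty⟩, hxy, -⟩ := hd
  obtain ⟨h₁, h₂, -⟩ := run_fill (x := x) (n := n) (a := F) (e := [[x]]) (φ := .fls F) (env := env)
    (m := m) (c := 0) (P := fun _ => False) (by intro j _; simp [Addr.val])
    (fun j _ m' _ => Fm.holds_fls)
  have key := run_loop_induction (x := t) (y := n) (env := env)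
    (c := replace x n F T (.or (.bit F [[x]]) (.ex y n (.and (.bit F [[y]]) E))))
    (m := (assign F [[r]] (.not (.fls F))).run env ((loop x n (assign F [[x]] (.fls F))).run env m))
    (fun s m' => (∀ b, b ≠ F → b ≠ T → m' b = m b) ∧
      ∀ j : Fin N, m' F j = true ↔ j ∈ (expand e)^[s] {i₀}) ?_ ?_
  · refine ⟨key.1, fun j => (key.2 j).trans ?_⟩
    have := iterate_expand_card e {i₀}
    rw [Fintype.card_fin] at this
    rw [hN, this]
    simp
  · refine ⟨fun b hb hb' => ?_, fun j => ?_⟩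
    · rw [run, update_of_ne hb, h₁ b hb]
    · have hj := h₂ j (by rw [hN]; exact j.2)
      rw [zero_add] at hj
      rw [run, update_self]
      simp only [Addr.val, List.map_cons, List.map_nil, List.prod_cons, List.prod_nil, mul_one,
        List.sum_cons, List.sum_nil, add_zero, hr, iterate_zero, id_eq, Set.mem_singleton_iff]
      by_cases hji : j = i₀
      · subst hji
        rw [update_self, Fm.eval_eq_true, Fm.Holds, Fm.holds_fls]
        simp
      · rw [update_of_ne (fun h => hji (Fin.ext h)), hj]
        simp [hji]
  · rintro s - m' ⟨hm₁, hm₂⟩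
    obtain ⟨h₃, h₄⟩ := run_replace (x := x) (n := n) (F := F) (T := T)
      (φ := .or (.bit F [[x]]) (.ex y n (.and (.bit F [[y]]) E))) (env := update env t s) (m := m')
      (P := fun j => ∃ hj : j < N, (⟨j, hj⟩ : Fin N) ∈ (expand e)^[s + 1] {i₀}) hFT (by
        intro j hj m'' hm''
        rw [update_of_ne hnt, hN] at hj
        rw [Fm.holds_or, iterate_succ_apply']
        simp only [Fm.Holds, Addr.val, List.map_cons, List.map_nil, List.prod_cons, List.prod_nil,
          mul_one, List.sum_cons, List.sum_nil, add_zero, update_self, update_of_ne hnx,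
          update_of_ne hnt, hm'' F hFT, hj, exists_true_left, hN]
        refine or_congr (hm₂ ⟨j, hj⟩) ⟨?_, ?_⟩
        · rintro ⟨i, hi, hFi, hEi⟩
          refine ⟨⟨i, hi⟩, (hm₂ ⟨i, hi⟩).1 hFi, (hE _ m'' ?_ ?_ ⟨i, hi⟩ ⟨j, hj⟩ ?_ ?_).1 hEi⟩
          · intro z hz₁ hz₂ hz₃
            rw [update_of_ne hz₃, update_of_ne hz₂, update_of_ne hz₁]
          · intro b hb hb'
            rw [hm'' b hb', hm₁ b hb hb']
          · simp
          · simp [hxy]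
        · rintro ⟨i, hi, hij⟩
          refine ⟨i, i.2, (hm₂ i).2 hi, (hE _ m'' ?_ ?_ i ⟨j, hj⟩ ?_ ?_).2 hij⟩
          · intro z hz₁ hz₂ hz₃
            rw [update_of_ne hz₃, update_of_ne hz₂, update_of_ne hz₁]
          · intro b hb hb'
            rw [hm'' b hb', hm₁ b hb hb']
          · simp
          · simp [hxy])
    refine ⟨fun b hb hb' => (h₃ b hb hb').trans (hm₁ b hb hb'), fun j => ?_⟩
    rw [h₄ j (by rw [update_of_ne hnt, hN]; exact j.2)]
    simp

end Cmd

end Fill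

/-! ### The separability program; pruning and closures. -/

section Algorithm

set_option linter.constructorNameAsVariable false

open Function Relation

/-- The registers of the separability program. -/
inductive Reg : Type
  | size | k | n₁ | n₂ | t₁ | t₂ | r₁ | r₂ | u | t | x | y | a | p | q | z
  deriving DecidableEq

/-- The arrays of the separability program. -/
inductive Arr : Type
  | inp | out | pairs | del | fwd₁ | bwd₁ | fwd₂ | bwd₂ | tmp
  deriving DecidableEq

instance : Fintype Reg where
  elems := {.size, .k, .n₁, .n₂, .t₁, .t₂, .r₁, .r₂, .u, .t, .x, .y, .a, .p, .q, .z}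
  complete i := by cases i <;> decide

instance : Fintype Arr where
  elems := {.inp, .out, .pairs, .del, .fwd₁, .bwd₁, .fwd₂, .bwd₂, .tmp}
  complete i := by cases i <;> decide

open Reg Arr

/-- The address of the table of the first automaton. -/
def table₁ : Addr Reg := [[k], [n₁], [n₂], [], [], []]

/-- The address of the table of the second automaton. -/
def table₂ : Addr Reg := table₁ ++ [[n₁], [n₁], [n₁, k, n₁]]

def startFm (o : Addr Reg) (q : Reg) : Fm Reg Arr := .bit inp (o ++ [[q]])

def acceptFm (o : Addr Reg) (n q : Reg) : Fm Reg Arr := .bit inp (o ++ [[n], [q]])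

def stepFm (o : Addr Reg) (n p a q : Reg) : Fm Reg Arr :=
  .bit inp (o ++ [[n], [n], [p, k, n], [a, n], [q]])

/-- From `y` to `x` there is a transition with a letter that has not been removed. -/
def fwdFm (o : Addr Reg) (n : Reg) : Fm Reg Arr :=
  .ex a k (.and (.not (.bit del [[a]])) (stepFm o n y a x))

/-- From `x` to `y` there is a transition with a letter that has not been removed. -/
def bwdFm (o : Addr Reg) (n : Reg) : Fm Reg Arr :=
  .ex a k (.and (.not (.bit del [[a]])) (stepFm o n x a y))

/-- Compute the states that are reachable from, or that reach, the states `r₁` and `r₂` without the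
removed letters. -/
def closures : Cmd Reg Arr :=
  .seq (.reach n₁ t x y r₁ (fwdFm table₁ n₁) fwd₁ tmp)
    (.seq (.reach n₁ t x y r₁ (bwdFm table₁ n₁) bwd₁ tmp)
      (.seq (.reach n₂ t x y r₂ (fwdFm table₂ n₂) fwd₂ tmp)
        (.reach n₂ t x y r₂ (bwdFm table₂ n₂) bwd₂ tmp)))

/-- The letter `a` lies on a loop. -/
def loopFm (o : Addr Reg) (n : Reg) (fwd bwd : Arr) : Fm Reg Arr :=
  .ex x n (.ex y n (.and (.bit fwd [[x]]) (.and (stepFm o n x a y) (.bit bwd [[y]]))))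

/-- Remove the letters that lie on no loop at `r₁` or on no loop at `r₂`. -/
def pruneCmd : Cmd Reg Arr :=
  .seq closures (.replace a k del tmp (.or (.bit del [[a]])
    (.not (.and (loopFm table₁ n₁ fwd₁ bwd₁) (loopFm table₂ n₂ fwd₂ bwd₂)))))

/-- Find the largest block for `r₁` and `r₂`. -/
def blockCmd : Cmd Reg Arr :=
  .seq (.loop a k (.assign del [[a]] (.fls del))) (.seq (.loop u k pruneCmd) closures)

/-- One expansion along letter edges, with source `(p, q)` and target `(x, y)`. -/
def letterFm : Fm Reg Arr :=
  .or (.bit pairs [[x, n₂], [y]]) (.ex p n₁ (.ex q n₂ (.and (.bit pairs [[p, n₂], [q]])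
    (.ex a k (.and (stepFm table₁ n₁ p a x) (stepFm table₂ n₂ q a y))))))

/-- By `exists_blockRun_iff`, a block edge through the current loop states splits into separate
conditions on the source `(p, q)` and the target `(x, y)`, which the closure arrays answer. -/
def blockFm : Fm Reg Arr :=
  .or (.bit pairs [[x, n₂], [y]]) (.and (.bit fwd₁ [[x]]) (.and (.bit fwd₂ [[y]])
    (.ex p n₁ (.ex q n₂ (.and (.bit pairs [[p, n₂], [q]])
      (.and (.bit bwd₁ [[p]]) (.bit bwd₂ [[q]])))))))

/-- Follow all edges of the graph of pairs. -/
def passCmd : Cmd Reg Arr :=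
  .seq (.replace₂ x y n₁ n₂ pairs tmp letterFm)
    (.loop r₁ n₁ (.loop r₂ n₂ (.seq blockCmd (.replace₂ x y n₁ n₂ pairs tmp blockFm))))

/-- Decide separability when the sizes are known. -/
def coreCmd : Cmd Reg Arr :=
  .seq (.loop x n₁ (.loop y n₂ (.assign pairs [[x, n₂], [y]]
      (.and (startFm table₁ x) (startFm table₂ y)))))
    (.seq (.loop t₁ n₁ (.loop t₂ n₂ passCmd))
      (.assign out [] (.not (.ex x n₁ (.ex y n₂ (.and (.bit pairs [[x, n₂], [y]])
        (.and (acceptFm table₁ n₁ x) (acceptFm table₂ n₂ y))))))))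

/-- The array `bits` contains a number in unary at the address `o`, followed by an end mark. -/
def unaryFm (o : Addr Reg) (n : Reg) : Fm Reg Arr :=
  .and (.not (.ex z n (.not (.bit inp (o ++ [[z]]))))) (.not (.bit inp (o ++ [[n]])))

def headerFm : Fm Reg Arr :=
  .and (unaryFm [] k) (.and (unaryFm [[k], []] n₁) (unaryFm [[k], [], [n₁], []] n₂))

/-- Decide separability. -/
def separabilityCmd : Cmd Reg Arr :=
  .loop k size (.loop n₁ size (.loop n₂ size (.cond headerFm coreCmd)))

theorem wf_separabilityCmd : separabilityCmd.wf [size] = true := by decide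

variable {κ N N₁ N₂ : ℕ}

/-- The table of an automaton, at the position `o` of a bit string. -/
structure IsTable (bits : ℕ → Bool) (o : ℕ) (A : NFA (Fin κ) (Fin N)) : Prop where
  start : ∀ q : Fin N, bits (o + q) = true ↔ q ∈ A.start
  accept : ∀ q : Fin N, bits (o + (N + q)) = true ↔ q ∈ A.accept
  step : ∀ (p : Fin N) (a : Fin κ) (q : Fin N),
    bits (o + (N + (N + (p * (κ * N) + (a * N + q))))) = true ↔ q ∈ A.step p a

theorem addr_val_append (env : Reg → ℕ) (o e : Addr Reg) :
    Addr.val env (o ++ e) = Addr.val env o + Addr.val env e := by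
  simp [Addr.val]

section Table

variable {A : NFA (Fin κ) (Fin N)} {o : Addr Reg} {n : Reg} {env : Reg → ℕ} {m : Mem Arr}

theorem holds_startFm {q : Reg} {j : Fin N} (h : IsTable (m inp) (Addr.val env o) A)
    (hq : env q = j) : (startFm o q).Holds env m ↔ j ∈ A.start := by
  rw [← h.start, startFm, Fm.Holds, addr_val_append]
  simp [Addr.val, hq]

theorem holds_acceptFm {q : Reg} {j : Fin N} (h : IsTable (m inp) (Addr.val env o) A)
    (hn : env n = N) (hq : env q = j) : (acceptFm o n q).Holds env m ↔ j ∈ A.accept := by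
  rw [← h.accept, acceptFm, Fm.Holds, addr_val_append]
  simp [Addr.val, hq, hn]

theorem holds_stepFm {p a q : Reg} {i j : Fin N} {c : Fin κ}
    (h : IsTable (m inp) (Addr.val env o) A) (hk : env k = κ) (hn : env n = N) (hp : env p = i)
    (ha : env a = c) (hq : env q = j) : (stepFm o n p a q).Holds env m ↔ j ∈ A.step i c := by
  rw [← h.step, stepFm, Fm.Holds, addr_val_append]
  simp [Addr.val, hp, ha, hq, hn, hk]

/-- An address does not depend on the registers other than the sizes. -/
def SizeAddr (o : Addr Reg) : Prop :=
  ∀ env env' : Reg → ℕ, env' k = env k → env' n₁ = env n₁ → env' n₂ = env n₂ →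
    Addr.val env' o = Addr.val env o

theorem sizeAddr_table₁ : SizeAddr table₁ := fun env env' h h₁ h₂ => by
  simp [table₁, Addr.val, h, h₁, h₂]

theorem sizeAddr_table₂ : SizeAddr table₂ := fun env env' h h₁ h₂ => by
  simp [table₂, table₁, Addr.val, h, h₁, h₂]

/-- The array represents a set. -/
def Represents (bits : ℕ → Bool) (S : Set (Fin N)) : Prop := ∀ i : Fin N, bits i = true ↔ i ∈ S

theorem holds_fwdFm {D : Set (Fin κ)} {i j : Fin N} (ho : SizeAddr o)
    (h : IsTable (m inp) (Addr.val env o) A) (hk : env k = κ) (hn : env n = N) (hna : n ≠ a)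
    (hD : Represents (m del) D) (hy : env y = i) (hx : env x = j) :
    (fwdFm o n).Holds env m ↔ StepIn A Dᶜ i j := by
  have hstep : ∀ c : Fin κ, (stepFm o n y a x).Holds (update env a c) m ↔ j ∈ A.step i c := by
    intro c
    refine holds_stepFm ?_ (by simp [hk]) (by rw [update_of_ne hna, hn]) (by simp [hy]) (by simp)
      (by simp [hx])
    rwa [ho env _ (by simp) (by simp) (by simp)]
  simp only [fwdFm, Fm.Holds, hk, StepIn]
  constructor
  · rintro ⟨c, hc, h₁, h₂⟩
    refine ⟨⟨c, hc⟩, fun hcD => h₁ ?_, (hstep ⟨c, hc⟩).1 h₂⟩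
    simpa [Addr.val] using (hD ⟨c, hc⟩).2 hcD
  · rintro ⟨c, hc, h₂⟩
    refine ⟨c, c.2, fun h₁ => hc ((hD c).1 ?_), (hstep c).2 h₂⟩
    simpa [Addr.val] using h₁

theorem holds_bwdFm {D : Set (Fin κ)} {i j : Fin N} (ho : SizeAddr o)
    (h : IsTable (m inp) (Addr.val env o) A) (hk : env k = κ) (hn : env n = N) (hna : n ≠ a)
    (hD : Represents (m del) D) (hy : env y = i) (hx : env x = j) :
    (bwdFm o n).Holds env m ↔ StepIn A Dᶜ j i := by
  have hstep : ∀ c : Fin κ, (stepFm o n x a y).Holds (update env a c) m ↔ i ∈ A.step j c := by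
    intro c
    refine holds_stepFm ?_ (by simp [hk]) (by rw [update_of_ne hna, hn]) (by simp [hx]) (by simp)
      (by simp [hy])
    rwa [ho env _ (by simp) (by simp) (by simp)]
  simp only [bwdFm, Fm.Holds, hk, StepIn]
  constructor
  · rintro ⟨c, hc, h₁, h₂⟩
    refine ⟨⟨c, hc⟩, fun hcD => h₁ ?_, (hstep ⟨c, hc⟩).1 h₂⟩
    simpa [Addr.val] using (hD ⟨c, hc⟩).2 hcD
  · rintro ⟨c, hc, h₂⟩
    refine ⟨c, c.2, fun h₁ => hc ((hD c).1 ?_), (hstep c).2 h₂⟩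
    simpa [Addr.val] using h₁

theorem holds_loopFm {D : Set (Fin κ)} {r : Fin N} {c : Fin κ} {fwd bwd : Arr} (ho : SizeAddr o)
    (h : IsTable (m inp) (Addr.val env o) A) (hk : env k = κ) (hn : env n = N) (hnx : n ≠ x)
    (hny : n ≠ y) (hf : ∀ j : Fin N, m fwd j = true ↔ ReflTransGen (StepIn A Dᶜ) r j)
    (hb : ∀ j : Fin N, m bwd j = true ↔ ReflTransGen (StepIn A Dᶜ) j r) (ha : env a = c) :
    (loopFm o n fwd bwd).Holds env m ↔ OnLoop A Dᶜ r c := by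
  have hstep : ∀ i j : Fin N, (stepFm o n x a y).Holds (update (update env x i) y j) m ↔
      j ∈ A.step i c := by
    intro i j
    refine holds_stepFm ?_ (by simp [hk]) (by rw [update_of_ne hny, update_of_ne hnx, hn]) (by simp)
      (by simp [ha]) (by simp)
    rwa [ho env _ (by simp) (by simp) (by simp)]
  simp only [loopFm, Fm.Holds, hn, OnLoop, update_of_ne hnx]
  constructor
  · rintro ⟨i, hi, j, hj, h₁, h₂, h₃⟩
    refine ⟨⟨i, hi⟩, ⟨j, hj⟩, (hf ⟨i, hi⟩).1 ?_, (hstep ⟨i, hi⟩ ⟨j, hj⟩).1 h₂, (hb ⟨j, hj⟩).1 ?_⟩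
    · simpa [Addr.val] using h₁
    · simpa [Addr.val] using h₃
  · rintro ⟨i, j, h₁, h₂, h₃⟩
    refine ⟨i, i.2, j, j.2, ?_, (hstep i j).2 h₂, ?_⟩
    · simpa [Addr.val] using (hf i).2 h₁
    · simpa [Addr.val] using (hb j).2 h₃

end Table

/-- The size registers hold the sizes. -/
structure Sized (κ N₁ N₂ : ℕ) (env : Reg → ℕ) : Prop where
  k : env k = κ
  n₁ : env n₁ = N₁
  n₂ : env n₂ = N₂

theorem Sized.congr {env env' : Reg → ℕ} (h : Sized κ N₁ N₂ env) (hk : env' Reg.k = env Reg.k)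
    (h₁ : env' Reg.n₁ = env Reg.n₁) (h₂ : env' Reg.n₂ = env Reg.n₂) : Sized κ N₁ N₂ env' :=
  ⟨hk.trans h.k, h₁.trans h.n₁, h₂.trans h.n₂⟩

/-- The position of the table of the first automaton. -/
def offset₁ (κ N₁ N₂ : ℕ) : ℕ := κ + (N₁ + (N₂ + 3))

/-- The position of the table of the second automaton. -/
def offset₂ (κ N₁ N₂ : ℕ) : ℕ := offset₁ κ N₁ N₂ + (N₁ + (N₁ + N₁ * (κ * N₁)))

/-- An empty product has the value `1`; the three of them account for the end marks of the unary
numbers. -/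
theorem Sized.val_table₁ {env : Reg → ℕ} (h : Sized κ N₁ N₂ env) :
    Addr.val env table₁ = offset₁ κ N₁ N₂ := by
  simp [table₁, Addr.val, h.k, h.n₁, h.n₂, offset₁]

theorem Sized.val_table₂ {env : Reg → ℕ} (h : Sized κ N₁ N₂ env) :
    Addr.val env table₂ = offset₂ κ N₁ N₂ := by
  rw [table₂, addr_val_append, h.val_table₁]
  simp [Addr.val, h.k, h.n₁, offset₂]

/-- The bit string contains the tables of two automata. -/
structure IsInput (bits : ℕ → Bool) (A₁ : NFA (Fin κ) (Fin N₁)) (A₂ : NFA (Fin κ) (Fin N₂)) :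
    Prop where
  table₁ : IsTable bits (offset₁ κ N₁ N₂) A₁
  table₂ : IsTable bits (offset₂ κ N₁ N₂) A₂

variable {A₁ : NFA (Fin κ) (Fin N₁)} {A₂ : NFA (Fin κ) (Fin N₂)} {env : Reg → ℕ} {m : Mem Arr}
  {D : Set (Fin κ)} {i₁ : Fin N₁} {i₂ : Fin N₂}

/-- The arrays hold the closures of `i₁` and `i₂` without the letters of `D`. -/
structure Closed (A₁ : NFA (Fin κ) (Fin N₁)) (A₂ : NFA (Fin κ) (Fin N₂)) (D : Set (Fin κ))
    (i₁ : Fin N₁) (i₂ : Fin N₂) (m : Mem Arr) : Prop where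
  fwd₁ : ∀ j : Fin N₁, m fwd₁ j = true ↔ ReflTransGen (StepIn A₁ Dᶜ) i₁ j
  bwd₁ : ∀ j : Fin N₁, m bwd₁ j = true ↔ ReflTransGen (StepIn A₁ Dᶜ) j i₁
  fwd₂ : ∀ j : Fin N₂, m fwd₂ j = true ↔ ReflTransGen (StepIn A₂ Dᶜ) i₂ j
  bwd₂ : ∀ j : Fin N₂, m bwd₂ j = true ↔ ReflTransGen (StepIn A₂ Dᶜ) j i₂

theorem reflTransGen_flip_iff {ι : Type*} {e : ι → ι → Prop} {i j : ι} :
    ReflTransGen (fun i j => e j i) i j ↔ ReflTransGen e j i :=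
  reflTransGen_swap

/-- The backward searches are forward searches along reversed transitions. Each search writes to its
own array and to `tmp` only, so the earlier results and the removed letters persist. -/
theorem run_closures (hs : Sized κ N₁ N₂ env) (h₁ : env r₁ = i₁) (h₂ : env r₂ = i₂)
    (hm : IsInput (m inp) A₁ A₂) (hD : Represents (m del) D) :
    (∀ b ∉ [fwd₁, bwd₁, fwd₂, bwd₂, tmp], closures.run env m b = m b) ∧
      Closed A₁ A₂ D i₁ i₂ (closures.run env m) := by
  have hs' : ∀ env' : Reg → ℕ, (∀ z, z ≠ t → z ≠ x → z ≠ y → env' z = env z) →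
      Sized κ N₁ N₂ env' := fun env' h =>
    hs.congr (h _ (by decide) (by decide) (by decide)) (h _ (by decide) (by decide) (by decide))
      (h _ (by decide) (by decide) (by decide))
  obtain ⟨f₁, g₁⟩ := Cmd.run_reach (n := n₁) (t := t) (x := x) (y := y) (r := r₁)
    (E := fwdFm table₁ n₁) (F := fwd₁) (T := tmp) (m := m) (e := StepIn A₁ Dᶜ) hs.n₁ h₁ (by decide)
    (by decide) (fun env' m' he hm' i j hy hx => by
      have hs' := hs' env' he
      refine holds_fwdFm sizeAddr_table₁ ?_ hs'.k hs'.n₁ (by decide) ?_ hy hx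
      · rw [hm' inp (by decide) (by decide), hs'.val_table₁]
        exact hm.table₁
      · rwa [hm' del (by decide) (by decide)])
  set m₁ := (Cmd.reach n₁ t x y r₁ (fwdFm table₁ n₁) fwd₁ tmp).run env m with hm₁
  obtain ⟨f₂, g₂⟩ := Cmd.run_reach (n := n₁) (t := t) (x := x) (y := y) (r := r₁)
    (E := bwdFm table₁ n₁) (F := bwd₁) (T := tmp) (m := m₁) (e := fun i j => StepIn A₁ Dᶜ j i)
    hs.n₁ h₁ (by decide) (by decide) (fun env' m' he hm' i j hy hx => by
      have hs' := hs' env' he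
      refine holds_bwdFm sizeAddr_table₁ ?_ hs'.k hs'.n₁ (by decide) ?_ hy hx
      · rw [hm' inp (by decide) (by decide), f₁ inp (by decide) (by decide), hs'.val_table₁]
        exact hm.table₁
      · rwa [hm' del (by decide) (by decide), f₁ del (by decide) (by decide)])
  set m₂ := (Cmd.reach n₁ t x y r₁ (bwdFm table₁ n₁) bwd₁ tmp).run env m₁ with hm₂
  obtain ⟨f₃, g₃⟩ := Cmd.run_reach (n := n₂) (t := t) (x := x) (y := y) (r := r₂)
    (E := fwdFm table₂ n₂) (F := fwd₂) (T := tmp) (m := m₂) (e := StepIn A₂ Dᶜ) hs.n₂ h₂ (by decide)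
    (by decide) (fun env' m' he hm' i j hy hx => by
      have hs' := hs' env' he
      refine holds_fwdFm sizeAddr_table₂ ?_ hs'.k hs'.n₂ (by decide) ?_ hy hx
      · rw [hm' inp (by decide) (by decide), f₂ inp (by decide) (by decide),
          f₁ inp (by decide) (by decide), hs'.val_table₂]
        exact hm.table₂
      · rwa [hm' del (by decide) (by decide), f₂ del (by decide) (by decide),
          f₁ del (by decide) (by decide)])
  set m₃ := (Cmd.reach n₂ t x y r₂ (fwdFm table₂ n₂) fwd₂ tmp).run env m₂ with hm₃
  obtain ⟨f₄, g₄⟩ := Cmd.run_reach (n := n₂) (t := t) (x := x) (y := y) (r := r₂)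
    (E := bwdFm table₂ n₂) (F := bwd₂) (T := tmp) (m := m₃) (e := fun i j => StepIn A₂ Dᶜ j i)
    hs.n₂ h₂ (by decide) (by decide) (fun env' m' he hm' i j hy hx => by
      have hs' := hs' env' he
      refine holds_bwdFm sizeAddr_table₂ ?_ hs'.k hs'.n₂ (by decide) ?_ hy hx
      · rw [hm' inp (by decide) (by decide), f₃ inp (by decide) (by decide),
          f₂ inp (by decide) (by decide), f₁ inp (by decide) (by decide), hs'.val_table₂]
        exact hm.table₂
      · rwa [hm' del (by decide) (by decide), f₃ del (by decide) (by decide),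
          f₂ del (by decide) (by decide), f₁ del (by decide) (by decide)])
  set m₄ := (Cmd.reach n₂ t x y r₂ (bwdFm table₂ n₂) bwd₂ tmp).run env m₃ with hm₄
  have hrun : closures.run env m = m₄ := rfl
  rw [hrun]
  refine ⟨fun b hb => ?_, fun j => ?_, fun j => ?_, fun j => ?_, fun j => ?_⟩
  · simp only [List.mem_cons, List.not_mem_nil, or_false, not_or] at hb
    obtain ⟨b₁, b₂, b₃, b₄, b₅⟩ := hb
    rw [f₄ b b₄ b₅, f₃ b b₃ b₅, f₂ b b₂ b₅, f₁ b b₁ b₅]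
  · rw [f₄ _ (by decide) (by decide), f₃ _ (by decide) (by decide), f₂ _ (by decide) (by decide)]
    exact g₁ j
  · rw [f₄ _ (by decide) (by decide), f₃ _ (by decide) (by decide)]
    exact (g₂ j).trans reflTransGen_flip_iff
  · rw [f₄ _ (by decide) (by decide)]
    exact g₃ j
  · exact (g₄ j).trans reflTransGen_flip_iff

theorem run_pruneCmd (hs : Sized κ N₁ N₂ env) (h₁ : env r₁ = i₁) (h₂ : env r₂ = i₂)
    (hm : IsInput (m inp) A₁ A₂) (hD : Represents (m del) D) :
    (∀ b ∉ [fwd₁, bwd₁, fwd₂, bwd₂, tmp, del], pruneCmd.run env m b = m b) ∧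
      Represents (pruneCmd.run env m del) (prune A₁ A₂ i₁ i₂ D) := by
  obtain ⟨f, g⟩ := run_closures hs h₁ h₂ hm hD
  set m₁ := closures.run env m with hm₁
  obtain ⟨f', g'⟩ := Cmd.run_replace (x := a) (n := k) (F := del) (T := tmp) (φ := .or
    (.bit del [[a]]) (.not (.and (loopFm table₁ n₁ fwd₁ bwd₁) (loopFm table₂ n₂ fwd₂ bwd₂))))
    (env := env) (m := m₁) (P := fun j => ∃ hj : j < κ, (⟨j, hj⟩ : Fin κ) ∈ prune A₁ A₂ i₁ i₂ D)
    (by decide) (by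
      intro c hc m' hm'
      rw [hs.k] at hc
      have hs' : Sized κ N₁ N₂ (update env a c) := hs.congr (by simp) (by simp) (by simp)
      have hin : m' inp = m inp := by rw [hm' _ (by decide), f _ (by decide)]
      have l₁ := holds_loopFm (m := m') (D := D) (r := i₁) (c := ⟨c, hc⟩) (fwd := fwd₁) (bwd := bwd₁)
        sizeAddr_table₁ (by rw [hin, hs'.val_table₁]; exact hm.table₁) hs'.k hs'.n₁ (by decide)
        (by decide) (by rw [hm' _ (by decide)]; exact g.fwd₁)
        (by rw [hm' _ (by decide)]; exact g.bwd₁) (by simp)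
      have l₂ := holds_loopFm (m := m') (D := D) (r := i₂) (c := ⟨c, hc⟩) (fwd := fwd₂) (bwd := bwd₂)
        sizeAddr_table₂ (by rw [hin, hs'.val_table₂]; exact hm.table₂) hs'.k hs'.n₂ (by decide)
        (by decide) (by rw [hm' _ (by decide)]; exact g.fwd₂)
        (by rw [hm' _ (by decide)]; exact g.bwd₂) (by simp)
      rw [Fm.holds_or, Fm.Holds, Fm.Holds, Fm.Holds, l₁, l₂]
      simp only [hc, exists_true_left]
      refine or_congr ?_ Iff.rfl
      rw [hm' _ (by decide), f _ (by decide), ← hD]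
      simp [Addr.val])
  refine ⟨fun b hb => ?_, fun c => ?_⟩
  · refine (f' b ?_ ?_).trans (f b ?_)
    · rintro rfl; simp at hb
    · rintro rfl; simp at hb
    · intro h
      simp only [List.mem_cons, List.not_mem_nil, or_false, not_or] at h hb
      tauto
  · refine (g' c (by rw [hs.k]; exact c.2)).trans ?_
    simp

/-- The closures left by a pruning round belong to the letters present before that round, hence the
final recomputation. -/
theorem run_blockCmd (hs : Sized κ N₁ N₂ env) (h₁ : env r₁ = i₁) (h₂ : env r₂ = i₂)
    (hm : IsInput (m inp) A₁ A₂) :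
    (∀ b ∉ [fwd₁, bwd₁, fwd₂, bwd₂, tmp, del], blockCmd.run env m b = m b) ∧
      Closed A₁ A₂ ((prune A₁ A₂ i₁ i₂)^[κ] ∅) i₁ i₂ (blockCmd.run env m) := by
  obtain ⟨f₁, g₁, -⟩ := Cmd.run_fill (x := a) (n := k) (a := del) (e := [[a]]) (φ := .fls del)
    (env := env) (m := m) (c := 0) (P := fun _ => False) (by intro j _; simp [Addr.val])
    (fun j _ m' _ => Fm.holds_fls)
  set m₁ := (Cmd.loop a k (.assign del [[a]] (.fls del))).run env m with hm₁
  have key := Cmd.run_loop_induction (x := u) (y := k) (c := pruneCmd) (env := env) (m := m₁)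
    (fun s m' => (∀ b ∉ [fwd₁, bwd₁, fwd₂, bwd₂, tmp, del], m' b = m b) ∧
      Represents (m' del) ((prune A₁ A₂ i₁ i₂)^[s] ∅)) ?_ ?_
  · obtain ⟨f₂, g₂⟩ := key
    set m₂ := (Cmd.loop u k pruneCmd).run env m₁ with hm₂
    rw [hs.k] at g₂
    obtain ⟨f₃, g₃⟩ := run_closures (m := m₂) hs h₁ h₂ (by rwa [f₂ _ (by decide)]) g₂
    refine ⟨fun b hb => (f₃ b ?_).trans (f₂ b hb), g₃⟩
    intro h
    simp only [List.mem_cons, List.not_mem_nil, or_false, not_or] at h hb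
    tauto
  · refine ⟨fun b hb => f₁ b ?_, fun c => ?_⟩
    · rintro rfl; simp at hb
    · have := g₁ c (by rw [hs.k]; exact c.2)
      rw [zero_add] at this
      simp [this]
  · rintro s - m' ⟨f₂, g₂⟩
    obtain ⟨f₃, g₃⟩ := run_pruneCmd (env := update env u s) (m := m')
      (hs.congr (by simp) (by simp) (by simp)) (by simpa using h₁) (by simpa using h₂)
      (by rwa [f₂ _ (by decide)]) g₂
    refine ⟨fun b hb => (f₃ b hb).trans (f₂ b hb), ?_⟩
    rwa [iterate_succ_apply']

end Algorithm

/-! ### Correctness of the saturation of pairs. -/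

section Correctness

set_option linter.constructorNameAsVariable false

open Function Relation

open Reg Arr

variable {κ N₁ N₂ : ℕ} {A₁ : NFA (Fin κ) (Fin N₁)} {A₂ : NFA (Fin κ) (Fin N₂)} {env : Reg → ℕ}
  {m : Mem Arr} {S T : Set (Fin N₁ × Fin N₂)}

/-- The array represents a set of pairs. -/
def RepresentsPairs (bits : ℕ → Bool) (S : Set (Fin N₁ × Fin N₂)) : Prop :=
  ∀ (i : Fin N₁) (j : Fin N₂), bits (i * N₂ + j) = true ↔ (i, j) ∈ S

theorem run_replacePairs {φ : Fm Reg Arr} (hs : Sized κ N₁ N₂ env)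
    (hφ : ∀ (i : Fin N₁) (j : Fin N₂) (m' : Mem Arr), (∀ b ≠ tmp, m' b = m b) →
      (φ.Holds (update (update env x i) y j) m' ↔ (i, j) ∈ S)) :
    (∀ b, b ≠ pairs → b ≠ tmp → (Cmd.replace₂ x y n₁ n₂ pairs tmp φ).run env m b = m b) ∧
      RepresentsPairs ((Cmd.replace₂ x y n₁ n₂ pairs tmp φ).run env m pairs) S := by
  obtain ⟨f, g⟩ := Cmd.run_replace₂ (x := x) (y := y) (n := n₁) (n' := n₂) (F := pairs) (T := tmp)
    (φ := φ) (env := env) (m := m)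
    (P := fun i j => ∃ (hi : i < N₁) (hj : j < N₂), ((⟨i, hi⟩, ⟨j, hj⟩) : Fin N₁ × Fin N₂) ∈ S)
    (by decide) (by decide) (by decide) (by decide) (by
      intro i hi j hj m' hm'
      rw [hs.n₁] at hi
      rw [hs.n₂] at hj
      rw [hφ ⟨i, hi⟩ ⟨j, hj⟩ m' hm']
      simp [hi, hj])
  refine ⟨f, fun i j => ?_⟩
  have := g i (by rw [hs.n₁]; exact i.2) j (by rw [hs.n₂]; exact j.2)
  rw [hs.n₂] at this
  rw [this]
  simp

theorem holds_pairBit (hs : Sized κ N₁ N₂ env) (hS : RepresentsPairs (m pairs) S) {z z' : Reg}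
    {i : Fin N₁} {j : Fin N₂} (hz : env z = i) (hz' : env z' = j) :
    (Fm.bit pairs [[z, n₂], [z']]).Holds env m ↔ (i, j) ∈ S := by
  rw [← hS]
  simp [Fm.Holds, Addr.val, hz, hz', hs.n₂]

/-- The edges of the graph of pairs that read a letter. -/
def LetterEdge (A₁ : NFA (Fin κ) (Fin N₁)) (A₂ : NFA (Fin κ) (Fin N₂)) (p q : Fin N₁ × Fin N₂) :
    Prop :=
  ∃ c, q.1 ∈ A₁.step p.1 c ∧ q.2 ∈ A₂.step p.2 c

/-- The edges of the graph of pairs that read a block with a loop at `r`. -/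
def BlockEdge (A₁ : NFA (Fin κ) (Fin N₁)) (A₂ : NFA (Fin κ) (Fin N₂)) (r p q : Fin N₁ × Fin N₂) :
    Prop :=
  ∃ B, BlockRun A₁ B p.1 r.1 q.1 ∧ BlockRun A₂ B p.2 r.2 q.2

theorem pairStep_iff {p q : Fin N₁ × Fin N₂} :
    PairStep A₁ A₂ p q ↔ LetterEdge A₁ A₂ p q ∨ ∃ r, BlockEdge A₁ A₂ r p q := by
  constructor
  · rintro (⟨c, h₁, h₂⟩ | ⟨B, r, h₁, h₂⟩)
    · exact Or.inl ⟨c, h₁, h₂⟩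
    · exact Or.inr ⟨r, B, h₁, h₂⟩
  · rintro (⟨c, h₁, h₂⟩ | ⟨r, B, h₁, h₂⟩)
    · exact .letter c h₁ h₂
    · exact .block B r h₁ h₂

theorem IsInput.sized_table₁ (h : IsInput (m inp) A₁ A₂) (hs : Sized κ N₁ N₂ env) :
    IsTable (m inp) (Addr.val env PTSep.table₁) A₁ := by
  rw [hs.val_table₁]; exact h.table₁

theorem IsInput.sized_table₂ (h : IsInput (m inp) A₁ A₂) (hs : Sized κ N₁ N₂ env) :
    IsTable (m inp) (Addr.val env PTSep.table₂) A₂ := by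
  rw [hs.val_table₂]; exact h.table₂

theorem holds_letterFm (hs : Sized κ N₁ N₂ env) (hm : IsInput (m inp) A₁ A₂)
    (hS : RepresentsPairs (m pairs) S) {i : Fin N₁} {j : Fin N₂} (hx : env x = i) (hy : env y = j) :
    letterFm.Holds env m ↔ (i, j) ∈ expand (LetterEdge A₁ A₂) S := by
  have hs₁ : ∀ i' j', Sized κ N₁ N₂ (update (update env p i') q j') := fun i' j' =>
    hs.congr (by simp) (by simp) (by simp)
  have hs₂ : ∀ i' j' c, Sized κ N₁ N₂ (update (update (update env p i') q j') a c) := fun i' j' c =>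
    hs.congr (by simp) (by simp) (by simp)
  have hbit : ∀ (i' : Fin N₁) (j' : Fin N₂), (Fm.bit pairs [[p, n₂], [q]]).Holds
      (update (update env p i') q j') m ↔ (i', j') ∈ S := fun i' j' =>
    holds_pairBit (hs₁ i' j') hS (by simp) (by simp)
  have h₁ : ∀ (i' : Fin N₁) (j' : Fin N₂) (c : Fin κ), (stepFm table₁ n₁ p a x).Holds
      (update (update (update env p i') q j') a c) m ↔ i ∈ A₁.step i' c := fun i' j' c =>
    holds_stepFm (hm.sized_table₁ (hs₂ i' j' c)) (hs₂ i' j' c).k (hs₂ i' j' c).n₁ (by simp) (by simp)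
      (by simp [hx])
  have h₂ : ∀ (i' : Fin N₁) (j' : Fin N₂) (c : Fin κ), (stepFm table₂ n₂ q a y).Holds
      (update (update (update env p i') q j') a c) m ↔ j ∈ A₂.step j' c := fun i' j' c =>
    holds_stepFm (hm.sized_table₂ (hs₂ i' j' c)) (hs₂ i' j' c).k (hs₂ i' j' c).n₂ (by simp) (by simp)
      (by simp [hy])
  rw [letterFm, Fm.holds_or, holds_pairBit hs hS hx hy]
  refine or_congr Iff.rfl ⟨?_, ?_⟩
  · rintro ⟨i', hi', j', hj', hb, c, hc, e₁, e₂⟩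
    rw [hs.n₁] at hi'
    rw [update_of_ne (by decide), hs.n₂] at hj'
    rw [(hs₁ i' j').k] at hc
    exact ⟨(⟨i', hi'⟩, ⟨j', hj'⟩), (hbit ⟨i', hi'⟩ ⟨j', hj'⟩).1 hb, ⟨c, hc⟩,
      (h₁ ⟨i', hi'⟩ ⟨j', hj'⟩ ⟨c, hc⟩).1 e₁, (h₂ ⟨i', hi'⟩ ⟨j', hj'⟩ ⟨c, hc⟩).1 e₂⟩
  · rintro ⟨⟨i', j'⟩, hb, c, e₁, e₂⟩
    refine ⟨i', by rw [hs.n₁]; exact i'.2, j', ?_, (hbit i' j').2 hb, c, ?_, (h₁ i' j' c).2 e₁,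
      (h₂ i' j' c).2 e₂⟩
    · rw [update_of_ne (by decide), hs.n₂]; exact j'.2
    · rw [(hs₁ i' j').k]; exact c.2

theorem holds_blockFm {r : Fin N₁ × Fin N₂} (hs : Sized κ N₁ N₂ env)
    (hc : Closed A₁ A₂ ((prune A₁ A₂ r.1 r.2)^[κ] ∅) r.1 r.2 m)
    (hS : RepresentsPairs (m pairs) S) {i : Fin N₁} {j : Fin N₂} (hx : env x = i) (hy : env y = j) :
    blockFm.Holds env m ↔ (i, j) ∈ expand (BlockEdge A₁ A₂ r) S := by
  have hs₁ : ∀ i' j', Sized κ N₁ N₂ (update (update env p i') q j') := fun i' j' =>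
    hs.congr (by simp) (by simp) (by simp)
  have hbit : ∀ (i' : Fin N₁) (j' : Fin N₂), (Fm.bit pairs [[p, n₂], [q]]).Holds
      (update (update env p i') q j') m ↔ (i', j') ∈ S := fun i' j' =>
    holds_pairBit (hs₁ i' j') hS (by simp) (by simp)
  have key : ∀ (i' : Fin N₁) (j' : Fin N₂), BlockEdge A₁ A₂ r (i', j') (i, j) ↔
      (m bwd₁ i' = true ∧ m fwd₁ i = true) ∧ m bwd₂ j' = true ∧ m fwd₂ j = true := by
    intro i' j'
    rw [hc.bwd₁, hc.fwd₁, hc.bwd₂, hc.fwd₂]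
    exact exists_blockRun_iff (by rw [Fintype.card_fin])
  rw [blockFm, Fm.holds_or, holds_pairBit hs hS hx hy]
  refine or_congr Iff.rfl ⟨?_, ?_⟩
  · rintro ⟨f₁, f₂, i', hi', j', hj', hb, b₁, b₂⟩
    rw [hs.n₁] at hi'
    rw [update_of_ne (by decide), hs.n₂] at hj'
    refine ⟨(⟨i', hi'⟩, ⟨j', hj'⟩), (hbit ⟨i', hi'⟩ ⟨j', hj'⟩).1 hb, (key _ _).2 ?_⟩
    simpa [Fm.Holds, Addr.val, hx, hy, and_assoc] using And.intro (And.intro b₁ f₁) (And.intro b₂ f₂)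
  · rintro ⟨⟨i', j'⟩, hb, e⟩
    obtain ⟨⟨b₁, f₁⟩, b₂, f₂⟩ := (key _ _).1 e
    refine ⟨?_, ?_, i', by rw [hs.n₁]; exact i'.2, j', ?_, (hbit i' j').2 hb, ?_, ?_⟩
    · simpa [Fm.Holds, Addr.val, hx] using f₁
    · simpa [Fm.Holds, Addr.val, hy] using f₂
    · rw [update_of_ne (by decide), hs.n₂]; exact j'.2
    · simpa [Fm.Holds, Addr.val] using b₁
    · simpa [Fm.Holds, Addr.val] using b₂

theorem run_letterPass (hs : Sized κ N₁ N₂ env) (hm : IsInput (m inp) A₁ A₂)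
    (hS : RepresentsPairs (m pairs) S) :
    (Cmd.replace₂ x y n₁ n₂ pairs tmp letterFm).run env m inp = m inp ∧
      RepresentsPairs ((Cmd.replace₂ x y n₁ n₂ pairs tmp letterFm).run env m pairs)
        (expand (LetterEdge A₁ A₂) S) := by
  obtain ⟨f, g⟩ := run_replacePairs (m := m) (φ := letterFm) (S := expand (LetterEdge A₁ A₂) S) hs (by
    intro i j m' hm'
    refine holds_letterFm (hs.congr (by simp) (by simp) (by simp)) ?_ ?_ (by simp) (by simp)
    · rwa [hm' _ (by decide)]
    · rwa [hm' _ (by decide)])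
  exact ⟨f _ (by decide) (by decide), g⟩

theorem run_blockPass {r : Fin N₁ × Fin N₂} (hs : Sized κ N₁ N₂ env) (h₁ : env r₁ = r.1)
    (h₂ : env r₂ = r.2) (hm : IsInput (m inp) A₁ A₂) (hS : RepresentsPairs (m pairs) S) :
    (Cmd.seq blockCmd (.replace₂ x y n₁ n₂ pairs tmp blockFm)).run env m inp = m inp ∧
      RepresentsPairs ((Cmd.seq blockCmd (.replace₂ x y n₁ n₂ pairs tmp blockFm)).run env m pairs)
        (expand (BlockEdge A₁ A₂ r) S) := by
  obtain ⟨f, g⟩ := run_blockCmd hs h₁ h₂ hm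
  set m₁ := blockCmd.run env m with hm₁
  obtain ⟨f', g'⟩ := run_replacePairs (m := m₁) (φ := blockFm) (S := expand (BlockEdge A₁ A₂ r) S) hs
    (by
      intro i j m' hm'
      refine holds_blockFm (hs.congr (by simp) (by simp) (by simp)) ?_ ?_ (by simp) (by simp)
      · constructor
        · rw [hm' _ (by decide)]; exact g.fwd₁
        · rw [hm' _ (by decide)]; exact g.bwd₁
        · rw [hm' _ (by decide)]; exact g.fwd₂
        · rw [hm' _ (by decide)]; exact g.bwd₂
      · rwa [hm' _ (by decide), f _ (by decide)])
  exact ⟨(f' _ (by decide) (by decide)).trans (f _ (by decide)), g'⟩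

theorem subset_expand {ι : Type*} (e : ι → ι → Prop) (S : Set ι) : S ⊆ expand e S :=
  Set.subset_union_left

/-- A pass adds all successors of the given pairs, and only pairs that are reachable. -/
theorem run_passCmd (hs : Sized κ N₁ N₂ env) (hm : IsInput (m inp) A₁ A₂)
    (hS : RepresentsPairs (m pairs) S) (hST : S ⊆ T) (hT : expand (PairStep A₁ A₂) T ⊆ T) :
    passCmd.run env m inp = m inp ∧
      ∃ R, RepresentsPairs (passCmd.run env m pairs) R ∧ expand (PairStep A₁ A₂) S ⊆ R ∧ R ⊆ T := by
  have hT₁ : ∀ R ⊆ T, expand (LetterEdge A₁ A₂) R ⊆ T := by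
    rintro R hR q (hq | ⟨p, hp, hpq⟩)
    · exact hR hq
    · exact hT (Or.inr ⟨p, hR hp, pairStep_iff.2 (Or.inl hpq)⟩)
  have hT₂ : ∀ r, ∀ R ⊆ T, expand (BlockEdge A₁ A₂ r) R ⊆ T := by
    rintro r R hR q (hq | ⟨p, hp, hpq⟩)
    · exact hR hq
    · exact hT (Or.inr ⟨p, hR hp, pairStep_iff.2 (Or.inr ⟨r, hpq⟩)⟩)
  obtain ⟨f, g⟩ := run_letterPass hs hm hS
  set m₁ := (Cmd.replace₂ x y n₁ n₂ pairs tmp letterFm).run env m with hm₁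
  set S₁ := expand (LetterEdge A₁ A₂) S with hS₁
  -- The array of pairs grows in place, so a pass may follow several edges in a row and the
  -- resulting `R` has no simple description. It suffices that `R` stays inside `T` and contains the
  -- successors of `S₁` along the block edges through all `r` treated so far, in lexicographic
  -- order.
  let done (s s' : ℕ) (m' : Mem Arr) : Prop := m' inp = m inp ∧ ∃ R, RepresentsPairs (m' pairs) R ∧
    S₁ ⊆ R ∧ R ⊆ T ∧ ∀ r : Fin N₁ × Fin N₂, (r.1 < s ∨ (r.1 : ℕ) = s ∧ r.2 < s') →
      ∀ p ∈ S₁, ∀ q, BlockEdge A₁ A₂ r p q → q ∈ R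
  have key := Cmd.run_loop_induction (x := r₁) (y := n₁) (env := env) (m := m₁)
    (c := .loop r₂ n₂ (.seq blockCmd (.replace₂ x y n₁ n₂ pairs tmp blockFm)))
    (fun s m' => done s 0 m') ⟨f, S₁, g, subset_rfl, hT₁ S hST, by simp⟩ ?_
  · rw [hs.n₁] at key
    obtain ⟨f', R, hR, hSR, hRT, h⟩ := key
    refine ⟨f', R, hR, ?_, hRT⟩
    rintro q (hq | ⟨p, hp, hpq⟩)
    · exact hSR (Or.inl hq)
    · rcases pairStep_iff.1 hpq with hpq | ⟨r, hpq⟩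
      · exact hSR (Or.inr ⟨p, hp, hpq⟩)
      · exact h r (Or.inl r.1.2) p (Or.inl hp) q hpq
  · intro s hsn m' hm'
    rw [hs.n₁] at hsn
    have hs' : Sized κ N₁ N₂ (update env r₁ s) := hs.congr (by simp) (by simp) (by simp)
    have key := Cmd.run_loop_induction (x := r₂) (y := n₂) (env := update env r₁ s) (m := m')
      (c := .seq blockCmd (.replace₂ x y n₁ n₂ pairs tmp blockFm))
      (fun s' m' => done s s' m') hm' ?_
    · rw [hs'.n₂] at key
      obtain ⟨f', R, hR, hSR, hRT, h⟩ := key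
      refine ⟨f', R, hR, hSR, hRT, fun r hr => h r ?_⟩
      have := r.2.2
      omega
    · rintro s' hsn' m'' ⟨f', R, hR, hSR, hRT, h⟩
      rw [hs'.n₂] at hsn'
      obtain ⟨f'', g''⟩ := run_blockPass (r := (⟨s, hsn⟩, ⟨s', hsn'⟩)) (m := m'')
        (env := update (update env r₁ s) r₂ s') (hs'.congr (by simp) (by simp) (by simp)) (by simp)
        (by simp) (by rwa [f']) hR
      refine ⟨f''.trans f', _, g'', hSR.trans (subset_expand _ _), hT₂ _ _ hRT, ?_⟩
      intro r hr p hp q hpq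
      by_cases hr' : r = (⟨s, hsn⟩, ⟨s', hsn'⟩)
      · subst hr'
        exact Or.inr ⟨p, hSR hp, hpq⟩
      · refine Or.inl (h r ?_ p hp q hpq)
        have : ¬ ((r.1 : ℕ) = s ∧ (r.2 : ℕ) = s') := fun h =>
          hr' (Prod.ext (Fin.ext h.1) (Fin.ext h.2))
        omega

/-- The main part of the program decides whether the languages are entangled. -/
theorem run_coreCmd (hs : Sized κ N₁ N₂ env) (hm : IsInput (m inp) A₁ A₂) :
    coreCmd.run env m inp = m inp ∧
      (coreCmd.run env m out 0 = true ↔ ¬ Entangled A₁.accepts A₂.accepts) := by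
  obtain ⟨f₁, g₁⟩ := Cmd.run_fill₂ (x := x) (y := y) (n := n₁) (n' := n₂) (a := pairs)
    (φ := .and (startFm table₁ x) (startFm table₂ y)) (env := env) (m := m)
    (P := fun i j => ∃ (hi : i < N₁) (hj : j < N₂), ⟨i, hi⟩ ∈ A₁.start ∧ ⟨j, hj⟩ ∈ A₂.start)
    (by decide) (by decide) (by decide) (by
      intro i hi j hj m' hm'
      rw [hs.n₁] at hi
      rw [hs.n₂] at hj
      have hs' : Sized κ N₁ N₂ (update (update env x i) y j) :=
        hs.congr (by simp) (by simp) (by simp)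
      have hin : IsInput (m' inp) A₁ A₂ := by rwa [hm' _ (by decide)]
      refine (and_congr (holds_startFm (j := ⟨i, hi⟩) (hin.sized_table₁ hs') (by simp))
        (holds_startFm (j := ⟨j, hj⟩) (hin.sized_table₂ hs') (by simp))).trans ?_
      simp [hi, hj])
  set m₁ := (Cmd.loop x n₁ (.loop y n₂ (.assign pairs [[x, n₂], [y]]
      (.and (startFm table₁ x) (startFm table₂ y))))).run env m with hm₁
  let I : Set (Fin N₁ × Fin N₂) := {p | p.1 ∈ A₁.start ∧ p.2 ∈ A₂.start}
  let T : Set (Fin N₁ × Fin N₂) := {q | ∃ p ∈ I, ReflTransGen (PairStep A₁ A₂) p q}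
  -- There are `N₁ * N₂` pairs, so this many expansions reach everything; the nested loops over `t₁`
  -- and `t₂` supply as many passes.
  have hIT : (expand (PairStep A₁ A₂))^[N₁ * N₂] I = T := by
    have := iterate_expand_card (PairStep A₁ A₂) I
    rwa [Fintype.card_prod, Fintype.card_fin, Fintype.card_fin] at this
  have hT : expand (PairStep A₁ A₂) T ⊆ T := by
    rintro q (hq | ⟨p, ⟨i, hi, hip⟩, hpq⟩)
    · exact hq
    · exact ⟨i, hi, hip.tail hpq⟩
  have hI : RepresentsPairs (m₁ pairs) I := by
    intro i j
    have := g₁ i (by rw [hs.n₁]; exact i.2) j (by rw [hs.n₂]; exact j.2)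
    rw [hs.n₂] at this
    rw [this]
    simp [I]
  -- A pass may add more than one expansion does. The set of pairs is therefore trapped between the
  -- iterated expansion and the set of reachable pairs, which agree at the end.
  let inv (s : ℕ) (m' : Mem Arr) : Prop := m' inp = m inp ∧ ∃ R, RepresentsPairs (m' pairs) R ∧
    (expand (PairStep A₁ A₂))^[s] I ⊆ R ∧ R ⊆ T
  have key := Cmd.run_loop_induction (x := t₁) (y := n₁) (env := env) (m := m₁)
    (c := .loop t₂ n₂ passCmd) (fun s m' => inv (s * N₂) m')
    ⟨f₁ _ (by decide), I, hI, by simp, fun i hi => ⟨i, hi, .refl⟩⟩ ?_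
  · set m₂ := (Cmd.loop t₁ n₁ (.loop t₂ n₂ passCmd)).run env m₁ with hm₂
    rw [hs.n₁] at key
    obtain ⟨f₂, R, hR, hIR, hRT⟩ := key
    have hRT : R = T := hRT.antisymm (hIT ▸ hIR)
    subst hRT
    let ψ : Fm Reg Arr := .ex x n₁ (.ex y n₂ (.and (.bit pairs [[x, n₂], [y]])
      (.and (acceptFm table₁ n₁ x) (acceptFm table₂ n₂ y))))
    have hrun : coreCmd.run env m = update m₂ out (update (m₂ out) (Addr.val env [])
      ((Fm.not ψ).eval env m₂)) := rfl
    have hm₂ : IsInput (m₂ inp) A₁ A₂ := by rwa [f₂]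
    have hψ : ψ.Holds env m₂ ↔ Entangled A₁.accepts A₂.accepts := by
      have hs' : ∀ i j, Sized κ N₁ N₂ (update (update env x i) y j) := fun i j =>
        hs.congr (by simp) (by simp) (by simp)
      have key : ∀ (i : Fin N₁) (j : Fin N₂), ((Fm.bit pairs [[x, n₂], [y]]).and
          ((acceptFm table₁ n₁ x).and (acceptFm table₂ n₂ y))).Holds
            (update (update env x i) y j) m₂ ↔ (i, j) ∈ T ∧ i ∈ A₁.accept ∧ j ∈ A₂.accept := by
        intro i j
        exact and_congr (holds_pairBit (hs' i j) hR (by simp) (by simp)) (and_congr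
          (holds_acceptFm (hm₂.sized_table₁ (hs' i j)) (hs' i j).n₁ (by simp))
          (holds_acceptFm (hm₂.sized_table₂ (hs' i j)) (hs' i j).n₂ (by simp)))
      rw [entangled_iff]
      constructor
      · rintro ⟨i, hi, j, hj, h⟩
        rw [hs.n₁] at hi
        rw [update_of_ne (by decide), hs.n₂] at hj
        obtain ⟨⟨p, hp, hpq⟩, hij⟩ := (key ⟨i, hi⟩ ⟨j, hj⟩).1 h
        exact ⟨p, _, hp, hij, hpq⟩
      · rintro ⟨p, q, hp, hq, hpq⟩
        refine ⟨q.1, by rw [hs.n₁]; exact q.1.2, q.2, ?_, (key q.1 q.2).2 ⟨⟨p, hp, hpq⟩, hq⟩⟩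
        rw [update_of_ne (by decide), hs.n₂]
        exact q.2.2
    rw [hrun]
    refine ⟨by rw [update_of_ne (by decide), f₂], ?_⟩
    rw [update_self, show Addr.val env [] = 0 from rfl, update_self, Fm.eval_eq_true, Fm.Holds, hψ]
  · intro s _ m' hm'
    have hs' : Sized κ N₁ N₂ (update env t₁ s) := hs.congr (by simp) (by simp) (by simp)
    have key := Cmd.run_loop_induction (x := t₂) (y := n₂) (env := update env t₁ s) (m := m')
      (c := passCmd) (fun s' m' => inv (s * N₂ + s') m') hm' ?_
    · rwa [hs'.n₂, ← Nat.succ_mul] at key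
    · rintro s' - m'' ⟨f', R, hR, hIR, hRT⟩
      obtain ⟨f'', R', hR', hRR', hRT'⟩ := run_passCmd (env := update (update env t₁ s) t₂ s')
        (m := m'') (hs'.congr (by simp) (by simp) (by simp)) (by rwa [f']) hR hRT hT
      refine ⟨f''.trans f', R', hR', ?_, hRT'⟩
      rw [← add_assoc, iterate_succ_apply']
      exact (expand_mono hIR).trans hRR'

end Correctness

/-! ### Finding the sizes in the input. -/

section Header

set_option linter.constructorNameAsVariable false

open Function

open Reg Arr

/-- The bits from position `o` on are `n` in unary, followed by an end mark. -/
def IsUnary (bits : ℕ → Bool) (o n : ℕ) : Prop := (∀ i < n, bits (o + i) = true) ∧ ¬ bits (o + n) = true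

/-- The number is the distance from `o` to the first bit that is not set. -/
theorem IsUnary.unique {bits : ℕ → Bool} {o n n' : ℕ} (h : IsUnary bits o n)
    (h' : IsUnary bits o n') : n = n' := by
  rcases lt_trichotomy n n' with hn | hn | hn
  · exact absurd (h'.1 n hn) h.2
  · exact hn
  · exact absurd (h.1 n' hn) h'.2

theorem holds_unaryFm {o : Addr Reg} {n : Reg} {env : Reg → ℕ} {m : Mem Arr}
    (ho : ∀ i, Addr.val (update env z i) o = Addr.val env o) :
    (unaryFm o n).Holds env m ↔ IsUnary (m inp) (Addr.val env o) (env n) := by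
  simp only [unaryFm, Fm.Holds, addr_val_append, IsUnary, ho]
  refine and_congr ?_ (by simp [Addr.val])
  simp [Addr.val]

/-- The bits start with the three sizes. -/
structure IsHeader (bits : ℕ → Bool) (κ N₁ N₂ : ℕ) : Prop where
  k : IsUnary bits 0 κ
  n₁ : IsUnary bits (κ + 1) N₁
  n₂ : IsUnary bits (κ + 1 + N₁ + 1) N₂

theorem holds_headerFm {env : Reg → ℕ} {m : Mem Arr} :
    headerFm.Holds env m ↔ IsHeader (m inp) (env k) (env n₁) (env n₂) := by
  rw [headerFm, Fm.Holds, Fm.Holds, holds_unaryFm (by intro i; simp [Addr.val]),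
    holds_unaryFm (by intro i; simp [Addr.val]),
    holds_unaryFm (by intro i; simp [Addr.val])]
  have e₁ : Addr.val env [[k], []] = env k + 1 := by simp [Addr.val]
  have e₂ : Addr.val env [[k], [], [n₁], []] = env k + 1 + env n₁ + 1 := by
    simp [Addr.val, add_assoc]
  rw [e₁, e₂, show Addr.val env [] = 0 from rfl]
  exact ⟨fun ⟨h, h₁, h₂⟩ => ⟨h, h₁, h₂⟩, fun ⟨h, h₁, h₂⟩ => ⟨h, h₁, h₂⟩⟩

/-- A loop whose body has an effect in one round only. -/
theorem Cmd.run_loop_single {V A : Type} [DecidableEq V] [DecidableEq A] {x y : V} {c : Cmd V A}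
    {env : V → ℕ} {m : Mem A} {j : ℕ} (P : Mem A → Prop) (hj : j < env y) (hm : P m)
    (hc : P (c.run (update env x j) m))
    (hid : ∀ i, i ≠ j → ∀ m', P m' → c.run (update env x i) m' = m') :
    (loop x y c).run env m = c.run (update env x j) m := by
  have := run_loop_induction (x := x) (y := y) (c := c) (env := env) (m := m)
    (fun s m' => m' = if j < s then c.run (update env x j) m else m) (by simp) (by
      rintro i - m' rfl
      rcases lt_trichotomy i j with h | h | h
      · rw [if_neg (by omega), if_neg (by omega), hid i h.ne m hm]
      · subst h
        simp
      · rw [if_pos (by omega), if_pos (by omega), hid i h.ne' _ hc])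
  rwa [if_pos hj] at this

/-- A loop whose body has no effect. -/
theorem Cmd.run_loop_id {V A : Type} [DecidableEq V] [DecidableEq A] {x y : V} {c : Cmd V A}
    {env : V → ℕ} {m : Mem A} (hid : ∀ i, c.run (update env x i) m = m) :
    (loop x y c).run env m = m :=
  run_loop_induction (fun _ m' => m' = m) rfl (by rintro i - m' rfl; exact hid i)

/-- The program tries all triples of sizes below `env size`. Unary codes are unique, so one triple
alone passes the header test; the main part leaves the input array intact, so this remains true
after it has run. -/
theorem run_separabilityCmd {κ N₁ N₂ : ℕ} {A₁ : NFA (Fin κ) (Fin N₁)} {A₂ : NFA (Fin κ) (Fin N₂)}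
    {env : Reg → ℕ} {m : Mem Arr} (hκ : κ < env size) (hN₁ : N₁ < env size) (hN₂ : N₂ < env size)
    (hh : IsHeader (m inp) κ N₁ N₂) (hm : IsInput (m inp) A₁ A₂) :
    separabilityCmd.run env m out 0 = true ↔ ¬ Entangled A₁.accepts A₂.accepts := by
  have hneg : ∀ (env' : Reg → ℕ) (m' : Mem Arr), m' inp = m inp →
      ¬ Sized κ N₁ N₂ env' → (Cmd.cond headerFm coreCmd).run env' m' = m' := by
    intro env' m' hm' hs
    have : headerFm.eval env' m' = false := by
      rw [Fm.eval_eq_false, holds_headerFm, hm']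
      intro h
      have h₀ := h.k.unique hh.k
      have h₁ := h.n₁
      rw [h₀] at h₁
      have h₁ := h₁.unique hh.n₁
      have h₂ := h.n₂
      rw [h₀, h₁] at h₂
      exact hs ⟨h₀, h₁, h₂.unique hh.n₂⟩
    rw [Cmd.run, this, cond_false]
  set env' := update (update (update env k κ) n₁ N₁) n₂ N₂ with henv'
  have hs : Sized κ N₁ N₂ env' := ⟨by simp [henv'], by simp [henv'], by simp [henv']⟩
  have hpos : (Cmd.cond headerFm coreCmd).run env' m = coreCmd.run env' m := by
    have : headerFm.eval env' m = true := by
      rw [Fm.eval_eq_true, holds_headerFm, hs.k, hs.n₁, hs.n₂]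
      exact hh
    rw [Cmd.run, this, cond_true]
  obtain ⟨hin, hout⟩ := run_coreCmd (m := m) hs hm
  have h₃ : (Cmd.loop n₂ size (.cond headerFm coreCmd)).run (update (update env k κ) n₁ N₁) m =
      coreCmd.run env' m := by
    rw [Cmd.run_loop_single (j := N₂) (fun m' => m' inp = m inp) (by simpa using hN₂) rfl
      (by rw [hpos, hin]), hpos]
    intro i hi m' hm'
    refine hneg _ _ hm' fun h => hi ?_
    simpa using h.n₂
  have h₂ : (Cmd.loop n₁ size (.loop n₂ size (.cond headerFm coreCmd))).run (update env k κ) m =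
      coreCmd.run env' m := by
    rw [Cmd.run_loop_single (j := N₁) (fun m' => m' inp = m inp) (by simpa using hN₁) rfl
      (by rw [h₃, hin]), h₃]
    intro i hi m' hm'
    refine Cmd.run_loop_id fun i' => hneg _ _ hm' fun h => hi ?_
    simpa using h.n₁
  have h₁ : separabilityCmd.run env m = coreCmd.run env' m := by
    rw [separabilityCmd, Cmd.run_loop_single (j := κ) (fun m' => m' inp = m inp) hκ rfl
      (by rw [h₂, hin]), h₂]
    intro i hi m' hm'
    refine Cmd.run_loop_id fun i' => Cmd.run_loop_id fun i'' => hneg _ _ hm' fun h => hi ?_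
    simpa using h.k
  rw [h₁, hout]

end Header

/-! ### Positions and lengths in the encoding. -/

section Encoding

/-- The list `l` stands in `bits` from position `o` on. -/
def ReadsAt (bits : ℕ → Bool) (o : ℕ) (l : List Bool) : Prop :=
  ∀ i < l.length, bits (o + i) = l.getD i false

variable {bits : ℕ → Bool} {o : ℕ}

theorem readsAt_self (l : List Bool) : ReadsAt (fun i => l.getD i false) 0 l := fun i _ => by
  rw [zero_add]

theorem ReadsAt.left {l l' : List Bool} (h : ReadsAt bits o (l ++ l')) : ReadsAt bits o l := by
  intro i hi
  rw [h i (by rw [List.length_append]; omega), List.getD_append _ _ _ _ hi]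

theorem ReadsAt.right {l l' : List Bool} (h : ReadsAt bits o (l ++ l')) :
    ReadsAt bits (o + l.length) l' := by
  intro i hi
  rw [add_assoc, h _ (by rw [List.length_append]; omega),
    List.getD_append_right _ _ _ _ (by omega), Nat.add_sub_cancel_left]

theorem ReadsAt.map_finRange {n : ℕ} {f : Fin n → Bool}
    (h : ReadsAt bits o ((List.finRange n).map f)) (i : Fin n) : bits (o + i) = f i := by
  rw [h i (by simp), List.getD_eq_getElem _ _ (by simp)]
  simp

/-- Equal lengths put the `i`-th block at distance `i * L`, in accordance with the products in the
addresses of transitions. -/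
theorem ReadsAt.flatMap_finRange {L : ℕ} : ∀ {n : ℕ} {f : Fin n → List Bool} {o : ℕ},
    (∀ i, (f i).length = L) → ReadsAt bits o ((List.finRange n).flatMap f) → ∀ i : Fin n,
      ReadsAt bits (o + i * L) (f i)
  | 0, _, _, _, _, i => i.elim0
  | n + 1, f, o, hf, h, i => by
      rw [List.finRange_succ, List.flatMap_cons, List.flatMap_map] at h
      induction i using Fin.cases with
      | zero => simpa using h.left
      | succ i =>
        have := ReadsAt.flatMap_finRange (fun i => hf i.succ) h.right i
        rwa [hf, add_assoc, add_comm L, ← Nat.succ_mul] at this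

theorem length_flatMap_finRange {n L : ℕ} {f : Fin n → List Bool} (hf : ∀ i, (f i).length = L) :
    ((List.finRange n).flatMap f).length = n * L := by
  simp [List.length_flatMap, hf]

theorem ReadsAt.isUnary {n : ℕ} (h : ReadsAt bits o (encodeUnary n)) : IsUnary bits o n := by
  constructor
  · intro i hi
    rw [h i (by simp [encodeUnary]; omega), encodeUnary, List.getD_append _ _ _ _ (by simpa using hi),
      List.getD_eq_getElem _ _ (by simpa using hi)]
    simp
  · rw [h n (by simp [encodeUnary]), encodeUnary, List.getD_append_right _ _ _ _ (by simp)]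
    simp

theorem length_encodeUnary (n : ℕ) : (encodeUnary n).length = n + 1 := by simp [encodeUnary]

theorem length_encodeTable {κ N : ℕ} (A : NFA (Fin κ) (Fin N)) :
    (encodeTable A).length = N + (N + N * (κ * N)) := by
  rw [encodeTable, List.length_append, List.length_append, length_flatMap_finRange
    (fun p => length_flatMap_finRange fun a => (List.length_map _).trans List.length_finRange)]
  simp [add_assoc]

theorem ReadsAt.isTable {κ N : ℕ} {A : NFA (Fin κ) (Fin N)} (h : ReadsAt bits o (encodeTable A)) :
    IsTable bits o A := by
  classical
  refine ⟨fun q => ?_, fun q => ?_, fun p a q => ?_⟩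
  · rw [h.left.left.map_finRange q, decide_eq_true_iff]
  · have := h.left.right.map_finRange q
    rw [List.length_map, List.length_finRange, add_assoc] at this
    rw [this, decide_eq_true_iff]
  · have := ((h.right.flatMap_finRange (fun p => length_flatMap_finRange fun a =>
      (List.length_map _).trans List.length_finRange) p).flatMap_finRange
        (fun a => (List.length_map _).trans List.length_finRange) a).map_finRange q
    rw [List.length_append, List.length_map, List.length_map, List.length_finRange] at this
    rw [← decide_eq_true_iff (p := q ∈ A.step p a), ← this]
    simp only [add_assoc]

variable {κ N₁ N₂ : ℕ} (A₁ : NFA (Fin κ) (Fin N₁)) (A₂ : NFA (Fin κ) (Fin N₂))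

theorem length_encodePair : (encodePair A₁ A₂).length = κ + 1 + (N₁ + 1) + (N₂ + 1) +
    (N₁ + (N₁ + N₁ * (κ * N₁))) + (N₂ + (N₂ + N₂ * (κ * N₂))) := by
  simp only [encodePair, List.length_append, length_encodeUnary, length_encodeTable]

theorem isHeader_encodePair : IsHeader (fun i => (encodePair A₁ A₂).getD i false) κ N₁ N₂ := by
  have h := readsAt_self (encodePair A₁ A₂)
  refine ⟨h.left.left.left.left.isUnary, ?_, ?_⟩
  · have := h.left.left.left.right.isUnary
    rwa [length_encodeUnary, zero_add] at this
  · have := h.left.left.right.isUnary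
    rwa [List.length_append, length_encodeUnary, length_encodeUnary, zero_add, ← add_assoc] at this

theorem isInput_encodePair : IsInput (fun i => (encodePair A₁ A₂).getD i false) A₁ A₂ := by
  have h := readsAt_self (encodePair A₁ A₂)
  constructor
  · convert h.left.right.isTable using 1
    simp only [List.length_append, length_encodeUnary, offset₁]
    omega
  · convert h.right.isTable using 1
    simp only [List.length_append, length_encodeUnary, length_encodeTable, offset₁, offset₂]
    omega

open Polynomial in
/-- A bound for the length of the code of a pair of automata. -/
noncomputable def lengthBound : Polynomial ℕ := 3 * X + 3 + 2 * (2 * X + X * (X * X))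

open Polynomial in
theorem length_encodePair_le : (encodePair A₁ A₂).length ≤ lengthBound.eval (N₁ + N₂ + κ) := by
  have key : ∀ {N s : ℕ}, N ≤ s → κ ≤ s → N + (N + N * (κ * N)) ≤ 2 * s + s * (s * s) :=
    fun {N s} h h' => by
      have := Nat.mul_le_mul h (Nat.mul_le_mul h' h)
      omega
  have h₁ := key (N := N₁) (s := N₁ + N₂ + κ) (by omega) (by omega)
  have h₂ := key (N := N₂) (s := N₁ + N₂ + κ) (by omega) (by omega)
  rw [length_encodePair]
  simp only [lengthBound, eval_add, eval_mul, eval_X, eval_ofNat]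
  omega

end Encoding

theorem AnswersWithin.mono {M : Turing.TM2ComputableAux Bool Bool} {w : List Bool} {b : Bool}
    {t t' : ℕ} (h : AnswersWithin M w b t) (ht : t ≤ t') : AnswersWithin M w b t' :=
  let ⟨⟨e, he⟩⟩ := h
  ⟨⟨e, he.trans ht⟩⟩

/-- The coefficients are natural numbers. -/
theorem eval_mono (p : Polynomial ℕ) {n n' : ℕ} (h : n ≤ n') : p.eval n ≤ p.eval n' := by
  rw [Polynomial.eval_eq_sum, Polynomial.eval_eq_sum]
  exact Finset.sum_le_sum fun i _ => Nat.mul_le_mul_left _ (Nat.pow_le_pow_left h i)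

end PTSep

theorem theorem1 :
    ∃ (M : Turing.TM2ComputableAux Bool Bool) (p : Polynomial ℕ),
      (∀ j : M.tm.K, Finite (M.tm.Γ j)) ∧
      ∀ (k n₁ n₂ : ℕ) (A₁ : NFA (Fin k) (Fin n₁)) (A₂ : NFA (Fin k) (Fin n₂)),
        ∃ b : Bool,
          PTSep.AnswersWithin M (PTSep.encodePair A₁ A₂) b (p.eval (n₁ + n₂ + k)) ∧
          (b = true ↔ PTSep.PTSeparable A₁.accepts A₂.accepts) ∧
          (b = true ↔ PTSep.BSigmaOneSeparable A₁.accepts A₂.accepts) := by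
  refine ⟨PTSep.machine .size .inp .out PTSep.separabilityCmd,
    (PTSep.mainCost PTSep.separabilityCmd).comp PTSep.lengthBound,
    fun _ => inferInstanceAs (Finite Bool), fun k n₁ n₂ A₁ A₂ => ?_⟩
  have hlen := PTSep.length_encodePair A₁ A₂
  have hinp : PTSep.inputMem PTSep.Arr.inp (PTSep.encodePair A₁ A₂) .inp =
      fun i => (PTSep.encodePair A₁ A₂).getD i false := funext fun _ => if_pos rfl
  have hb := PTSep.run_separabilityCmd (A₁ := A₁) (A₂ := A₂)
    (env := PTSep.sizeEnv .size (PTSep.encodePair A₁ A₂).length)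
    (m := PTSep.inputMem .inp (PTSep.encodePair A₁ A₂))
    -- Each size is strictly below the length of the code, thanks to the end marks, so the search
    -- over sizes finds it.
    (by rw [PTSep.sizeEnv, Function.update_self]; omega)
    (by rw [PTSep.sizeEnv, Function.update_self]; omega)
    (by rw [PTSep.sizeEnv, Function.update_self]; omega)
    (by rw [hinp]; exact PTSep.isHeader_encodePair A₁ A₂)
    (by rw [hinp]; exact PTSep.isInput_encodePair A₁ A₂)
  refine ⟨_, (PTSep.machine_answersWithin .size .inp .out PTSep.separabilityCmd
    PTSep.wf_separabilityCmd (PTSep.encodePair A₁ A₂)).mono ?_, ?_, ?_⟩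
  -- The cost is polynomial in the length of the code, and this length is polynomial in the sizes.
  · rw [Polynomial.eval_comp]
    exact PTSep.eval_mono _ (PTSep.length_encodePair_le A₁ A₂)
  · rw [hb, PTSep.ptSeparable_iff]
  · rw [hb, PTSep.bSigmaOneSeparable_iff]
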